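/- All operads are symmetric coloured operads in the category of abelian groups, with set of colours $\mathbb N=\{0,1,2,\dots\}$; an operation with inputs of colours $k_1,\dots,k_n$ and output colour $l$ is said to have type $(l;k_1,\dots,k_n)$, $n\ge 0$. **The operad $T$.** Let $U=\mathbb Z\langle x_1,x_2,x_3,\dots\rangle$ be the free unital associative ring on countably many generators, and let $C^k(U;U)=\mathrm{Lin}(U^{\otimes k},U)$ be its Hochschild cochains, $k\ge 0$. Let $T$ be the suboperad of the endomorphism operad of the $\mathbb N$-coloured collection $\{C^k(U;U)\}_{k\ge 0}$ generated (under identities, operadic composition, permutation of the arguments $f_1,\dots,f_n$ of an operation, and $\mathbb Z$-linear combinations) by the following elementary operations: the insertions $\circ_i:C^k(U;U)\otimes C^l(U;U)\to C^{k+l-1}(U;U)$, $1\le i\le k$, $l\ge 0$, $$(f\circ_i g)(a_1,\dots,a_{k+l-1})=f(a_1,\dots,a_{i-1},g(a_i,\dots,a_{i+l-1}),a_{i+l},\dots,a_{k+l-1}),$$ and the constants $\mu\in C^2(U;U)$ (the product), $\mathrm{id}\in C^1(U;U)$ and $1\in C^0(U;U)$ (the unit). Permutations of the inputs of a cochain are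 not among the generators. **The operad $\check T$.** Consider pairs $(V,M)$ of a (not necessarily symmetric) monoidal category $V$ enriched in abelian groups, with biadditive tensor product, and a unital monoid $M$ in $V$. Morphisms $(V,M)\to(W,N)$ are additive strong monoidal functors $F:V\to W$ together with an isomorphism of monoids $F(M)\cong N$; such a morphism induces homomorphisms $V(M^{\otimes k},M)\to W(N^{\otimes k},N)$, $k \geq 0$. Let $\check T^{\,l}_{k_1,\dots,k_n}$ be the abelian group of families of linear maps $$\alpha_{(V,M)}:V(M^{\otimes k_1},M)\otimes\cdots\otimes V(M^{\otimes k_n},M)\to V(M^{\otimes l},M),$$ indexed by all pairs $(V,M)$, that commute with the maps induced by all morphisms of pairs. With componentwise composition these groups form an $\mathbb N$-coloured operad $\check T$. **Theorem.** The $\mathbb N$-coloured operads $T$ and $\check T$ are naturally isomorphic: there is an isomorphism of $\mathbb N$-coloured operads $\Phi:T\to\check T$, and exactly one such, that sends the insertions $\circ_i$ to the natural operations $(f,g)\mapsto f\circ(\mathrm{id}_M^{\otimes (i-1)}\otimes g\otimes \mathrm{id}_M^{\otimes (k-i)})$, and $\mu$, $\mathrm{id}$, $1$ to the natural constants given by the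 multiplication $M\otimes M\to M$, the identity $M\to M$ and the unit $\mathbf 1\to M$ of the monoid $M$. -/

import Mathlib

open CategoryTheory MonoidalCategory

/-! ## Coloured operads in abelian groups -/

/-- A symmetric `C`-coloured operad in the category of abelian groups, in coordinate-free form:
the inputs of an operation are indexed by an arbitrary finite type `I` instead of `{1, ..., n}`.
`Op I k l` is the abelian group of operations with an input of colour `k i` for each `i : I`
and with output colour `l`. The group structure is over the integers, so multilinear means
additive in each variable. -/
structure ColOperad.{w, u} (C : Type u) where
  Op : (I : Type) → [Finite I] → (I → C) → C → Type w
  [grp : ∀ (I : Type) [Finite I] (k : I → C) (l : C), AddCommGroup (Op I k l)]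
  /-- the identity operation of colour `c` -/
  one : (c : C) → Op Unit (fun _ => c) c
  /-- simultaneous composition: the operation `y i` is plugged into the input `i` of `x` -/
  comp : {I : Type} → [Finite I] → {J : I → Type} → [∀ i, Finite (J i)] → {k : I → C} →
    {m : (i : I) → J i → C} → {l : C} → Op I k l → ((i : I) → Op (J i) (m i) (k i)) →
    Op (Σ i, J i) (fun p => m p.1 p.2) l
  /-- relabelling of the inputs along a bijection (for `I = J`, the symmetric group action) -/
  act : {I J : Type} → [Finite I] → [Finite J] → (e : I ≃ J) → {k : J → C} → {l : C} →
    Op I (fun i => k (e i)) l → Op J k l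
  act_add : ∀ {I J : Type} [Finite I] [Finite J] (e : I ≃ J) {k : J → C} {l : C}
    (x x' : Op I (fun i => k (e i)) l), act e (x + x') = act (k := k) e x + act e x'
  comp_add : ∀ {I : Type} [Finite I] {J : I → Type} [∀ i, Finite (J i)] {k : I → C}
    {m : (i : I) → J i → C} {l : C} (x x' : Op I k l) (y : (i : I) → Op (J i) (m i) (k i)),
    comp (x + x') y = comp x y + comp x' y
  comp_update_add : ∀ {I : Type} [Finite I] [DecidableEq I] {J : I → Type} [∀ i, Finite (J i)]
    {k : I → C} {m : (i : I) → J i → C} {l : C} (x : Op I k l)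
    (y : (i : I) → Op (J i) (m i) (k i)) (i : I) (a b : Op (J i) (m i) (k i)),
    comp x (Function.update y i (a + b)) =
      comp x (Function.update y i a) + comp x (Function.update y i b)
  act_refl : ∀ {I : Type} [Finite I] {k : I → C} {l : C} (x : Op I k l),
    act (Equiv.refl I) x = x
  act_trans : ∀ {I J K : Type} [Finite I] [Finite J] [Finite K] (e : I ≃ J) (f : J ≃ K)
    {k : K → C} {l : C} (x : Op I (fun i => k (f (e i))) l),
    act (k := k) (e.trans f) x = act f (act (k := fun j => k (f j)) e x)
  one_comp : ∀ {J : Type} [Finite J] {m : J → C} {l : C} (y : Op J m l),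
    act (k := m) (⟨fun p => p.2, fun j => ⟨(), j⟩, fun _ => rfl, fun _ => rfl⟩ :
      (Σ _ : Unit, J) ≃ J) (comp (one l) (fun _ => y)) = y
  comp_one : ∀ {I : Type} [Finite I] {k : I → C} {l : C} (x : Op I k l),
    act (k := k) (⟨fun p => p.1, fun i => ⟨i, ()⟩, fun _ => rfl, fun _ => rfl⟩ :
      (Σ _ : I, Unit) ≃ I) (comp x (fun i => one (k i))) = x
  comp_assoc : ∀ {I : Type} [Finite I] {J : I → Type} [∀ i, Finite (J i)]
    {K : (i : I) → J i → Type} [∀ i j, Finite (K i j)] {k : I → C} {m : (i : I) → J i → C}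
    {n : (i : I) → (j : J i) → K i j → C} {l : C} (x : Op I k l)
    (y : (i : I) → Op (J i) (m i) (k i)) (z : (i : I) → (j : J i) → Op (K i j) (n i j) (m i j)),
    act (k := fun q : (Σ i, Σ j, K i j) => n q.1 q.2.1 q.2.2) (Equiv.sigmaAssoc K)
      (comp (comp x y) (fun p => z p.1 p.2)) = comp x (fun i => comp (y i) (z i))
  /-- equivariance with respect to the inputs of the outer operation -/
  act_comp : ∀ {I I' : Type} [Finite I] [Finite I'] (e : I' ≃ I) {J : I → Type}
    [∀ i, Finite (J i)] {k : I → C} {m : (i : I) → J i → C} {l : C}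
    (x : Op I' (fun i => k (e i)) l) (y : (i : I) → Op (J i) (m i) (k i)),
    comp (act (k := k) e x) y =
      act (k := fun p : (Σ i, J i) => m p.1 p.2) (Equiv.sigmaCongrLeft e)
        (comp x (fun i' => y (e i')))
  /-- equivariance with respect to the inputs of the inner operations -/
  comp_act : ∀ {I : Type} [Finite I] {J J' : I → Type} [∀ i, Finite (J i)] [∀ i, Finite (J' i)]
    (e : (i : I) → J' i ≃ J i) {k : I → C} {m : (i : I) → J i → C} {l : C} (x : Op I k l)
    (y : (i : I) → Op (J' i) (fun j => m i (e i j)) (k i)),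
    comp x (fun i => act (k := m i) (e i) (y i)) =
      act (k := fun p : (Σ i, J i) => m p.1 p.2) (Equiv.sigmaCongrRight e) (comp x y)

namespace ColOperad

attribute [instance] ColOperad.grp

universe w w' u

variable {C : Type u}

/-- An isomorphism of `C`-coloured operads. -/
structure Iso (P : ColOperad.{w} C) (Q : ColOperad.{w'} C) where
  toEquiv : (I : Type) → [Finite I] → (k : I → C) → (l : C) → P.Op I k l ≃+ Q.Op I k l
  map_one : ∀ c : C, toEquiv Unit (fun _ => c) c (P.one c) = Q.one c
  map_comp : ∀ {I : Type} [Finite I] {J : I → Type} [∀ i, Finite (J i)] {k : I → C}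
    {m : (i : I) → J i → C} {l : C} (x : P.Op I k l) (y : (i : I) → P.Op (J i) (m i) (k i)),
    toEquiv (Σ i, J i) (fun p => m p.1 p.2) l (P.comp x y) =
      Q.comp (toEquiv I k l x) (fun i => toEquiv (J i) (m i) (k i) (y i))
  map_act : ∀ {I J : Type} [Finite I] [Finite J] (e : I ≃ J) {k : J → C} {l : C}
    (x : P.Op I (fun i => k (e i)) l),
    toEquiv J k l (P.act e x) = Q.act e (toEquiv I (fun i => k (e i)) l x)

/-- A suboperad: subgroups containing the identities, closed under composition and relabelling. -/
structure Suboperad (P : ColOperad.{w} C) where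
  carrier : (I : Type) → [Finite I] → (k : I → C) → (l : C) → AddSubgroup (P.Op I k l)
  one_mem : ∀ c : C, P.one c ∈ carrier Unit (fun _ => c) c
  comp_mem : ∀ {I : Type} [Finite I] {J : I → Type} [∀ i, Finite (J i)] {k : I → C}
    {m : (i : I) → J i → C} {l : C} (x : P.Op I k l) (y : (i : I) → P.Op (J i) (m i) (k i)),
    x ∈ carrier I k l → (∀ i, y i ∈ carrier (J i) (m i) (k i)) →
      P.comp x y ∈ carrier (Σ i, J i) (fun p => m p.1 p.2) l
  act_mem : ∀ {I J : Type} [Finite I] [Finite J] (e : I ≃ J) {k : J → C} {l : C}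
    (x : P.Op I (fun i => k (e i)) l),
    x ∈ carrier I (fun i => k (e i)) l → P.act e x ∈ carrier J k l

/-- A suboperad, regarded as an operad. -/
def Suboperad.toOperad {P : ColOperad.{w} C} (S : P.Suboperad) : ColOperad.{w} C where
  Op I _ k l := S.carrier I k l
  grp _ _ _ _ := inferInstance
  one c := ⟨P.one c, S.one_mem c⟩
  comp x y := ⟨P.comp x.1 (fun i => (y i).1), S.comp_mem _ _ x.2 (fun i => (y i).2)⟩
  act e _ _ x := ⟨P.act e x.1, S.act_mem e _ x.2⟩
  act_add e _ _ x x' := Subtype.ext (P.act_add e x.1 x'.1)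
  comp_add x x' y := Subtype.ext (P.comp_add x.1 x'.1 _)
  comp_update_add {I _ _ J _ k m l} x y i a b := by
    have h : ∀ c : S.carrier (J i) (m i) (k i), (fun j => (Function.update y i c j).1) =
        Function.update (fun j => (y j).1) i c.1 := fun c => by
      funext j
      exact Function.apply_update (fun j (t : S.carrier (J j) (m j) (k j)) => t.1) y i c j
    apply Subtype.ext
    simp only [AddSubgroup.coe_add, h]
    exact P.comp_update_add x.1 _ i a.1 b.1
  act_refl x := Subtype.ext (P.act_refl x.1)
  act_trans e f _ _ x := Subtype.ext (P.act_trans e f x.1)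
  one_comp y := Subtype.ext (P.one_comp y.1)
  comp_one x := Subtype.ext (P.comp_one x.1)
  comp_assoc x y z :=
    Subtype.ext (P.comp_assoc x.1 (fun i => (y i).1) (fun i j => (z i j).1))
  act_comp e _ _ _ _ _ x y := Subtype.ext (P.act_comp e x.1 (fun i => (y i).1))
  comp_act e _ _ _ x y := Subtype.ext (P.comp_act e x.1 (fun i => (y i).1))

/-- The operations obtained from those in `S` and the identities by finitely many compositions,
relabellings of inputs, and integral linear combinations. -/
inductive Generated (P : ColOperad.{w} C)
    (S : (I : Type) → [Finite I] → (k : I → C) → (l : C) → P.Op I k l → Prop) :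
    (I : Type) → [Finite I] → (k : I → C) → (l : C) → P.Op I k l → Prop
  | basic (I : Type) [Finite I] (k : I → C) (l : C) (x : P.Op I k l) (h : S I k l x) :
      Generated P S I k l x
  | one (c : C) : Generated P S Unit (fun _ => c) c (P.one c)
  | comp (I : Type) [Finite I] (J : I → Type) [∀ i, Finite (J i)] (k : I → C)
      (m : (i : I) → J i → C) (l : C) (x : P.Op I k l) (y : (i : I) → P.Op (J i) (m i) (k i))
      (hx : Generated P S I k l x) (hy : ∀ i, Generated P S (J i) (m i) (k i) (y i)) :
      Generated P S (Σ i, J i) (fun p => m p.1 p.2) l (P.comp x y)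
  | act (I J : Type) [Finite I] [Finite J] (e : I ≃ J) (k : J → C) (l : C)
      (x : P.Op I (fun i => k (e i)) l) (hx : Generated P S I (fun i => k (e i)) l x) :
      Generated P S J k l (P.act e x)
  | zero (I : Type) [Finite I] (k : I → C) (l : C) : Generated P S I k l 0
  | add (I : Type) [Finite I] (k : I → C) (l : C) (x y : P.Op I k l)
      (hx : Generated P S I k l x) (hy : Generated P S I k l y) : Generated P S I k l (x + y)
  | neg (I : Type) [Finite I] (k : I → C) (l : C) (x : P.Op I k l)
      (hx : Generated P S I k l x) : Generated P S I k l (-x)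

/-- The suboperad generated by `S`. -/
def closure (P : ColOperad.{w} C)
    (S : (I : Type) → [Finite I] → (k : I → C) → (l : C) → P.Op I k l → Prop) :
    P.Suboperad where
  carrier I _ k l :=
    { carrier := {x | Generated P S I k l x}
      add_mem' := fun hx hy => Generated.add _ _ _ _ _ hx hy
      zero_mem' := Generated.zero _ _ _
      neg_mem' := fun hx => Generated.neg _ _ _ _ hx }
  one_mem c := Generated.one c
  comp_mem x y hx hy := Generated.comp _ _ _ _ _ x y hx hy
  act_mem e _ _ x hx := Generated.act _ _ e _ _ x hx

/-- The endomorphism operad of a collection `X` of abelian groups indexed by the colours: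
operations are the multilinear maps `⨂ X (k i) → X l`. -/
def endOperad (X : C → Type w) [∀ c, AddCommGroup (X c)] : ColOperad.{w} C where
  Op I _ k l := MultilinearMap ℤ (fun i : I => X (k i)) (X l)
  grp _ _ _ _ := inferInstance
  one c := LinearMap.id.compMultilinearMap
    { toFun := fun x => x ()
      map_update_add' := by intro _ m i x y; cases i; simp
      map_update_smul' := by intro _ m i a x; cases i; simp }
  comp x y := x.compMultilinearMap y
  act {I J} _ _ e k l x :=
    { toFun := fun v => x (fun i => v (e i))
      map_update_add' := by
        classical
        intro _ v j a b
        obtain ⟨i, rfl⟩ := e.surjective j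
        have h : ∀ c : X (k (e i)), (fun i' => Function.update v (e i) c (e i')) =
            Function.update (fun i' => v (e i')) i c := fun c => by
          funext i'
          by_cases hi : i' = i
          · subst hi; simp
          · simp [hi]
        simp only [h]
        exact x.map_update_add _ i a b
      map_update_smul' := by
        classical
        intro _ v j c a
        obtain ⟨i, rfl⟩ := e.surjective j
        have h : ∀ c : X (k (e i)), (fun i' => Function.update v (e i) c (e i')) =
            Function.update (fun i' => v (e i')) i c := fun c => by
          funext i'
          by_cases hi : i' = i
          · subst hi; simp
          · simp [hi]
        simp only [h]
        exact x.map_update_smul _ i c a }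
  act_add _ _ _ _ _ := rfl
  comp_add _ _ _ := rfl
  comp_update_add {I _ _ J _ k m l} x y i a b := by
    ext v
    have h : ∀ c : MultilinearMap ℤ (fun j : J i => X (m i j)) (X (k i)),
        (fun j => (Function.update y i c j) (fun b => v ⟨j, b⟩)) =
        Function.update (fun j => y j (fun b => v ⟨j, b⟩)) i (c (fun b => v ⟨i, b⟩)) :=
        fun c => by
      funext j
      exact Function.apply_update
        (fun j (t : MultilinearMap ℤ (fun b : J j => X (m j b)) (X (k j))) =>
          t (fun b => v ⟨j, b⟩)) y i c j
    change x (fun j => (Function.update y i (a + b) j) (fun b => v ⟨j, b⟩)) =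
      x (fun j => (Function.update y i a j) (fun b => v ⟨j, b⟩)) +
      x (fun j => (Function.update y i b j) (fun b => v ⟨j, b⟩))
    simp only [h]
    exact x.map_update_add _ i _ _
  act_refl _ := rfl
  act_trans _ _ _ _ _ := rfl
  one_comp _ := rfl
  comp_one _ := rfl
  comp_assoc _ _ _ := rfl
  act_comp _ _ _ _ _ _ _ _ := rfl
  comp_act _ _ _ _ _ _ := rfl

/-- The product of a family of operads. -/
def pi {ι : Type w'} (P : ι → ColOperad.{w} C) : ColOperad.{max w w'} C where
  Op I _ k l := ∀ a, (P a).Op I k l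
  grp _ _ _ _ := inferInstance
  one c a := (P a).one c
  comp x y a := (P a).comp (x a) (fun i => y i a)
  act e _ _ x a := (P a).act e (x a)
  act_add e _ _ x x' := funext fun a => (P a).act_add e (x a) (x' a)
  comp_add x x' y := funext fun a => (P a).comp_add (x a) (x' a) _
  comp_update_add {I _ _ J _ k m l} x y i b b' := by
    funext a
    have h : ∀ c : (∀ a, (P a).Op (J i) (m i) (k i)), (fun j => Function.update y i c j a) =
        Function.update (fun j => y j a) i (c a) := fun c => by
      funext j
      exact Function.apply_update (fun j (t : ∀ a, (P a).Op (J j) (m j) (k j)) => t a) y i c j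
    simp only [Pi.add_apply, h]
    exact (P a).comp_update_add (x a) _ i (b a) (b' a)
  act_refl x := funext fun a => (P a).act_refl (x a)
  act_trans e f _ _ x := funext fun a => (P a).act_trans e f (x a)
  one_comp y := funext fun a => (P a).one_comp (y a)
  comp_one x := funext fun a => (P a).comp_one (x a)
  comp_assoc x y z :=
    funext fun a => (P a).comp_assoc (x a) (fun i => y i a) (fun i j => z i j a)
  act_comp e _ _ _ _ _ x y := funext fun a => (P a).act_comp e (x a) (fun i => y i a)
  comp_act e _ _ _ x y := funext fun a => (P a).comp_act e (x a) (fun i => y i a)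

/-- A constant `c : X l` as an operation without inputs. -/
def constOp {X : C → Type w} [∀ c, AddCommGroup (X c)] {l : C} (c : X l) :
    (endOperad X).Op (Fin 0) ![] l :=
  MultilinearMap.constOfIsEmpty ℤ _ c

/-- A bilinear map as an operation with two inputs. -/
def bilinOp {X : C → Type w} [∀ c, AddCommGroup (X c)] {k₁ k₂ l : C}
    (B : X k₁ →+ X k₂ →+ X l) : (endOperad X).Op (Fin 2) ![k₁, k₂] l :=
  show MultilinearMap ℤ (fun i : Fin 2 => X (![k₁, k₂] i)) (X l) from
  MultilinearMap.mk' (fun v => B (v 0) (v 1))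
    (by
      intro v i x y
      fin_cases i
      · exact (congrArg (fun t => t (v 1)) (B.map_add x y))
      · exact ((B (v 0)).map_add x y))
    (by
      intro v i c x
      fin_cases i
      · exact (congrArg (fun t => t (v 1)) (B.map_zsmul c x))
      · exact ((B (v 0)).map_zsmul c x))

end ColOperad

/-! ## Elementary operations on Hochschild cochains -/

/-- The Hochschild cochains `C^k(A; A)` of a unital associative ring `A`, i.e. the linear maps
`A^{⊗ k} → A`. -/
abbrev Hoch.{w} (A : Type w) [Ring A] (k : ℕ) : Type w := MultilinearMap ℤ (fun _ : Fin k => A) A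

namespace Hoch

universe w

variable {A : Type w} [Ring A]

/-- The arguments `(x₁, ..., x_a, g(x_{a+1}, ..., x_{a+l}), x_{a+l+1}, ..., x_{a+l+b})`. -/
def insertArgs (a l b : ℕ) (g : Hoch A l) (x : Fin (a + l + b) → A) : Fin (a + 1 + b) → A :=
  Fin.append
    (Fin.append (fun i => x (Fin.castAdd b (Fin.castAdd l i)))
      (fun _ : Fin 1 => g fun j => x (Fin.castAdd b (Fin.natAdd a j))))
    (fun j => x (Fin.natAdd (a + l) j))

theorem castAdd_ne_natAdd {m n : ℕ} (i : Fin m) (j : Fin n) : Fin.castAdd n i ≠ Fin.natAdd m j := by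
  intro h
  have := congrArg Fin.val h
  simp at this
  omega

theorem insertArgs_update (a l b : ℕ) (g : Hoch A l) (x : Fin (a + l + b) → A)
    (p : Fin (a + l + b)) : ∃ (q : Fin (a + 1 + b)) (φ : A →ₗ[ℤ] A), ∀ c : A,
      insertArgs a l b g (Function.update x p c) =
        Function.update (insertArgs a l b g x) q (φ c) := by
  have ne1 := @castAdd_ne_natAdd
  have ne2 : ∀ {m n : ℕ} (i : Fin m) (j : Fin n), Fin.natAdd m j ≠ Fin.castAdd n i :=
    fun i j => (castAdd_ne_natAdd i j).symm
  induction p using Fin.addCases with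
  | right j =>
    refine ⟨Fin.natAdd (a + 1) j, LinearMap.id, fun c => ?_⟩
    funext q
    induction q using Fin.addCases with
    | left q =>
      induction q using Fin.addCases <;> simp [insertArgs, Function.update_apply, ne1]
    | right j' => simp [insertArgs, Function.update_apply]
  | left p =>
    induction p using Fin.addCases with
    | left i =>
      refine ⟨Fin.castAdd b (Fin.castAdd 1 i), LinearMap.id, fun c => ?_⟩
      funext q
      induction q using Fin.addCases with
      | left q =>
        induction q using Fin.addCases <;> simp [insertArgs, Function.update_apply, ne2]
      | right j' => simp [insertArgs, Function.update_apply, ne2]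
    | right j =>
      refine ⟨Fin.castAdd b (Fin.natAdd a 0),
        g.toLinearMap (fun j => x (Fin.castAdd b (Fin.natAdd a j))) j, fun c => ?_⟩
      funext q
      induction q using Fin.addCases with
      | left q =>
        induction q using Fin.addCases with
        | left i => simp [insertArgs, Function.update_apply, ne1]
        | right j' =>
          obtain rfl : j' = 0 := Subsingleton.elim _ _
          simp only [insertArgs, Fin.append_left, Fin.append_right, Function.update_self,
            MultilinearMap.toLinearMap_apply]
          congr 1
          funext j'
          simp [Function.update_apply]
      | right j' => simp [insertArgs, Function.update_apply, ne2]

theorem insertArgs_eq (a l b : ℕ) (g : Hoch A l) (x : Fin (a + l + b) → A) :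
    insertArgs a l b g x = Function.update (insertArgs a l b 0 x) (Fin.castAdd b (Fin.natAdd a 0))
      (g fun j => x (Fin.castAdd b (Fin.natAdd a j))) := by
  funext q
  induction q using Fin.addCases with
  | left q =>
    induction q using Fin.addCases with
    | left i => simp [insertArgs, castAdd_ne_natAdd]
    | right j =>
      obtain rfl : j = 0 := Subsingleton.elim _ _
      simp [insertArgs]
  | right j => simp [insertArgs, (castAdd_ne_natAdd _ _).symm]

/-- The insertion `f ∘_{a+1} g` of a cochain `g` into the input `a + 1` of a cochain `f` with
`a + 1 + b` inputs:
`(x₁, ..., x_{a+l+b}) ↦ f(x₁, ..., x_a, g(x_{a+1}, ..., x_{a+l}), x_{a+l+1}, ..., x_{a+l+b})`. -/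
def insert (a l b : ℕ) : Hoch A (a + 1 + b) →+ Hoch A l →+ Hoch A (a + l + b) :=
  AddMonoidHom.mk' (fun f => AddMonoidHom.mk' (fun g =>
      MultilinearMap.mk' (fun x => f (insertArgs a l b g x))
        (by
          intro x p c c'
          obtain ⟨q, φ, h⟩ := insertArgs_update a l b g x p
          simp only [h, map_add]
          exact f.map_update_add _ q _ _)
        (by
          intro x p t c
          obtain ⟨q, φ, h⟩ := insertArgs_update a l b g x p
          simp only [h, map_smul]
          exact f.map_update_smul _ q _ _))
      (by
        intro g g'
        ext x
        change f _ = f _ + f _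
        rw [insertArgs_eq a l b (g + g'), insertArgs_eq a l b g, insertArgs_eq a l b g']
        exact f.map_update_add _ _ _ _))
    (fun _ _ => rfl)

/-- The product `(x, y) ↦ x * y` of `A` as a cochain. -/
def mul : Hoch A 2 := MultilinearMap.mkPiAlgebraFin ℤ 2 A

/-- The identity `x ↦ x` of `A` as a cochain. -/
def id : Hoch A 1 := MultilinearMap.mkPiAlgebraFin ℤ 1 A

/-- The unit `1` of `A` as a cochain. -/
def one : Hoch A 0 := MultilinearMap.mkPiAlgebraFin ℤ 0 A

theorem mul_apply (x : Fin 2 → A) : (mul : Hoch A 2) x = x 0 * x 1 := by simp [mul]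

theorem id_apply (x : Fin 1 → A) : (id : Hoch A 1) x = x 0 := by simp [id]

theorem one_apply (x : Fin 0 → A) : (one : Hoch A 0) x = 1 := by simp [one]

variable (A) in
/-- The elementary operations on the Hochschild cochains of `A`, permutations of the inputs of
cochains excluded: the insertions and the constants given by the product, the identity and the
unit. -/
inductive IsElementary : (I : Type) → [Finite I] → (k : I → ℕ) → (l : ℕ) →
    (ColOperad.endOperad (Hoch A)).Op I k l → Prop
  | insert (a l b : ℕ) :
      IsElementary (Fin 2) ![a + 1 + b, l] (a + l + b) (ColOperad.bilinOp (insert a l b))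
  | mul : IsElementary (Fin 0) ![] 2 (ColOperad.constOp mul)
  | id : IsElementary (Fin 0) ![] 1 (ColOperad.constOp id)
  | one : IsElementary (Fin 0) ![] 0 (ColOperad.constOp one)

variable (A) in
/-- The `ℕ`-coloured operad `T(A)` of natural operations on the Hochschild cochains of `A`
generated by the elementary operations without permutations. -/
def operadT : ColOperad.{w} ℕ :=
  ((ColOperad.endOperad (Hoch A)).closure (IsElementary A)).toOperad

/-- The insertion as an element of `T(A)`. -/
def insertT (a l b : ℕ) : (operadT A).Op (Fin 2) ![a + 1 + b, l] (a + l + b) :=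
  ⟨_, .basic _ _ _ _ (.insert a l b)⟩

/-- The product as an element of `T(A)`. -/
def mulT : (operadT A).Op (Fin 0) ![] 2 := ⟨_, .basic _ _ _ _ .mul⟩

/-- The identity cochain as an element of `T(A)`. -/
def idT : (operadT A).Op (Fin 0) ![] 1 := ⟨_, .basic _ _ _ _ .id⟩

/-- The unit as an element of `T(A)`. -/
def oneT : (operadT A).Op (Fin 0) ![] 0 := ⟨_, .basic _ _ _ _ .one⟩

end Hoch

/-- The free unital associative ring on countably many generators (a generic algebra). -/
abbrev GenericRing : Type := FreeAlgebra ℤ ℕ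

/-- The `ℕ`-coloured operad `T`: the operad of natural operations, generated by the elementary
operations without permutations, on the Hochschild cochains of the generic algebra. -/
abbrev operadT : ColOperad.{0} ℕ := Hoch.operadT GenericRing

/-! ## Natural operations on monoids in nonsymmetric monoidal categories -/

/-- The left-bracketed tensor power `(((𝟙 ⊗ M) ⊗ M) ⊗ ⋯) ⊗ M`. -/
def tpow {V : Type*} [Category V] [MonoidalCategory V] (M : V) : ℕ → V
  | 0 => 𝟙_ V
  | n + 1 => tpow M n ⊗ M

/-- The canonical isomorphism `M^{⊗ (a + b)} ≅ M^{⊗ a} ⊗ M^{⊗ b}`. -/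
def tpowAdd {V : Type*} [Category V] [MonoidalCategory V] (M : V) (a : ℕ) :
    (b : ℕ) → (tpow M (a + b) ≅ tpow M a ⊗ tpow M b)
  | 0 => (ρ_ (tpow M a)).symm
  | b + 1 => whiskerRightIso (tpowAdd M a b) M ≪≫ α_ (tpow M a) (tpow M b) M

/-- A pair `(V, M)` of a monoidal category `V` enriched in abelian groups (not assumed to be
symmetric or braided) and a unital monoid `M` in `V`. -/
structure MonPair.{v, u} where
  V : Type u
  [cat : Category.{v} V]
  [preadditive : Preadditive V]
  [monoidal : MonoidalCategory V]
  [monoidalPreadditive : MonoidalPreadditive V]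
  M : Mon V

namespace MonPair

universe v u

attribute [instance] MonPair.cat MonPair.preadditive MonPair.monoidal MonPair.monoidalPreadditive

/-- A morphism `(V, M) → (W, N)`: an additive (strong) monoidal functor `F : V ⥤ W` preserving the
distinguished monoids, i.e. with an identification `F M ≅ N` of monoids. -/
structure Hom (P Q : MonPair.{v, u}) where
  F : P.V ⥤ Q.V
  [additive : F.Additive]
  [monoidal : F.Monoidal]
  iso : F.mapMon.obj P.M ≅ Q.M

attribute [instance] Hom.additive Hom.monoidal

/-- The abelian group `V(M^{⊗ k}, M)`. -/
abbrev End (P : MonPair.{v, u}) (k : ℕ) : Type v := tpow P.M.X k ⟶ P.M.X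

/-- The canonical map `N^{⊗ k} → F (M^{⊗ k})`. -/
def Hom.tpowMap {P Q : MonPair.{v, u}} (F : Hom P Q) :
    (k : ℕ) → (tpow Q.M.X k ⟶ F.F.obj (tpow P.M.X k))
  | 0 => Functor.LaxMonoidal.ε F.F
  | k + 1 => (F.tpowMap k ⊗ₘ F.iso.inv.hom) ≫ Functor.LaxMonoidal.μ F.F (tpow P.M.X k) P.M.X

/-- The map `V(M^{⊗ k}, M) → W(N^{⊗ k}, N)` induced by a morphism `(V, M) → (W, N)`. -/
def Hom.map {P Q : MonPair.{v, u}} (F : Hom P Q) (k : ℕ) : P.End k →+ Q.End k :=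
  AddMonoidHom.mk' (fun f => F.tpowMap k ≫ F.F.map f ≫ F.iso.hom.hom) (by
    intro f g
    rw [F.F.map_add]
    exact (congrArg (F.tpowMap k ≫ ·) (Preadditive.add_comp _ _ _ _ _ _)).trans
      (Preadditive.comp_add _ _ _ _ _ _))

/-- The insertion of `g : M^{⊗ l} → M` into the input `a + 1` of `f : M^{⊗ (a + 1 + b)} → M`. -/
def insert (P : MonPair.{v, u}) (a l b : ℕ) :
    P.End (a + 1 + b) →+ P.End l →+ P.End (a + l + b) :=
  AddMonoidHom.mk' (fun f => AddMonoidHom.mk' (fun g =>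
      (tpowAdd P.M.X (a + l) b).hom ≫
        ((tpowAdd P.M.X a l).hom ≫ tpow P.M.X a ◁ g) ▷ tpow P.M.X b ≫
          (tpowAdd P.M.X (a + 1) b).inv ≫ f)
      (by intro g g'; simp))
    (by
      intro f f'
      ext g
      simp only [AddMonoidHom.mk'_apply, AddMonoidHom.add_apply]
      rw [← Preadditive.comp_add]
      congr 1
      exact (congrArg (_ ≫ ·) (Preadditive.comp_add _ _ _ _ _ _)).trans
        (Preadditive.comp_add _ _ _ _ _ _))

/-- The multiplication of `M` as a morphism `M^{⊗ 2} → M`. -/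
def mul (P : MonPair.{v, u}) : P.End 2 := (λ_ P.M.X).hom ▷ P.M.X ≫ MonObj.mul

/-- The identity of `M` as a morphism `M^{⊗ 1} → M`. -/
def id (P : MonPair.{v, u}) : P.End 1 := (λ_ P.M.X).hom

/-- The unit of `M` as a morphism `M^{⊗ 0} → M`. -/
def one (P : MonPair.{v, u}) : P.End 0 := MonObj.one

/-- The coloured operad of all families, indexed by pairs `(V, M)`, of multilinear maps
`V(M^{⊗ k₁}, M) ⊗ ⋯ ⊗ V(M^{⊗ kₙ}, M) → V(M^{⊗ l}, M)`. -/
abbrev familyOperad : ColOperad.{max v (max (u + 1) (v + 1))} ℕ :=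
  ColOperad.pi (fun P : MonPair.{v, u} => ColOperad.endOperad P.End)

/-- The component at `(V, M)` of a family of multilinear maps. -/
def component {I : Type} [Finite I] {k : I → ℕ} {l : ℕ} (α : familyOperad.{v, u}.Op I k l)
    (P : MonPair.{v, u}) : MultilinearMap ℤ (fun i => P.End (k i)) (P.End l) := α P

/-- The suboperad of natural families of multilinear maps. -/
def naturalFamilies : familyOperad.{v, u}.Suboperad where
  carrier I _ k l :=
    { carrier := {α | ∀ (P Q : MonPair.{v, u}) (F : Hom P Q) (f : (i : I) → P.End (k i)),
        component α Q (fun i => F.map (k i) (f i)) = F.map l (component α P f)}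
      add_mem' := by
        intro α β hα hβ P Q F f
        change component α Q _ + component β Q _ = F.map l (component α P f + component β P f)
        rw [hα, hβ, map_add]
      zero_mem' := by
        intro P Q F f
        exact (map_zero (F.map l)).symm
      neg_mem' := by
        intro α hα P Q F f
        change -component α Q _ = F.map l (-component α P f)
        rw [hα, map_neg] }
  one_mem c := fun _ _ _ _ => rfl
  comp_mem {I _ J _ k m l} x y hx hy := fun P Q F f => by
    change component x Q (fun i => component (y i) Q
      (fun j => F.map (m i j) (f ⟨i, j⟩))) =
      F.map l (component x P (fun i => component (y i) P (fun j => f ⟨i, j⟩)))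
    rw [← hx P Q F]
    congr 1
    funext i
    exact hy i P Q F _
  act_mem e _ _ x hx := fun P Q F f => hx P Q F (fun i => f (e i))

/-- The `ℕ`-coloured operad `Ť` of natural operations on monoids in nonsymmetric monoidal
categories. -/
def operadTCheck : ColOperad.{max v (max (u + 1) (v + 1))} ℕ := naturalFamilies.{v, u}.toOperad

/-- The component at `(V, M)` of an element of `Ť`. -/
def evalAt {I : Type} [Finite I] {k : I → ℕ} {l : ℕ} (α : operadTCheck.{v, u}.Op I k l)
    (P : MonPair.{v, u}) : (ColOperad.endOperad P.End).Op I k l := α.1 P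

end MonPair

universe v u

/-! The inverse of `Φ` is evaluation at one pair. For the pair given by abelian groups and a ring
`A`, the groups `End k` are the Hochschild cochains of `A` (`RingPair.toHoch`), so a natural
operation becomes an operation on cochains (`toEndHoch`), compatibly with the operad structure. For
the generic ring one has to see that the image is exactly `T` and that the kernel is zero. The image
contains `T` because insertions and the three constants commute with monoidal functors
(`map_insert`, `map_mul`, `map_id`, `map_one`).

For the rest, let `genPair k` be the free preadditive monoidal category on a monoid with operations
of arities `k i`. Any operations in any pair are images of the generic ones (`evalHom_genOp`), so,
as in the Yoneda lemma, a natural operation is determined by its value at the generic operations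
(`component_eq`). Every morphism `M^{⊗ l} ⟶ M` of the free category is an integral combination of
planar normal forms, the forests: words whose letters are inputs or operations applied to tuples of
words (`conj_mem_repSpan`, resting on `IsRep.comp`). No permutations arise, since no symmetry is
available. Hence a natural operation is a combination of forests with the same coefficients in every
pair.

Over the free ring, cochains take arbitrary values on tuples of monomials. Let `g i` send a tuple to
a single generator that encodes `i` and the tuple. If all arguments are one fixed generator,
distinct forests then take distinct monomials as values (`exists_separating`), so the coefficients
can be read off and evaluation is injective. Scaling `g i` by `z i` multiplies the operation by the
product of the `z i`, but multiplies a forest by one factor `z i` for each node labelled `i`;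
comparing coefficients, every forest that occurs uses each operation exactly once (`count_eq_one`).
Such a forest is a composite of insertions and the constants (`Forest.exists_isGenerated`), so the
image lies in `T`.

Uniqueness of `Φ` holds because `T` is generated by the elementary operations. -/

/-! ### Coherence for left-bracketed tensor powers. -/

section TensorPowers

variable {V : Type*} [Category V] [MonoidalCategory V] (M : V)

/-- The identification of tensor powers with equal exponents. -/
def tpowCast {m n : ℕ} (h : m = n) : tpow M m ⟶ tpow M n := eqToHom (congrArg (tpow M) h)

@[simp] theorem tpowCast_rfl (m : ℕ) : tpowCast M (rfl : m = m) = 𝟙 _ := rfl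

theorem tpowCast_trans {m n p : ℕ} (h : m = n) (h' : n = p) :
    tpowCast M h ≫ tpowCast M h' = tpowCast M (h.trans h') := by
  subst h h'; simp

theorem tpowCast_succ {m n : ℕ} (h : m = n) (h' : m + 1 = n + 1) :
    tpowCast M h' = tpowCast M h ▷ M := by
  subst h; exact (id_whiskerRight _ _).symm

theorem tpowAdd_succ_hom (a b : ℕ) : (tpowAdd M a (b + 1)).hom =
    (tpowAdd M a b).hom ▷ M ≫ (α_ (tpow M a) (tpow M b) M).hom := rfl

/-- The two ways of cutting a tensor power into three blocks agree. The cast is unavoidable: the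
exponents `(a + b) + c` and `a + (b + c)` are equal, but not by reduction for a variable `c`. -/
theorem tpowAdd_assoc (a b c : ℕ) :
    (tpowAdd M (a + b) c).hom ≫ (tpowAdd M a b).hom ▷ tpow M c ≫ (α_ _ _ _).hom =
      tpowCast M (add_assoc a b c) ≫ (tpowAdd M a (b + c)).hom ≫
        tpow M a ◁ (tpowAdd M b c).hom := by
  induction c with
  | zero =>
    -- The identity is proved for arbitrary objects and morphisms and then specialised, since `tpow`
    -- and `tpowAdd` unfold definitionally. The same device is used throughout.
    have h : ∀ {X A B : V} (f : X ⟶ A ⊗ B), (ρ_ X).inv ≫ f ▷ 𝟙_ V ≫ (α_ _ _ _).hom =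
        𝟙 X ≫ f ≫ A ◁ (ρ_ B).inv := by intros; simp
    exact h _
  | succ c ih =>
    have h : ∀ {Y A B C D E F G : V} (p : Y ⟶ D ⊗ C) (q : D ⟶ A ⊗ B) (s : Y ⟶ E)
        (t : E ⟶ A ⊗ F) (r : F ⟶ B ⊗ C), p ≫ q ▷ C ≫ (α_ A B C).hom = s ≫ t ≫ A ◁ r →
        (p ▷ G ≫ (α_ _ _ _).hom) ≫ q ▷ (C ⊗ G) ≫ (α_ _ _ _).hom =
          s ▷ G ≫ (t ▷ G ≫ (α_ _ _ _).hom) ≫ A ◁ (r ▷ G ≫ (α_ _ _ _).hom) := by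
      intro Y A B C D E F G p q s t r h
      have h' := congrArg (fun t => t ▷ G ≫ (α_ _ _ _).hom ≫ _ ◁ (α_ _ _ _).hom) h
      simp only [comp_whiskerRight, Category.assoc] at h'
      simpa using h'
    exact (tpowCast_succ M (add_assoc a b c) _).symm ▸ h _ _ _ _ _ ih

theorem tpowAdd_zero_left (b : ℕ) :
    (tpowAdd M 0 b).hom = tpowCast M (zero_add b) ≫ (λ_ (tpow M b)).inv := by
  induction b with
  | zero => exact (unitors_inv_equal.symm.trans (Category.id_comp _).symm :
      (ρ_ (𝟙_ V)).inv = 𝟙 _ ≫ (λ_ (𝟙_ V)).inv)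
  | succ b ih =>
    rw [tpowAdd_succ_hom, ih, tpowCast_succ M (zero_add b)]
    have h : ∀ {A B : V} (f : A ⟶ B), (f ≫ (λ_ B).inv) ▷ M ≫ (α_ _ _ _).hom =
        f ▷ M ≫ (λ_ (B ⊗ M)).inv := by intros; simp
    exact h _

end TensorPowers

/-! ### The elementary operations commute with morphisms of pairs. -/

namespace MonPair
namespace Hom

variable {P Q : MonPair.{v, u}} (F : Hom P Q)

/-- The induction on `b` follows the recursion of `tpowAdd`: unitality of `F` gives the base case,
associativity of its structure maps the step. -/
theorem tpowMap_add (a b : ℕ) :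
    F.tpowMap (a + b) ≫ F.F.map (tpowAdd P.M.X a b).hom =
      (tpowAdd Q.M.X a b).hom ≫ (F.tpowMap a ⊗ₘ F.tpowMap b) ≫
        Functor.LaxMonoidal.μ F.F (tpow P.M.X a) (tpow P.M.X b) := by
  induction b with
  | zero =>
    have h : ∀ {X : Q.V} {A : P.V} (f : X ⟶ F.F.obj A), f ≫ F.F.map (ρ_ A).inv =
      (ρ_ X).inv ≫ (f ⊗ₘ Functor.LaxMonoidal.ε F.F) ≫ Functor.LaxMonoidal.μ F.F A (𝟙_ _) := by
      intros; simp [MonoidalCategory.tensorHom_def]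
    exact h _
  | succ b ih =>
    have h : ∀ {X Y Z N : Q.V} {A B C D : P.V} (p : X ⟶ F.F.obj D) (q : D ⟶ A ⊗ B) (t : X ⟶ Y ⊗ Z)
        (x : Y ⟶ F.F.obj A) (y : Z ⟶ F.F.obj B) (z : N ⟶ F.F.obj C),
        p ≫ F.F.map q = t ≫ (x ⊗ₘ y) ≫ Functor.LaxMonoidal.μ F.F A B →
        ((p ⊗ₘ z) ≫ Functor.LaxMonoidal.μ F.F D C) ≫ F.F.map (q ▷ C ≫ (α_ _ _ _).hom) =
        (t ▷ N ≫ (α_ _ _ _).hom) ≫ (x ⊗ₘ ((y ⊗ₘ z) ≫ Functor.LaxMonoidal.μ F.F B C)) ≫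
          Functor.LaxMonoidal.μ F.F A (B ⊗ C) := by
      intro X Y Z N A B C D p q t x y z h
      have h' := congrArg (fun w => (w ⊗ₘ z) ≫ Functor.LaxMonoidal.μ F.F (A ⊗ B) C ≫
        F.F.map (α_ _ _ _).hom) h
      trans ((p ≫ F.F.map q) ⊗ₘ z) ≫ Functor.LaxMonoidal.μ F.F (A ⊗ B) C ≫
        F.F.map (α_ _ _ _).hom
      · simp [MonoidalCategory.tensorHom_def']
      rw [h']
      simp only [MonoidalCategory.tensorHom_def, comp_whiskerRight, whisker_assoc,
        Category.assoc, whiskerLeft_comp]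
      simp [← whisker_exchange_assoc (Functor.LaxMonoidal.μ F.F A B)]
    exact h _ _ _ _ _ _ ih

theorem tpowMap_add_inv (a b : ℕ) :
    (tpowAdd Q.M.X a b).inv ≫ F.tpowMap (a + b) =
      (F.tpowMap a ⊗ₘ F.tpowMap b) ≫
        Functor.LaxMonoidal.μ F.F (tpow P.M.X a) (tpow P.M.X b) ≫
        F.F.map (tpowAdd P.M.X a b).inv := by
  rw [Iso.inv_comp_eq, ← Category.assoc, ← Category.assoc, ← Functor.mapIso_inv, Iso.eq_comp_inv,
    Functor.mapIso_hom, tpowMap_add, Category.assoc]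

theorem iso_inv_hom_hom : F.iso.inv.hom ≫ F.iso.hom.hom = 𝟙 Q.M.X :=
  congrArg Mon.Hom.hom F.iso.inv_hom_id

theorem iso_hom_inv_hom : F.iso.hom.hom ≫ F.iso.inv.hom = 𝟙 (F.F.obj P.M.X) :=
  congrArg Mon.Hom.hom F.iso.hom_inv_id

/-- An insertion regroups, applies `g` in the middle block, regroups back and applies `f`. The
regroupings are handled by `tpowMap_add` and `tpowMap_add_inv`; the identification `F M ≅ N` appears
after `g` and cancels against its inverse before `f`. -/
theorem map_insert (a l b : ℕ) (f : P.End (a + 1 + b)) (g : P.End l) :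
    F.map (a + l + b) (P.insert a l b f g) =
      Q.insert a l b (F.map (a + 1 + b) f) (F.map l g) := by
  have h : ∀ {X XAL NA NL NB N Y : Q.V} {A L B AL T M S : P.V}
      (t : X ⟶ F.F.obj T) (tal : XAL ⟶ F.F.obj AL) (ta : NA ⟶ F.F.obj A) (tl : NL ⟶ F.F.obj L)
      (tb : NB ⟶ F.F.obj B) (e : F.F.obj M ⟶ N) (e' : N ⟶ F.F.obj M) (_ : e ≫ e' = 𝟙 _)
      (p : T ⟶ AL ⊗ B) (q : AL ⟶ A ⊗ L) (g : L ⟶ M) (r : (A ⊗ M) ⊗ B ⟶ S) (f : S ⟶ M)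
      (p' : X ⟶ XAL ⊗ NB) (q' : XAL ⟶ NA ⊗ NL) (r' : (NA ⊗ N) ⊗ NB ⟶ Y) (ts : Y ⟶ F.F.obj S)
      (_ : t ≫ F.F.map p = p' ≫ (tal ⊗ₘ tb) ≫ Functor.LaxMonoidal.μ F.F _ _)
      (_ : tal ≫ F.F.map q = q' ≫ (ta ⊗ₘ tl) ≫ Functor.LaxMonoidal.μ F.F _ _)
      (_ : r' ≫ ts = (((ta ⊗ₘ e') ≫ Functor.LaxMonoidal.μ F.F _ _) ⊗ₘ tb) ≫
        Functor.LaxMonoidal.μ F.F _ _ ≫ F.F.map r),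
      t ≫ F.F.map (p ≫ (q ≫ A ◁ g) ▷ B ≫ r ≫ f) ≫ e =
        p' ≫ (q' ≫ NA ◁ (tl ≫ F.F.map g ≫ e)) ▷ NB ≫ r' ≫ ts ≫ F.F.map f ≫ e := by
    intro X XAL NA NL NB N Y A L B AL T M S t tal ta tl tb e e' he p q g r f p' q' r' ts h₁ h₂ h₃
    -- The middle block, where `e` and `e'` cancel.
    have h₄ : tal ≫ F.F.map q ≫ F.F.map (A ◁ g) = q' ≫ NA ◁ (tl ≫ F.F.map g ≫ e) ≫
        (ta ⊗ₘ e') ≫ Functor.LaxMonoidal.μ F.F _ _ := by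
      rw [reassoc_of% h₂, ← Functor.LaxMonoidal.μ_natural_right]
      simp only [MonoidalCategory.tensorHom_def', whiskerLeft_comp, Category.assoc]
      rw [← whiskerLeft_comp_assoc _ e e', he]
      simp [whisker_exchange_assoc]
    simp only [F.F.map_comp, Category.assoc]
    rw [reassoc_of% h₁, reassoc_of% h₃, ← Functor.LaxMonoidal.μ_natural_left_assoc,
      tensorHom_comp_whiskerRight_assoc, whiskerRight_comp_tensorHom_assoc, F.F.map_comp, h₄,
      Category.assoc]
  exact h (F.tpowMap (a + l + b)) (F.tpowMap (a + l)) (F.tpowMap a) (F.tpowMap l)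
    (F.tpowMap b) F.iso.hom.hom F.iso.inv.hom F.iso_hom_inv_hom _ _ g
    (tpowAdd P.M.X (a + 1) b).inv f _ _ _ _ (F.tpowMap_add (a + l) b) (F.tpowMap_add a l)
    (F.tpowMap_add_inv (a + 1) b)

theorem map_mul : F.map 2 P.mul = Q.mul := by
  have h : ∀ {M : P.V} {N : Q.V} (e : F.F.obj M ⟶ N) (e' : N ⟶ F.F.obj M) (m : M ⊗ M ⟶ M)
      (n : N ⊗ N ⟶ N) (_ : e' ≫ e = 𝟙 _)
      (_ : (Functor.LaxMonoidal.μ F.F M M ≫ F.F.map m) ≫ e = (e ⊗ₘ e) ≫ n),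
      ((((Functor.LaxMonoidal.ε F.F ⊗ₘ e') ≫ Functor.LaxMonoidal.μ F.F (𝟙_ P.V) M) ⊗ₘ e') ≫
        Functor.LaxMonoidal.μ F.F _ _) ≫ F.F.map ((λ_ M).hom ▷ M ≫ m) ≫ e =
      (λ_ N).hom ▷ N ≫ n := by
    intro M N e e' m n h₁ h₂
    have h₃ : n = (e' ⊗ₘ e') ≫ (Functor.LaxMonoidal.μ F.F M M ≫ F.F.map m) ≫ e := by
      rw [h₂, ← Category.assoc, MonoidalCategory.tensorHom_comp_tensorHom, h₁]; simp
    rw [h₃]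
    simp only [Functor.map_comp, Category.assoc, ← Functor.LaxMonoidal.μ_natural_left_assoc]
    rw [tensorHom_comp_whiskerRight_assoc, whiskerRight_comp_tensorHom_assoc]
    congr 2
    simp [MonoidalCategory.tensorHom_def']
  exact h F.iso.hom.hom F.iso.inv.hom _ _ F.iso_inv_hom_hom (F.iso.hom.isMonHom_hom.mul_hom)

theorem map_id : F.map 1 P.id = Q.id := by
  have h : ∀ {M : P.V} {N : Q.V} (e : F.F.obj M ⟶ N) (e' : N ⟶ F.F.obj M) (_ : e' ≫ e = 𝟙 _),
      ((Functor.LaxMonoidal.ε F.F ⊗ₘ e') ≫ Functor.LaxMonoidal.μ F.F (𝟙_ P.V) M) ≫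
        F.F.map (λ_ M).hom ≫ e = (λ_ N).hom := by
    intro M N e e' h
    simp [MonoidalCategory.tensorHom_def', h]
  exact h _ _ F.iso_inv_hom_hom

theorem map_one : F.map 0 P.one = Q.one :=
  (Category.assoc _ _ _).symm.trans F.iso.hom.isMonHom_hom.one_hom

end Hom
end MonPair

/-! ### Forests and the morphisms that they represent. -/

/-- Normal forms of `n`-tuples of operations built from the unit, the product and one operation
with `k i` inputs for each `i`: an `n`-tuple of words whose letters are leaves or operations applied
to a tuple of words. -/
inductive Forest {I : Type} (k : I → ℕ) : ℕ → Type
  | nil : Forest k 0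
  /-- append an empty word -/
  | new {n : ℕ} (w : Forest k n) : Forest k (n + 1)
  /-- append a leaf to the last word -/
  | leaf {n : ℕ} (w : Forest k (n + 1)) : Forest k (n + 1)
  /-- append an operation to the last word -/
  | node {n : ℕ} (w : Forest k (n + 1)) (i : I) (t : Forest k (k i)) : Forest k (n + 1)

section ForestMorphisms

variable {V : Type u} [Category.{v} V] [MonoidalCategory V] (M : V)

/-- The isomorphism `M^{⊗ 1} → M`. -/
def tpowOne : tpow M 1 ⟶ M := (λ_ M).hom

/-- The inverse of `tpowOne`. -/
def tpowOneInv : M ⟶ tpow M 1 := (λ_ M).inv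

theorem tpowOneInv_one : tpowOneInv M ≫ tpowOne M = 𝟙 _ := (λ_ M).inv_hom_id

variable {M}

/-- The tensor product of morphisms between tensor powers. -/
def tpowTensor {m n m' n' : ℕ} (φ : tpow M m ⟶ tpow M n) (ψ : tpow M m' ⟶ tpow M n') :
    tpow M (m + m') ⟶ tpow M (n + n') :=
  (tpowAdd M m m').hom ≫ (φ ⊗ₘ ψ) ≫ (tpowAdd M n n').inv

/-- No cast is needed: `m + 0` reduces to `m`, and splitting off an empty block is the right unitor.
-/
theorem tpowTensor_id_zero {m n : ℕ} (φ : tpow M m ⟶ tpow M n) :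
    tpowTensor φ (𝟙 (tpow M 0)) = φ := by
  have h : ∀ {A B : V} (φ : A ⟶ B), (ρ_ A).inv ≫ (φ ⊗ₘ 𝟙 (𝟙_ V)) ≫ (ρ_ B).hom = φ := by
    intros; simp
  exact h φ

variable [MonObj M]

/-- Append the unit of `M` to a morphism into a tensor power of `M`. -/
def newHom {m n : ℕ} (φ : tpow M m ⟶ tpow M n) : tpow M m ⟶ tpow M (n + 1) :=
  φ ≫ (ρ_ (tpow M n)).inv ≫ tpow M n ◁ MonObj.one

/-- Multiply the last component of `φ` by `ψ`. -/
def nodeHom {m m' n : ℕ} (φ : tpow M m ⟶ tpow M (n + 1)) (ψ : tpow M m' ⟶ M) :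
    tpow M (m + m') ⟶ tpow M (n + 1) :=
  (tpowAdd M m m').hom ≫ (φ ⊗ₘ ψ) ≫ (α_ (tpow M n) M M).hom ≫ tpow M n ◁ MonObj.mul

theorem comp_newHom {m n p : ℕ} (φ : tpow M m ⟶ tpow M n) (ψ : tpow M n ⟶ tpow M p) :
    φ ≫ newHom ψ = newHom (φ ≫ ψ) := by simp [newHom]

theorem tpowTensor_comp_nodeHom {m n m' n' p : ℕ} (φ : tpow M m ⟶ tpow M n)
    (φ' : tpow M m' ⟶ tpow M n') (ψ : tpow M n ⟶ tpow M (p + 1)) (ψ' : tpow M n' ⟶ M) :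
    tpowTensor φ φ' ≫ nodeHom ψ ψ' = nodeHom (φ ≫ ψ) (φ' ≫ ψ') := by
  simp only [tpowTensor, nodeHom, Category.assoc, Iso.inv_hom_id_assoc,
    MonoidalCategory.tensorHom_comp_tensorHom_assoc]

theorem tpowTensor_newHom {m n m' n' : ℕ} (φ : tpow M m ⟶ tpow M n) (ψ : tpow M m' ⟶ tpow M n') :
    tpowTensor φ (newHom ψ) = newHom (tpowTensor φ ψ) := by
  have h : ∀ {A B C D E F : V} (t : A ⟶ B ⊗ C) (φ : B ⟶ D) (ψ : C ⟶ E) (s : D ⊗ E ⟶ F),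
      t ≫ (φ ⊗ₘ (ψ ≫ (ρ_ E).inv ≫ E ◁ (MonObj.one : 𝟙_ V ⟶ M))) ≫ (α_ D E M).inv ≫ s ▷ M =
        (t ≫ (φ ⊗ₘ ψ) ≫ s) ≫ (ρ_ F).inv ≫ F ◁ MonObj.one := by
    intros A B C D E F t φ ψ s
    have e : (ρ_ (B ⊗ E)).inv ≫ (α_ B E (𝟙_ V)).hom ≫ B ◁ E ◁ (MonObj.one : 𝟙_ V ⟶ M) ≫
        (α_ B E M).inv = (ρ_ (B ⊗ E)).inv ≫ (B ⊗ E) ◁ MonObj.one := by simp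
    simp [MonoidalCategory.tensorHom_def']
    rw [reassoc_of% e, ← comp_whiskerRight, whisker_exchange]
    simp
  exact h _ _ _ _

/-- The last word of the right factor is the last word of the tensor product, so a letter can be
appended before or after tensoring on the left. -/
theorem tpowTensor_nodeHom {m n m' m'' n' : ℕ} (φ : tpow M m ⟶ tpow M n)
    (ψ : tpow M m' ⟶ tpow M (n' + 1)) (χ : tpow M m'' ⟶ M) :
    tpowTensor φ (nodeHom ψ χ) = tpowCast M (add_assoc m m' m'').symm ≫
      nodeHom (n := n + n') (tpowTensor (n' := n' + 1) φ ψ) χ := by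
  have h : ∀ {A B C D E F A' G H : V} (p : G ⟶ H ⊗ C) (q : H ⟶ A ⊗ B) (c : D ⟶ G)
      (r : D ⟶ A ⊗ F) (s : F ⟶ B ⊗ C) (φ : A ⟶ A') (ψ : B ⟶ E ⊗ M) (χ : C ⟶ M) {J : V}
      (x : A' ⊗ E ⟶ J) (_ : c ≫ p ≫ q ▷ C ≫ (α_ _ _ _).hom = r ≫ A ◁ s),
      r ≫ (φ ⊗ₘ (s ≫ (ψ ⊗ₘ χ) ≫ (α_ _ _ _).hom ≫ E ◁ MonObj.mul)) ≫ (α_ A' E M).inv ≫ x ▷ M =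
        c ≫ p ≫ ((q ≫ (φ ⊗ₘ ψ) ≫ (α_ A' E M).inv ≫ x ▷ M) ⊗ₘ χ) ≫ (α_ J M M).hom ≫
          J ◁ MonObj.mul := by
    intro A B C D E F A' G H p q c r s φ ψ χ J x h
    rw [← whiskerLeft_comp_tensorHom_assoc, ← reassoc_of% h]
    simp only [MonoidalCategory.tensorHom_def, Category.assoc, comp_whiskerRight, whiskerLeft_comp]
    simp
    congr 6
    rw [associator_naturality_left_assoc, ← whiskerLeft_comp J, ← whisker_exchange]
    simp
  refine h _ _ _ _ _ _ _ _ _ ?_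
  rw [tpowAdd_assoc, ← Category.assoc, tpowCast_trans]
  simp

/-- The right unit law: appending an empty word changes nothing. -/
theorem nodeHom_newHom {m n : ℕ} (φ : tpow M m ⟶ tpow M (n + 1)) :
    nodeHom φ (newHom (𝟙 (tpow M 0)) ≫ tpowOne M) = φ := by
  have h : ∀ {A B : V} (φ : A ⟶ B ⊗ M),
      (ρ_ A).inv ≫ (φ ⊗ₘ ((𝟙 (𝟙_ V) ≫ (ρ_ _).inv ≫ _ ◁ MonObj.one) ≫ (λ_ M).hom)) ≫
        (α_ _ _ _).hom ≫ B ◁ MonObj.mul = φ := by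
    intro A B φ
    simp only [MonoidalCategory.tensorHom_def]
    simp
    rw [← whiskerLeft_comp, MonObj.mul_one]
    monoidal
  exact h φ

/-- Associativity of the monoid: appending a word amounts to appending its letters one at a time.
This is the step of `IsRep.concat`. -/
theorem nodeHom_nodeHom {m m' m'' n : ℕ} (φ : tpow M m ⟶ tpow M (n + 1))
    (ψ : tpow M m' ⟶ tpow M 1) (χ : tpow M m'' ⟶ M) :
    nodeHom φ (nodeHom ψ χ ≫ tpowOne M) = tpowCast M (add_assoc m m' m'').symm ≫
      nodeHom (nodeHom φ (ψ ≫ tpowOne M)) χ := by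
  have h : ∀ {A B C D F A' G H : V} (p : G ⟶ H ⊗ C) (q : H ⟶ A ⊗ B) (c : D ⟶ G)
      (r : D ⟶ A ⊗ F) (s : F ⟶ B ⊗ C) (φ : A ⟶ A' ⊗ M) (ψ : B ⟶ 𝟙_ V ⊗ M) (χ : C ⟶ M) 
      (_ : c ≫ p ≫ q ▷ C ≫ (α_ _ _ _).hom = r ≫ A ◁ s),
      r ≫ (φ ⊗ₘ ((s ≫ (ψ ⊗ₘ χ) ≫ (α_ _ _ _).hom ≫ _ ◁ MonObj.mul) ≫ (λ_ M).hom)) ≫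
        (α_ A' M M).hom ≫ A' ◁ MonObj.mul =
        c ≫ p ≫ ((q ≫ (φ ⊗ₘ (ψ ≫ (λ_ M).hom)) ≫ (α_ A' M M).hom ≫ A' ◁ MonObj.mul) ⊗ₘ χ) ≫
          (α_ A' M M).hom ≫ A' ◁ MonObj.mul := by
    intro A B C D F A' G H p q c r s φ ψ χ h
    rw [Category.assoc s, ← whiskerLeft_comp_tensorHom_assoc, ← reassoc_of% h]
    simp only [MonoidalCategory.tensorHom_def, Category.assoc, comp_whiskerRight, whiskerLeft_comp]
    have e : M ◁ M ◁ χ ≫ M ◁ MonObj.mul ≫ MonObj.mul = (α_ M M C).inv ≫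
        (MonObj.mul : M ⊗ M ⟶ M) ▷ C ≫ M ◁ χ ≫ MonObj.mul := by
      rw [← whisker_exchange_assoc, MonObj.mul_assoc]
      simp
    simp
    congr 9
    simp only [← whiskerLeft_comp, e]
  refine h _ _ _ _ _ _ _ _ ?_
  rw [tpowAdd_assoc, ← Category.assoc, tpowCast_trans]
  simp

variable {I : Type} {k : I → ℕ} (f : (i : I) → (tpow M (k i) ⟶ M))

/-- `φ` is the morphism represented by the forest `w`, with the operation `i` interpreted by
`f i`. -/
inductive Forest.Rep : (m n : ℕ) → Forest k n → (tpow M m ⟶ tpow M n) → Prop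
  | nil : Rep 0 0 .nil (𝟙 _)
  | new {m n : ℕ} {w : Forest k n} {φ : tpow M m ⟶ tpow M n} (h : Rep m n w φ) :
      Rep m (n + 1) w.new (newHom φ)
  | leaf {m n : ℕ} {w : Forest k (n + 1)} {φ : tpow M m ⟶ tpow M (n + 1)}
      (h : Rep m (n + 1) w φ) : Rep (m + 1) (n + 1) w.leaf (nodeHom φ (tpowOne M))
  | node {m m' n : ℕ} {w : Forest k (n + 1)} {i : I} {t : Forest k (k i)}
      {φ : tpow M m ⟶ tpow M (n + 1)} {ψ : tpow M m' ⟶ tpow M (k i)} (h : Rep m (n + 1) w φ)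
      (h' : Rep m' (k i) t ψ) : Rep (m + m') (n + 1) (w.node i t) (nodeHom φ (ψ ≫ f i))

namespace Forest

variable {f}

/-- The number of inputs is an index of the relation and is not computed from the forest, so it has
to be shown unique along with the morphism. -/
theorem Rep.unique {m n : ℕ} {w : Forest k n} {φ : tpow M m ⟶ tpow M n} (h : Rep f m n w φ) :
    ∀ {m' : ℕ} {φ' : tpow M m' ⟶ tpow M n}, Rep f m' n w φ' →
      ∃ h : m = m', φ = tpowCast M h ≫ φ' := by
  induction h with
  | nil => intro m' φ' h; cases h; exact ⟨rfl, (Category.id_comp _).symm⟩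
  | new h ih =>
    intro m' φ' h
    cases h with
    | new h =>
      obtain ⟨rfl, rfl⟩ := ih h
      exact ⟨rfl, by simp⟩
  | leaf h ih =>
    intro m' φ' h
    cases h with
    | leaf h =>
      obtain ⟨rfl, rfl⟩ := ih h
      exact ⟨rfl, by simp⟩
  | node h h' ih ih' =>
    intro m' φ' h
    cases h with
    | node h h' =>
      obtain ⟨rfl, rfl⟩ := ih h
      obtain ⟨rfl, rfl⟩ := ih' h'
      exact ⟨rfl, by simp⟩

variable (f) in
/-- The morphisms represented by forests. -/
def IsRep (m n : ℕ) (φ : tpow M m ⟶ tpow M n) : Prop := ∃ w, Rep f m n w φ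

namespace IsRep

theorem cast_comp {m m' n : ℕ} (e : m' = m) {φ : tpow M m ⟶ tpow M n} (h : IsRep f m n φ) :
    IsRep f m' n (tpowCast M e ≫ φ) := by
  subst e; simpa using h

theorem new {m n : ℕ} {φ : tpow M m ⟶ tpow M n} (h : IsRep f m n φ) :
    IsRep f m (n + 1) (newHom φ) :=
  let ⟨_, h⟩ := h; ⟨_, .new h⟩

theorem leaf {m n : ℕ} {φ : tpow M m ⟶ tpow M (n + 1)} (h : IsRep f m (n + 1) φ) :
    IsRep f (m + 1) (n + 1) (nodeHom φ (tpowOne M)) :=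
  let ⟨_, h⟩ := h; ⟨_, .leaf h⟩

theorem node {m m' n : ℕ} {i : I} {φ : tpow M m ⟶ tpow M (n + 1)}
    {ψ : tpow M m' ⟶ tpow M (k i)} (h : IsRep f m (n + 1) φ) (h' : IsRep f m' (k i) ψ) :
    IsRep f (m + m') (n + 1) (nodeHom φ (ψ ≫ f i)) :=
  let ⟨_, h⟩ := h; let ⟨_, h'⟩ := h'; ⟨_, .node h h'⟩

theorem tensor {m n m' n' : ℕ} {φ : tpow M m ⟶ tpow M n} {ψ : tpow M m' ⟶ tpow M n'}
    (h : IsRep f m n φ) (h' : IsRep f m' n' ψ) :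
    IsRep f (m + m') (n + n') (tpowTensor φ ψ) := by
  obtain ⟨w, h'⟩ := h'
  induction h' with
  | nil => rwa [tpowTensor_id_zero]
  | new _ ih => rw [tpowTensor_newHom]; exact ih.new
  | leaf _ ih => rw [tpowTensor_nodeHom]; exact cast_comp _ ih.leaf
  | node _ h₂ ih _ => rw [tpowTensor_nodeHom]; exact cast_comp _ (ih.node ⟨_, h₂⟩)

theorem id (n : ℕ) : IsRep f n n (𝟙 _) := by
  induction n with
  | zero => exact ⟨_, .nil⟩
  | succ n ih =>
    -- The last factor `x` is the new empty word followed by a leaf, that is `1 * x`; this is the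
    -- left unit law.
    have h : nodeHom (newHom (𝟙 (tpow M n))) (tpowOne M) = 𝟙 (tpow M (n + 1)) := by
      have h : ∀ A : V, ((ρ_ A).inv ▷ M ≫ (α_ A (𝟙_ V) M).hom) ≫
          ((𝟙 A ≫ (ρ_ A).inv ≫ A ◁ MonObj.one) ⊗ₘ (λ_ M).hom) ≫ (α_ A M M).hom ≫
          A ◁ MonObj.mul = 𝟙 (A ⊗ M) := by
        intro A
        simp [MonoidalCategory.tensorHom_def']
        rw [← whiskerLeft_comp, MonObj.one_mul]
        simp
      exact h _
    exact h ▸ ih.new.leaf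

/-- Distinct words of a forest use consecutive, disjoint blocks of inputs, so a represented morphism
factors along any cut between words. -/
theorem split {m n a b : ℕ} (e : n = a + b) {φ : tpow M m ⟶ tpow M n} (h : IsRep f m n φ) :
    ∃ (m₁ m₂ : ℕ) (e' : m = m₁ + m₂) (φ₁ : tpow M m₁ ⟶ tpow M a) (φ₂ : tpow M m₂ ⟶ tpow M b),
      IsRep f m₁ a φ₁ ∧ IsRep f m₂ b φ₂ ∧
        φ ≫ tpowCast M e = tpowCast M e' ≫ tpowTensor φ₁ φ₂ := by
  obtain ⟨w, h⟩ := h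
  -- The induction alters the last word, which belongs to the second block only if `b` is nonzero.
  by_cases hb : b = 0
  · subst hb
    obtain rfl : n = a := e
    exact ⟨m, 0, rfl, φ, 𝟙 _, ⟨w, h⟩, ⟨_, .nil⟩, by simp [tpowTensor_id_zero]⟩
  induction h generalizing a b with
  | nil => omega
  | @new m n w φ h ih =>
    obtain ⟨b, rfl⟩ : ∃ b', b = b' + 1 := ⟨b - 1, by omega⟩
    obtain rfl : n = a + b := by omega
    -- Removing the new word can leave an empty second block, which `ih` does not cover.
    have ih' : ∃ (m₁ m₂ : ℕ) (e' : m = m₁ + m₂) (φ₁ : tpow M m₁ ⟶ tpow M a)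
        (φ₂ : tpow M m₂ ⟶ tpow M b), IsRep f m₁ a φ₁ ∧ IsRep f m₂ b φ₂ ∧
        φ ≫ tpowCast M rfl = tpowCast M e' ≫ tpowTensor φ₁ φ₂ := by
      by_cases hb : b = 0
      · subst hb
        exact ⟨m, 0, rfl, φ, 𝟙 _, ⟨w, h⟩, ⟨_, .nil⟩, by simp [tpowTensor_id_zero]⟩
      · exact ih rfl hb
    obtain ⟨m₁, m₂, rfl, φ₁, φ₂, h₁, h₂, he⟩ := ih'
    refine ⟨m₁, m₂, rfl, φ₁, newHom φ₂, h₁, h₂.new, ?_⟩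
    simp only [tpowCast_rfl, Category.comp_id, Category.id_comp] at he
    rw [tpowTensor_newHom, he]
    exact (Category.comp_id _).trans (Category.id_comp _).symm
  | @leaf m n w φ h ih =>
    obtain ⟨b, rfl⟩ : ∃ b', b = b' + 1 := ⟨b - 1, by omega⟩
    obtain rfl : n = a + b := by omega
    obtain ⟨m₁, m₂, rfl, φ₁, φ₂, h₁, h₂, he⟩ := ih (a := a) (b := b + 1) rfl hb
    refine ⟨m₁, m₂ + 1, rfl, φ₁, nodeHom φ₂ (tpowOne M), h₁, h₂.leaf, ?_⟩
    simp only [tpowCast_rfl, Category.comp_id, Category.id_comp] at he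
    rw [tpowTensor_nodeHom, ← he]
    exact (Category.comp_id _).trans ((Category.id_comp _).trans (Category.id_comp _)).symm
  | @node m m' n w i t φ ψ h h' ih ih' =>
    obtain ⟨b, rfl⟩ : ∃ b', b = b' + 1 := ⟨b - 1, by omega⟩
    obtain rfl : n = a + b := by omega
    obtain ⟨m₁, m₂, rfl, φ₁, φ₂, h₁, h₂, he⟩ := ih (a := a) (b := b + 1) rfl hb
    refine ⟨m₁, m₂ + m', add_assoc _ _ _, φ₁, nodeHom φ₂ (ψ ≫ f i), h₁, h₂.node ⟨_, h'⟩, ?_⟩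
    simp only [tpowCast_rfl, Category.comp_id, Category.id_comp] at he
    rw [tpowTensor_nodeHom, ← he, ← Category.assoc, tpowCast_trans]
    exact (Category.comp_id _).trans (Category.id_comp _).symm

/-- The letters of the second word are moved over one by one. The target exponent is a variable `p`
with `p = 1`, so that induction on `Rep` applies. -/
theorem concat {m m' n : ℕ} {φ : tpow M m ⟶ tpow M (n + 1)} (h : IsRep f m (n + 1) φ) {p : ℕ}
    (e : p = 1) {χ : tpow M m' ⟶ tpow M p} (h' : IsRep f m' p χ) :
    IsRep f (m + m') (n + 1) (nodeHom φ (χ ≫ tpowCast M e ≫ tpowOne M)) := by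
  obtain ⟨w, h'⟩ := h'
  induction h' with
  | nil => omega
  | @new m' p w χ h' =>
    obtain rfl : p = 0 := by omega
    cases h'
    have := nodeHom_newHom φ
    simp only [tpowCast_rfl, Category.id_comp]
    rwa [this]
  | @leaf m' p w χ h' ih =>
    obtain rfl : p = 0 := by omega
    specialize ih rfl
    simp only [tpowCast_rfl, Category.id_comp] at ih ⊢
    rw [nodeHom_nodeHom]
    exact cast_comp _ ih.leaf
  | @node m' m'' p w i t χ ψ h' h'' ih =>
    obtain rfl : p = 0 := by omega
    specialize ih rfl
    simp only [tpowCast_rfl, Category.id_comp] at ih ⊢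
    rw [nodeHom_nodeHom]
    exact cast_comp _ (ih.node ⟨_, h''⟩)

/-- Substitution of forests, by induction on the outer one. An outer leaf consumes the last inner
word, which is concatenated to the word being built; an outer node consumes a final block of inner
words, which is substituted in its arguments. `split` provides these blocks. -/
theorem comp {m n p : ℕ} {φ : tpow M m ⟶ tpow M n} {ψ : tpow M n ⟶ tpow M p}
    (h : IsRep f m n φ) (h' : IsRep f n p ψ) : IsRep f m p (φ ≫ ψ) := by
  obtain ⟨w, h'⟩ := h'
  induction h' generalizing m with
  | nil => simpa using h
  | new _ ih => rw [comp_newHom]; exact (ih h).new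
  | leaf _ ih =>
    obtain ⟨m₁, m₂, rfl, φ₁, φ₂, h₁, h₂, he⟩ := h.split rfl
    simp only [tpowCast_rfl, Category.comp_id, Category.id_comp] at he
    rw [he, tpowTensor_comp_nodeHom]
    simpa using concat (ih h₁) rfl h₂
  | node _ _ ih ih' =>
    obtain ⟨m₁, m₂, rfl, φ₁, φ₂, h₁, h₂, he⟩ := h.split rfl
    simp only [tpowCast_rfl, Category.comp_id, Category.id_comp] at he
    rw [he, tpowTensor_comp_nodeHom, ← Category.assoc]
    exact (ih h₁).node (ih' h₂)

theorem op (i : I) : IsRep f (k i) 1 (f i ≫ tpowOneInv M) := by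
  -- The one-letter word whose letter is the operation `i` applied to the identity forest.
  have h : IsRep f (0 + k i) 1 (nodeHom (n := 0) (newHom (𝟙 (tpow M 0))) (𝟙 _ ≫ f i)) :=
    IsRep.node (IsRep.new (IsRep.id 0)) (IsRep.id (k i))
  have h' : nodeHom (n := 0) (newHom (𝟙 (tpow M 0))) (𝟙 _ ≫ f i) =
      tpowCast M (zero_add (k i)) ≫ f i ≫ tpowOneInv M := by
    have h : ∀ {A B : V} (c : A ⟶ B) (f : B ⟶ M), (c ≫ (λ_ B).inv) ≫
        ((𝟙 (𝟙_ V) ≫ (ρ_ _).inv ≫ 𝟙_ V ◁ MonObj.one) ⊗ₘ (𝟙 B ≫ f)) ≫ (α_ _ _ _).hom ≫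
          𝟙_ V ◁ MonObj.mul = c ≫ f ≫ (λ_ M).inv := by
      intro A B c f
      simp [MonoidalCategory.tensorHom_def']
    rw [nodeHom, tpowAdd_zero_left]
    exact h _ _
  rw [h'] at h
  have h'' := cast_comp (zero_add (k i)).symm h
  rwa [← Category.assoc, tpowCast_trans, tpowCast_rfl, Category.id_comp] at h''

theorem one : IsRep f 0 1 (MonObj.one ≫ tpowOneInv M) := by
  have h : IsRep f 0 1 _ := IsRep.new (IsRep.id 0)
  have h' : 𝟙 (𝟙_ V) ≫ (ρ_ _).inv ≫ 𝟙_ V ◁ (MonObj.one : _ ⟶ M) = MonObj.one ≫ (λ_ M).inv := by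
    rw [← unitors_inv_equal]
    simp
  exact h' ▸ h

theorem mul : IsRep f 2 1 ((λ_ M).hom ▷ M ≫ MonObj.mul ≫ tpowOneInv M) := by
  have h : IsRep f 2 1 _ := IsRep.leaf (IsRep.id (f := f) 1)
  have h' : ((ρ_ (𝟙_ V ⊗ M)).inv ▷ M ≫ (α_ _ _ _).hom) ≫ (𝟙 (𝟙_ V ⊗ M) ⊗ₘ (λ_ M).hom) ≫
      (α_ _ _ _).hom ≫ 𝟙_ V ◁ MonObj.mul = (λ_ M).hom ▷ M ≫ MonObj.mul ≫ (λ_ M).inv := by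
    simp [MonoidalCategory.tensorHom_def']
  exact h' ▸ h

end IsRep
end Forest
end ForestMorphisms

/-! ### Scaling of operations and linear combinations of forests. -/

section

variable {V : Type u} [Category.{v} V] [Preadditive V] [MonoidalCategory V] {M : V} [MonObj M]

theorem newHom_zsmul {m n : ℕ} (z : ℤ) (φ : tpow M m ⟶ tpow M n) :
    newHom (z • φ) = z • newHom φ := by
  rw [newHom, Preadditive.zsmul_comp]; rfl

variable [MonoidalPreadditive V]

/-- `nodeHom` as a biadditive map. -/
def nodeAddHom (m m' n : ℕ) : (tpow M m ⟶ tpow M (n + 1)) →+ (tpow M m' ⟶ M) →+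
    (tpow M (m + m') ⟶ tpow M (n + 1)) :=
  AddMonoidHom.mk' (fun φ => AddMonoidHom.mk' (fun ψ => nodeHom φ ψ)
    (by intro a b; simp only [nodeHom, MonoidalPreadditive.tensor_add, Preadditive.add_comp,
      Preadditive.comp_add]))
    (by intro a b; ext ψ; simp only [nodeHom, MonoidalPreadditive.add_tensor, Preadditive.add_comp,
          Preadditive.comp_add, AddMonoidHom.mk'_apply, AddMonoidHom.add_apply])

theorem nodeHom_zsmul {m m' n : ℕ} (z z' : ℤ) (φ : tpow M m ⟶ tpow M (n + 1))
    (ψ : tpow M m' ⟶ M) : nodeHom (z • φ) (z' • ψ) = (z * z') • nodeHom φ ψ := by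
  change nodeAddHom m m' n (z • φ) (z' • ψ) = (z * z') • nodeAddHom m m' n φ ψ
  rw [map_zsmul, AddMonoidHom.map_zsmul, AddMonoidHom.zsmul_apply, smul_smul, mul_comm]

/-- `tpowTensor` as a biadditive map. -/
def tpowTensorAddHom (m n m' n' : ℕ) : (tpow M m ⟶ tpow M n) →+ (tpow M m' ⟶ tpow M n') →+
    (tpow M (m + m') ⟶ tpow M (n + n')) :=
  AddMonoidHom.mk' (fun φ => AddMonoidHom.mk' (fun ψ => tpowTensor φ ψ)
    (by intro a b; simp only [tpowTensor, MonoidalPreadditive.tensor_add, Preadditive.add_comp,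
      Preadditive.comp_add]))
    (by intro a b; ext ψ; simp only [tpowTensor, MonoidalPreadditive.add_tensor, Preadditive.add_comp,
          Preadditive.comp_add, AddMonoidHom.mk'_apply, AddMonoidHom.add_apply])

namespace Forest

variable {I : Type} {k : I → ℕ} {f : (i : I) → (tpow M (k i) ⟶ M)}

/-- The product of `z i` over all operations in the forest. -/
def weight (z : I → ℤ) : {n : ℕ} → Forest k n → ℤ
  | _, .nil => 1
  | _, .new w => weight z w
  | _, .leaf w => weight z w
  | _, .node w i t => weight z w * (weight z t * z i)

/-- Each node labelled `i` contributes a factor `z i`. Set against the multilinearity of a natural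
operation, this later determines how often each operation occurs. -/
theorem Rep.zsmul (z : I → ℤ) {m n : ℕ} {w : Forest k n} {φ : tpow M m ⟶ tpow M n}
    (h : Rep f m n w φ) : Rep (fun i => z i • f i) m n w (weight z w • φ) := by
  induction h with
  | nil => simpa [weight] using Rep.nil
  | new _ ih => rw [← newHom_zsmul]; exact ih.new
  | leaf _ ih =>
    have := ih.leaf
    have e := nodeHom_zsmul (weight z ‹_›) 1 ‹tpow M _ ⟶ tpow M (_ + 1)› (tpowOne M)
    rw [one_zsmul, mul_one] at e
    exact e ▸ this
  | node _ _ ih ih' =>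
    have := ih.node ih'
    rw [Preadditive.comp_zsmul, Preadditive.zsmul_comp, smul_smul, nodeHom_zsmul] at this
    rwa [mul_comm (z _)] at this

variable (f) in
/-- The linear combinations of morphisms represented by forests. -/
def repSpan (m n : ℕ) : AddSubgroup (tpow M m ⟶ tpow M n) :=
  AddSubgroup.closure {φ | IsRep f m n φ}

theorem repSpan_bilinear {m n m' n' p q : ℕ} (B : (tpow M m ⟶ tpow M n) →+
    (tpow M m' ⟶ tpow M n') →+ (tpow M p ⟶ tpow M q))
    (hB : ∀ φ ψ, IsRep f m n φ → IsRep f m' n' ψ → IsRep f p q (B φ ψ)) {φ ψ}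
    (h : φ ∈ repSpan f m n) (h' : ψ ∈ repSpan f m' n') : B φ ψ ∈ repSpan f p q := by
  have key : ∀ φ, IsRep f m n φ → repSpan f m' n' ≤ (repSpan f p q).comap (B φ) := by
    intro φ hφ
    refine (AddSubgroup.closure_le _).2 fun ψ hψ => ?_
    exact AddSubgroup.subset_closure (hB φ ψ hφ hψ)
  have key' : repSpan f m n ≤ (repSpan f p q).comap (B.flip ψ) :=
    (AddSubgroup.closure_le _).2 fun φ hφ => key φ hφ h'
  exact key' h

theorem comp_mem_repSpan {m n p : ℕ} {φ : tpow M m ⟶ tpow M n} {ψ : tpow M n ⟶ tpow M p}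
    (h : φ ∈ repSpan f m n) (h' : ψ ∈ repSpan f n p) : φ ≫ ψ ∈ repSpan f m p :=
  repSpan_bilinear (AddMonoidHom.mk' (fun φ => AddMonoidHom.mk' (fun ψ => φ ≫ ψ)
    (by intro a b; simp)) (by intro a b; ext ψ; simp)) (fun _ _ h h' => h.comp h') h h'

theorem tpowTensor_mem_repSpan {m n m' n' : ℕ} {φ : tpow M m ⟶ tpow M n}
    {ψ : tpow M m' ⟶ tpow M n'} (h : φ ∈ repSpan f m n) (h' : ψ ∈ repSpan f m' n') :
    tpowTensor φ ψ ∈ repSpan f (m + m') (n + n') :=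
  repSpan_bilinear (tpowTensorAddHom m n m' n') (fun _ _ h h' => h.tensor h') h h'

end Forest

end

/-! ### Forests under monoidal functors. -/

namespace MonPair.Hom

variable {P Q : MonPair.{v, u}} (F : Hom P Q)

/-- The isomorphism `F M → N` underlying the isomorphism of monoids. -/
def isoHom : F.F.obj P.M.X ⟶ Q.M.X := F.iso.hom.hom

/-- The inverse of `isoHom`. -/
def isoInv : Q.M.X ⟶ F.F.obj P.M.X := F.iso.inv.hom

theorem isoHom_isoInv : F.isoHom ≫ F.isoInv = 𝟙 _ := F.iso_hom_inv_hom

theorem map_def (k : ℕ) (f : P.End k) :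
    F.map k f = F.tpowMap k ≫ F.F.map f ≫ F.isoHom := rfl

theorem map_isoInv (k : ℕ) (f : P.End k) :
    F.map k f ≫ F.isoInv = F.tpowMap k ≫ F.F.map f := by
  rw [map_def, Category.assoc, Category.assoc, isoHom_isoInv, Category.comp_id]

theorem mul_isoInv : MonObj.mul ≫ F.isoInv = (F.isoInv ⊗ₘ F.isoInv) ≫
    Functor.LaxMonoidal.μ F.F _ _ ≫ F.F.map MonObj.mul := F.iso.inv.isMonHom_hom.mul_hom

theorem one_isoInv : MonObj.one ≫ F.isoInv = Functor.LaxMonoidal.ε F.F ≫ F.F.map MonObj.one :=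
  F.iso.inv.isMonHom_hom.one_hom

theorem nodeHom_tpowMap {m m' n : ℕ} {φ : tpow P.M.X m ⟶ tpow P.M.X (n + 1)}
    {χ : tpow P.M.X m' ⟶ P.M.X} {ψ : tpow Q.M.X m ⟶ tpow Q.M.X (n + 1)}
    (h : ψ ≫ F.tpowMap (n + 1) = F.tpowMap m ≫ F.F.map φ) :
    nodeHom ψ (F.map m' χ) ≫ F.tpowMap (n + 1) = F.tpowMap (m + m') ≫ F.F.map (nodeHom φ χ) := by
  have aux : ∀ {A : P.V} {B B' X X' : Q.V} {T S S' : P.V} (r : X ⟶ B ⊗ B')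
      (c : B ⟶ X' ⊗ Q.M.X) (d : B' ⟶ Q.M.X) (x : X' ⟶ F.F.obj A) (t : X ⟶ F.F.obj T)
      (s : B ⟶ F.F.obj S) (s' : B' ⟶ F.F.obj S') (q : T ⟶ S ⊗ S') (φ : S ⟶ A ⊗ P.M.X)
      (χ : S' ⟶ P.M.X)
      (_ : c ≫ (x ⊗ₘ F.isoInv) ≫ Functor.LaxMonoidal.μ F.F _ _ = s ≫ F.F.map φ)
      (_ : d ≫ F.isoInv = s' ≫ F.F.map χ)
      (_ : t ≫ F.F.map q = r ≫ (s ⊗ₘ s') ≫ Functor.LaxMonoidal.μ F.F _ _),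
      (r ≫ (c ⊗ₘ d) ≫ (α_ _ _ _).hom ≫ X' ◁ MonObj.mul) ≫ (x ⊗ₘ F.isoInv) ≫
        Functor.LaxMonoidal.μ F.F _ _ =
      t ≫ F.F.map (q ≫ (φ ⊗ₘ χ) ≫ (α_ _ _ _).hom ≫ A ◁ MonObj.mul) := by
    intro A B B' X X' T S S' r c d x t s s' q φ χ h₁ h₂ h₃
    simp only [Functor.map_comp, Category.assoc]
    rw [reassoc_of% h₃, ← Functor.LaxMonoidal.μ_natural_assoc,
      MonoidalCategory.tensorHom_comp_tensorHom_assoc, ← h₁, ← h₂,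
      whiskerLeft_comp_tensorHom_assoc, mul_isoInv]
    have e : (x ⊗ₘ ((F.isoInv ⊗ₘ F.isoInv) ≫ Functor.LaxMonoidal.μ F.F P.M.X P.M.X ≫
        F.F.map MonObj.mul)) = (x ⊗ₘ (F.isoInv ⊗ₘ F.isoInv)) ≫
        F.F.obj A ◁ Functor.LaxMonoidal.μ F.F P.M.X P.M.X ≫ F.F.obj A ◁ F.F.map MonObj.mul := by
      rw [← whiskerLeft_comp, tensorHom_comp_whiskerLeft]
    rw [e]
    simp only [Category.assoc]
    rw [Functor.LaxMonoidal.μ_natural_right, ← associator_naturality_assoc,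
      ← Functor.LaxMonoidal.associativity_assoc]
    have e' : ((c ≫ (x ⊗ₘ F.isoInv) ≫ Functor.LaxMonoidal.μ F.F A P.M.X) ⊗ₘ (d ≫ F.isoInv)) =
        (c ⊗ₘ d) ≫ ((x ⊗ₘ F.isoInv) ⊗ₘ F.isoInv) ≫ Functor.LaxMonoidal.μ F.F A P.M.X ▷ _ := by
      rw [tensorHom_comp_whiskerRight, MonoidalCategory.tensorHom_comp_tensorHom]
    rw [e']
    simp only [Category.assoc]
  exact aux _ _ _ _ _ _ _ _ _ _ h (F.map_isoInv _ _) (F.tpowMap_add m m')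

theorem newHom_tpowMap {m n : ℕ} {φ : tpow P.M.X m ⟶ tpow P.M.X n}
    {ψ : tpow Q.M.X m ⟶ tpow Q.M.X n} (h : ψ ≫ F.tpowMap n = F.tpowMap m ≫ F.F.map φ) :
    newHom ψ ≫ F.tpowMap (n + 1) = F.tpowMap m ≫ F.F.map (newHom φ) := by
  have aux : ∀ {A : P.V} {B X : Q.V} (y : X ⟶ B) (x : B ⟶ F.F.obj A) {T : P.V}
      (t : X ⟶ F.F.obj T) (φ : T ⟶ A) (_ : y ≫ x = t ≫ F.F.map φ),
      (y ≫ (ρ_ B).inv ≫ B ◁ MonObj.one) ≫ (x ⊗ₘ F.isoInv) ≫ Functor.LaxMonoidal.μ F.F _ _ =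
        t ≫ F.F.map (φ ≫ (ρ_ A).inv ≫ A ◁ MonObj.one) := by
    intro A B X y x T t φ h
    simp only [Functor.map_comp, Category.assoc]
    rw [← reassoc_of% h, whiskerLeft_comp_tensorHom_assoc, one_isoInv,
      ← tensorHom_comp_whiskerLeft_assoc, Functor.LaxMonoidal.μ_natural_right]
    simp [MonoidalCategory.tensorHom_def]
  exact aux _ _ _ _ h

/-- A monoidal functor keeps the forest and changes only the operations at its nodes. Hence an
expansion found in the free pair holds, with the same coefficients, in every pair. -/
theorem map_rep {I : Type} {k : I → ℕ} {f : (i : I) → P.End (k i)} {m n : ℕ} {w : Forest k n}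
    {φ : tpow P.M.X m ⟶ tpow P.M.X n} (h : Forest.Rep f m n w φ) :
    ∃ ψ, Forest.Rep (fun i => F.map (k i) (f i)) m n w ψ ∧
      ψ ≫ F.tpowMap n = F.tpowMap m ≫ F.F.map φ := by
  induction h with
  | nil => exact ⟨_, .nil, by simp⟩
  | new _ ih =>
    obtain ⟨ψ, h, he⟩ := ih
    exact ⟨_, h.new, F.newHom_tpowMap he⟩
  | leaf _ ih =>
    obtain ⟨ψ, h, he⟩ := ih
    refine ⟨_, h.leaf, ?_⟩
    -- A leaf appends the identity cochain, which is preserved by `map_id`.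
    have := F.nodeHom_tpowMap (χ := P.id) he
    rwa [map_id] at this
  | node _ _ ih ih' =>
    obtain ⟨ψ, h, he⟩ := ih
    obtain ⟨ψ', h', he'⟩ := ih'
    refine ⟨_, h.node h', ?_⟩
    rw [← F.nodeHom_tpowMap he, map_def, map_def, reassoc_of% he', Functor.map_comp_assoc]

theorem map_rep_comp_tpowOne {I : Type} {k : I → ℕ} {f : (i : I) → P.End (k i)} {l : ℕ}
    {w : Forest k 1} {φ : tpow P.M.X l ⟶ tpow P.M.X 1} (h : Forest.Rep f l 1 w φ) :
    ∃ ψ, Forest.Rep (fun i => F.map (k i) (f i)) l 1 w ψ ∧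
      F.map l (φ ≫ tpowOne P.M.X) = ψ ≫ tpowOne Q.M.X := by
  obtain ⟨ψ, h, he⟩ := F.map_rep h
  refine ⟨ψ, h, ?_⟩
  rw [map_def, Functor.map_comp_assoc, ← reassoc_of% he]
  exact congrArg (ψ ≫ ·) F.map_id

end MonPair.Hom

/-! ### The free pair on operations of given arities. -/

/-- Formal tensor words in one object. -/
inductive MonWord : Type
  | unit : MonWord
  | gen : MonWord
  | tensor (X Y : MonWord) : MonWord

namespace MonWord

/-- The left-bracketed tensor power of the generator. -/
def pow : ℕ → MonWord
  | 0 => unit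
  | n + 1 => tensor (pow n) gen

/-- The number of generators in a word. -/
def length : MonWord → ℕ
  | unit => 0
  | gen => 1
  | tensor X Y => length X + length Y

variable {V : Type*} [Category V] [MonoidalCategory V] (M : V)

/-- The interpretation of a word in a monoidal category. -/
def obj : MonWord → V
  | unit => 𝟙_ V
  | gen => M
  | tensor X Y => obj X ⊗ obj Y

/-- The canonical isomorphism from the interpretation of `pow n` to the tensor power. -/
def powHom : (n : ℕ) → (obj M (pow n) ⟶ tpow M n)
  | 0 => 𝟙 (𝟙_ V)
  | n + 1 => powHom n ▷ M

end MonWord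

/-- Words as the objects of a category with the sets of morphisms `H`. -/
structure WordObj.{v', u'} (H : MonWord → MonWord → Type v') : Type u' where
  word : MonWord

section GenericPair

variable {I : Type} (k : I → ℕ)

/-- Formal morphisms in a preadditive monoidal category with a monoid and operations of arities
`k i` on it. -/
inductive GenTerm : MonWord → MonWord → Type
  | id (X : MonWord) : GenTerm X X
  | comp {X Y Z} (f : GenTerm X Y) (g : GenTerm Y Z) : GenTerm X Z
  | whiskerLeft (X) {Y Z} (f : GenTerm Y Z) : GenTerm (.tensor X Y) (.tensor X Z)
  | whiskerRight {X Y} (f : GenTerm X Y) (Z) : GenTerm (.tensor X Z) (.tensor Y Z)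
  | assocHom (X Y Z) : GenTerm (.tensor (.tensor X Y) Z) (.tensor X (.tensor Y Z))
  | assocInv (X Y Z) : GenTerm (.tensor X (.tensor Y Z)) (.tensor (.tensor X Y) Z)
  | leftHom (X) : GenTerm (.tensor .unit X) X
  | leftInv (X) : GenTerm X (.tensor .unit X)
  | rightHom (X) : GenTerm (.tensor X .unit) X
  | rightInv (X) : GenTerm X (.tensor X .unit)
  | mul : GenTerm (.tensor .gen .gen) .gen
  | one : GenTerm .unit .gen
  | op (i : I) : GenTerm (.pow (k i)) .gen
  | zero (X Y) : GenTerm X Y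
  | add {X Y} (f g : GenTerm X Y) : GenTerm X Y
  | neg {X Y} (f : GenTerm X Y) : GenTerm X Y

variable {k}

/-- The interpretation of a formal morphism in a pair `(V, M)` with operations `g i`. -/
def GenTerm.eval (P : MonPair.{v, u}) (g : (i : I) → P.End (k i)) : {X Y : MonWord} →
    GenTerm k X Y → (X.obj P.M.X ⟶ Y.obj P.M.X)
  | _, _, .id _ => 𝟙 _
  | _, _, .comp f h => eval P g f ≫ eval P g h
  | _, _, .whiskerLeft X f => X.obj P.M.X ◁ eval P g f
  | _, _, .whiskerRight f Z => eval P g f ▷ Z.obj P.M.X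
  | _, _, .assocHom _ _ _ => (α_ _ _ _).hom
  | _, _, .assocInv _ _ _ => (α_ _ _ _).inv
  | _, _, .leftHom _ => (λ_ _).hom
  | _, _, .leftInv _ => (λ_ _).inv
  | _, _, .rightHom _ => (ρ_ _).hom
  | _, _, .rightInv _ => (ρ_ _).inv
  | _, _, .mul => (MonObj.mul : P.M.X ⊗ P.M.X ⟶ P.M.X)
  | _, _, .one => (MonObj.one : 𝟙_ P.V ⟶ P.M.X)
  | _, _, .op i => MonWord.powHom P.M.X (k i) ≫ g i
  | _, _, .zero _ _ => 0
  | _, _, .add f h => eval P g f + eval P g h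
  | _, _, .neg f => -eval P g f

/-- Two formal morphisms are identified if they agree in all pairs with operations. -/
def GenTerm.setoid (X Y : MonWord) : Setoid (GenTerm k X Y) where
  r s t := ∀ (P : MonPair.{v, u}) (g : (i : I) → P.End (k i)), s.eval P g = t.eval P g
  iseqv := ⟨fun _ _ _ => rfl, fun h P g => (h P g).symm, fun h h' P g => (h P g).trans (h' P g)⟩

/-- The morphisms of the free preadditive monoidal category on a monoid with operations. -/
def GenHom (X Y : MonWord) : Type v := ULift.{v} (Quotient (GenTerm.setoid.{v, u} (k := k) X Y))

namespace GenHom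

/-- The class of a formal morphism. -/
def mk {X Y : MonWord} (t : GenTerm k X Y) : GenHom.{v, u} (k := k) X Y := ⟨Quotient.mk _ t⟩

/-- A formal morphism representing a class. -/
noncomputable def out {X Y : MonWord} (f : GenHom.{v, u} (k := k) X Y) : GenTerm k X Y :=
  Quotient.out f.down

/-- The interpretation of a morphism in a pair `(V, M)` with operations `g i`. -/
noncomputable def eval (P : MonPair.{v, u}) (g : (i : I) → P.End (k i)) {X Y : MonWord}
    (f : GenHom.{v, u} (k := k) X Y) : X.obj P.M.X ⟶ Y.obj P.M.X := f.out.eval P g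

@[simp] theorem eval_mk (P : MonPair.{v, u}) (g : (i : I) → P.End (k i)) {X Y : MonWord}
    (t : GenTerm k X Y) : eval P g (mk t) = t.eval P g :=
  Quotient.mk_out (s := GenTerm.setoid X Y) t P g

/-- Terms are identified when they agree in all pairs, so no relations need to be listed: each axiom
of a preadditive monoidal category holds for the classes because it holds in every pair. -/
theorem ext {X Y : MonWord} {f f' : GenHom.{v, u} (k := k) X Y}
    (h : ∀ P g, eval P g f = eval P g f') : f = f' :=
  ULift.ext _ _ (Quotient.out_equiv_out.1 h)

theorem mk_out {X Y : MonWord} (f : GenHom.{v, u} (k := k) X Y) : mk f.out = f :=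
  ext fun _ _ => eval_mk _ _ _

end GenHom

variable (k) in
/-- The free preadditive monoidal category on a monoid with operations of arities `k i`. -/
abbrev GenCat : Type u := WordObj.{v, u} (GenHom.{v, u} (k := k))

namespace GenCat

open GenHom

/-- Operations on classes use chosen representatives; by `eval_mk` the choice does not affect any
evaluation. -/
noncomputable instance : CategoryStruct.{v} (GenCat.{v, u} k) where
  Hom X Y := GenHom.{v, u} (k := k) X.word Y.word
  id _ := mk (.id _)
  comp f g := mk (.comp f.out g.out)

section

variable (P : MonPair.{v, u}) (g : (i : I) → P.End (k i))

/-- The interpretation of a morphism in a pair `(V, M)` with operations `g i`. -/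
noncomputable def eval {X Y : GenCat.{v, u} k} (f : X ⟶ Y) :
    X.word.obj P.M.X ⟶ Y.word.obj P.M.X := GenHom.eval P g f

@[simp] theorem eval_id (X : GenCat.{v, u} k) : eval P g (𝟙 X) = 𝟙 _ := eval_mk _ _ _

@[simp] theorem eval_comp {X Y Z : GenCat.{v, u} k} (f : X ⟶ Y) (h : Y ⟶ Z) :
    eval P g (f ≫ h) = eval P g f ≫ eval P g h := eval_mk _ _ _

end

theorem hom_ext {X Y : GenCat.{v, u} k} {f f' : X ⟶ Y} (h : ∀ P g, eval P g f = eval P g f') :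
    f = f' := GenHom.ext h

noncomputable instance : Category.{v} (GenCat.{v, u} k) where
  id_comp f := hom_ext fun P g => by simp
  comp_id f := hom_ext fun P g => by simp
  assoc f g h := hom_ext fun P g => by simp

noncomputable instance (X Y : GenCat.{v, u} k) : Add (X ⟶ Y) := ⟨fun f g => mk (.add (out f) (out g))⟩
noncomputable instance (X Y : GenCat.{v, u} k) : Zero (X ⟶ Y) := ⟨mk (.zero _ _)⟩
noncomputable instance (X Y : GenCat.{v, u} k) : Neg (X ⟶ Y) := ⟨fun f => mk (.neg (out f))⟩

section

variable (P : MonPair.{v, u}) (g : (i : I) → P.End (k i))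

@[simp] theorem eval_add {X Y : GenCat.{v, u} k} (f h : X ⟶ Y) :
    eval P g (f + h) = eval P g f + eval P g h := eval_mk _ _ _

@[simp] theorem eval_zero (X Y : GenCat.{v, u} k) : eval P g (0 : X ⟶ Y) = 0 := eval_mk _ _ _

@[simp] theorem eval_neg {X Y : GenCat.{v, u} k} (f : X ⟶ Y) :
    eval P g (-f) = -eval P g f := eval_mk _ _ _

end

noncomputable instance (X Y : GenCat.{v, u} k) : AddCommGroup (X ⟶ Y) where
  add_assoc f g h := hom_ext fun P g => by simp [add_assoc]
  zero_add f := hom_ext fun P g => by simp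
  add_zero f := hom_ext fun P g => by simp
  neg_add_cancel f := hom_ext fun P g => by simp
  add_comm f f' := hom_ext fun P g => by simp [add_comm]
  nsmul := nsmulRec
  zsmul := zsmulRec

noncomputable instance : Preadditive (GenCat.{v, u} k) where
  homGroup _ _ := inferInstance
  add_comp _ _ _ f f' g := hom_ext fun P g => by simp
  comp_add _ _ _ f g g' := hom_ext fun P g => by simp

/-- An isomorphism given by mutually inverse formal morphisms. -/
noncomputable def isoMk (X Y : GenCat.{v, u} k) (s : GenTerm k X.word Y.word)
    (t : GenTerm k Y.word X.word)
    (h : ∀ (P : MonPair.{v, u}) (g : (i : I) → P.End (k i)), s.eval P g ≫ t.eval P g = 𝟙 _)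
    (h' : ∀ (P : MonPair.{v, u}) (g : (i : I) → P.End (k i)), t.eval P g ≫ s.eval P g = 𝟙 _) :
    X ≅ Y where
  hom := mk s
  inv := mk t
  hom_inv_id := hom_ext fun P g => (eval_comp _ _ _ _).trans
    ((congrArg₂ (· ≫ ·) (eval_mk _ _ _) (eval_mk _ _ _)).trans ((h P g).trans (eval_id P g X).symm))
  inv_hom_id := hom_ext fun P g => (eval_comp _ _ _ _).trans
    ((congrArg₂ (· ≫ ·) (eval_mk _ _ _) (eval_mk _ _ _)).trans ((h' P g).trans (eval_id P g Y).symm))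

noncomputable instance : MonoidalCategoryStruct (GenCat.{v, u} k) where
  tensorObj X Y := ⟨.tensor X.word Y.word⟩
  tensorUnit := ⟨.unit⟩
  whiskerLeft X _ _ f := mk (.whiskerLeft X.word (out f))
  whiskerRight f Z := mk (.whiskerRight (out f) Z.word)
  associator X Y Z := isoMk ⟨_⟩ ⟨_⟩ (.assocHom X.word Y.word Z.word) (.assocInv _ _ _)
    (fun _ _ => Iso.hom_inv_id _) (fun _ _ => Iso.inv_hom_id _)
  leftUnitor X := isoMk ⟨_⟩ X (.leftHom _) (.leftInv _)
    (fun _ _ => Iso.hom_inv_id _) (fun _ _ => Iso.inv_hom_id _)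
  rightUnitor X := isoMk ⟨_⟩ X (.rightHom _) (.rightInv _)
    (fun _ _ => Iso.hom_inv_id _) (fun _ _ => Iso.inv_hom_id _)
  tensorHom f g := mk (.comp (.whiskerRight (out f) _) (.whiskerLeft _ (out g)))

section

variable (P : MonPair.{v, u}) (g : (i : I) → P.End (k i)) {X Y Z : GenCat.{v, u} k}

@[simp] theorem eval_whiskerLeft (X : GenCat.{v, u} k) (f : Y ⟶ Z) :
    eval P g (X ◁ f) = X.word.obj P.M.X ◁ eval P g f := eval_mk _ _ _

@[simp] theorem eval_whiskerRight (f : X ⟶ Y) (Z : GenCat.{v, u} k) :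
    eval P g (f ▷ Z) = eval P g f ▷ Z.word.obj P.M.X := eval_mk _ _ _

@[simp] theorem eval_tensorHom {X₁ Y₁ X₂ Y₂ : GenCat.{v, u} k} (f : X₁ ⟶ Y₁) (f' : X₂ ⟶ Y₂) :
    eval P g (f ⊗ₘ f') = eval P g f ⊗ₘ eval P g f' :=
  (eval_mk _ _ _).trans (MonoidalCategory.tensorHom_def _ _).symm

@[simp] theorem eval_associator_hom (X Y Z : GenCat.{v, u} k) :
    eval P g (α_ X Y Z).hom = (α_ _ _ _).hom := eval_mk _ _ _

@[simp] theorem eval_leftUnitor_hom (X : GenCat.{v, u} k) :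
    eval P g (λ_ X).hom = (λ_ _).hom := eval_mk _ _ _

@[simp] theorem eval_rightUnitor_hom (X : GenCat.{v, u} k) :
    eval P g (ρ_ X).hom = (ρ_ _).hom := eval_mk _ _ _

end

@[simp] theorem obj_tensor {V : Type*} [Category V] [MonoidalCategory V] (M : V)
    (X Y : GenCat.{v, u} k) : (X ⊗ Y).word.obj M = X.word.obj M ⊗ Y.word.obj M := rfl

@[simp] theorem obj_unit {V : Type*} [Category V] [MonoidalCategory V] (M : V) :
    (𝟙_ (GenCat.{v, u} k)).word.obj M = 𝟙_ V := rfl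

noncomputable instance : MonoidalCategory (GenCat.{v, u} k) where
  tensorHom_def f g := hom_ext fun P g => by simp [MonoidalCategory.tensorHom_def]
  id_tensorHom_id _ _ := hom_ext fun P g => by simp
  tensorHom_comp_tensorHom _ _ _ _ := hom_ext fun P g => by simp
  whiskerLeft_id _ _ := hom_ext fun P g => by simp
  id_whiskerRight _ _ := hom_ext fun P g => by simp
  associator_naturality _ _ _ := hom_ext fun P g => by
    simp only [eval_comp, eval_tensorHom, eval_associator_hom]
    exact associator_naturality _ _ _
  leftUnitor_naturality _ := hom_ext fun P g => by
    simp only [eval_comp, eval_whiskerLeft, eval_leftUnitor_hom]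
    exact leftUnitor_naturality _
  rightUnitor_naturality _ := hom_ext fun P g => by
    simp only [eval_comp, eval_whiskerRight, eval_rightUnitor_hom]
    exact rightUnitor_naturality _
  pentagon _ _ _ _ := hom_ext fun P g => by
    simp only [eval_comp, eval_whiskerRight, eval_whiskerLeft, eval_associator_hom]
    exact pentagon _ _ _ _
  triangle _ _ := hom_ext fun P g => by
    simp only [eval_comp, eval_whiskerRight, eval_whiskerLeft, eval_associator_hom,
      eval_leftUnitor_hom, eval_rightUnitor_hom]
    exact triangle _ _

noncomputable instance : MonoidalPreadditive (GenCat.{v, u} k) where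
  whiskerLeft_zero := hom_ext fun P g => by simp; rfl
  zero_whiskerRight := hom_ext fun P g => by simp; rfl
  whiskerLeft_add _ _ := hom_ext fun P g => by simp; rfl
  add_whiskerRight _ _ := hom_ext fun P g => by simp; rfl

variable (k) in
/-- The generating object. -/
def gen : GenCat.{v, u} k := ⟨.gen⟩

/-- The multiplication of the generating monoid. -/
noncomputable def genMul : gen.{v, u} k ⊗ gen k ⟶ gen k := mk .mul

/-- The unit of the generating monoid. -/
noncomputable def genOne : 𝟙_ (GenCat.{v, u} k) ⟶ gen k := mk .one

@[simp] theorem eval_genMul (P : MonPair.{v, u}) (g : (i : I) → P.End (k i)) :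
    eval P g genMul = (MonObj.mul : P.M.X ⊗ P.M.X ⟶ P.M.X) := eval_mk _ _ _

@[simp] theorem eval_genOne (P : MonPair.{v, u}) (g : (i : I) → P.End (k i)) :
    eval P g genOne = (MonObj.one : 𝟙_ P.V ⟶ P.M.X) := eval_mk _ _ _

noncomputable instance : MonObj (gen.{v, u} k) where
  one := genOne
  mul := genMul
  one_mul := hom_ext fun P g => by
    simp only [eval_comp, eval_whiskerRight, eval_genMul, eval_genOne, eval_leftUnitor_hom]
    exact MonObj.one_mul P.M.X
  mul_one := hom_ext fun P g => by
    simp only [eval_comp, eval_whiskerLeft, eval_genMul, eval_genOne, eval_rightUnitor_hom]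
    exact MonObj.mul_one P.M.X
  mul_assoc := hom_ext fun P g => by
    simp only [eval_comp, eval_whiskerLeft, eval_whiskerRight, eval_genMul, eval_associator_hom]
    exact MonObj.mul_assoc P.M.X

end GenCat

end GenericPair

section GenericPair

variable {I : Type} (k : I → ℕ)

/-- The free pair on operations of arities `k i`. -/
noncomputable def genPair : MonPair.{v, u} where
  V := GenCat.{v, u} k
  M := ⟨GenCat.gen k⟩

namespace GenCat

/-- The canonical isomorphism from the tensor power of the generator to a formal tensor power. -/
noncomputable def toPow : (n : ℕ) → (tpow (gen.{v, u} k) n ⟶ ⟨.pow n⟩)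
  | 0 => 𝟙 _
  | n + 1 => toPow n ▷ gen k

/-- The generic operations. -/
noncomputable def genOp (i : I) : (genPair.{v, u} k).End (k i) :=
  toPow k (k i) ≫ GenHom.mk (.op i)

variable {k} (P : MonPair.{v, u}) (g : (i : I) → P.End (k i))

/-- The monoidal functor from the free pair to a pair with operations. -/
noncomputable def evalFunctor : GenCat.{v, u} k ⥤ P.V where
  obj X := X.word.obj P.M.X
  map f := eval P g f

theorem evalFunctor_additive : (evalFunctor P g).Additive where
  map_add := eval_add P g _ _

/-- The strict monoidal structure of the interpretation. -/
@[reducible] noncomputable def evalFunctorMonoidal : (evalFunctor P g).Monoidal :=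
  Functor.CoreMonoidal.toMonoidal
    -- A tensor product of words is interpreted, by definition, as the tensor product of the
    -- interpretations, so identities serve as structure maps.
    { εIso := Iso.refl _
      μIso := fun _ _ => Iso.refl _
      μIso_hom_natural_left := fun f X => by
        have aux : ∀ {A B : P.V} {f f' : A ⟶ B}, f' = f → f ≫ 𝟙 B = 𝟙 A ≫ f' := by simp
        exact aux (eval_whiskerRight P g f X)
      μIso_hom_natural_right := fun X f => by
        have aux : ∀ {A B : P.V} {f f' : A ⟶ B}, f' = f → f ≫ 𝟙 B = 𝟙 A ≫ f' := by simp
        exact aux (eval_whiskerLeft P g X f)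
      associativity := fun X Y Z => by
        have aux : ∀ {A B C : P.V} {f : (A ⊗ B) ⊗ C ⟶ A ⊗ B ⊗ C}, f = (α_ A B C).hom →
            𝟙 (A ⊗ B) ▷ C ≫ 𝟙 _ ≫ f = (α_ A B C).hom ≫ A ◁ 𝟙 (B ⊗ C) ≫ 𝟙 _ := by
          rintro A B C f rfl; simp
        exact aux (eval_associator_hom P g X Y Z)
      left_unitality := fun X => by
        have aux : ∀ {A : P.V} {f : 𝟙_ _ ⊗ A ⟶ A}, f = (λ_ A).hom →
            (λ_ A).hom = 𝟙 _ ▷ A ≫ 𝟙 _ ≫ f := by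
          rintro A f rfl; simp
        exact aux (eval_leftUnitor_hom P g X)
      right_unitality := fun X => by
        have aux : ∀ {A : P.V} {f : A ⊗ 𝟙_ _ ⟶ A}, f = (ρ_ A).hom →
            (ρ_ A).hom = A ◁ 𝟙 _ ≫ 𝟙 _ ≫ f := by
          rintro A f rfl; simp
        exact aux (eval_rightUnitor_hom P g X) }

/-- The morphism from the free pair to a pair with operations. -/
noncomputable def evalHom : MonPair.Hom (genPair.{v, u} k) P where
  F := evalFunctor P g
  additive := evalFunctor_additive P g
  monoidal := evalFunctorMonoidal P g
  iso := letI := evalFunctorMonoidal P g; Mon.mkIso (M := (evalFunctor P g).mapMon.obj ⟨gen k⟩) (N := P.M) (Iso.refl P.M.X)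
    ((Category.comp_id _).trans ((Category.id_comp _).trans (eval_genOne P g)))
    (by
      have aux : ∀ {A B : P.V} {f f' : A ⊗ A ⟶ B}, f = f' →
        (𝟙 _ ≫ f) ≫ 𝟙 B = (𝟙 A ⊗ₘ 𝟙 A) ≫ f' := by simp
      exact aux (eval_genMul P g))

/-- This absorbs the comparison `powHom` built into the evaluation of a formal operation, and is
what makes `evalHom_genOp` an exact equality. -/
theorem evalHom_tpowMap (n : ℕ) : (evalHom P g).tpowMap n ≫ eval P g (toPow k n) ≫
    MonWord.powHom P.M.X n = 𝟙 (tpow P.M.X n) := by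
  induction n with
  | zero =>
    have aux : ∀ {A : P.V} {f : A ⟶ A}, f = 𝟙 A → 𝟙 A ≫ f ≫ 𝟙 A = 𝟙 A := by
      rintro A f rfl; simp
    exact aux (eval_id P g (𝟙_ (GenCat.{v, u} k)))
  | succ n ih =>
    have aux : ∀ {A B C D : P.V} {f : A ⟶ B} {h : B ⟶ C} {h' : B ⊗ D ⟶ C ⊗ D} {j : C ⟶ A},
        f ≫ h ≫ j = 𝟙 A → h' = h ▷ D →
        ((f ⊗ₘ 𝟙 D) ≫ 𝟙 (B ⊗ D)) ≫ h' ≫ j ▷ D = 𝟙 (A ⊗ D) := by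
      rintro A B C D f h h' j e rfl
      simp [← comp_whiskerRight, e]
    exact aux ih (eval_whiskerRight P g (toPow k n) (gen k))

/-- The existence half of the universal property, which is all that is used: every family of
operations is the image of the generic one. -/
theorem evalHom_genOp (i : I) : (evalHom P g).map (k i) (genOp k i) = g i := by
  have aux : ∀ {A B C D E : P.V} {t : A ⟶ B} {x : B ⟶ C} {y : C ⟶ A} {h : A ⟶ E} {q : B ⟶ E}
      {r : C ⟶ E}, t ≫ x ≫ y = 𝟙 A → q = x ≫ r → r = y ≫ h → t ≫ q ≫ 𝟙 E = h := by
    rintro A B C D E t x y h q r e rfl rfl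
    simp [reassoc_of% e]
  exact aux (D := P.M.X) (evalHom_tpowMap P g (k i)) (eval_comp P g (toPow k (k i)) _)
    (GenHom.eval_mk P g (.op i))

end GenCat

end GenericPair

/-! ### Morphisms of the free pair are combinations of forests. -/

section GenericPair

variable {I : Type} (k : I → ℕ)

namespace GenCat

/-- The canonical isomorphism from a word to a tensor power of the generator. -/
noncomputable def canon : (X : MonWord) → ((⟨X⟩ : GenCat.{v, u} k) ≅ tpow (gen.{v, u} k) X.length)
  | .unit => Iso.refl _
  | .gen => (λ_ (gen k)).symm
  | .tensor X Y => (canon X ⊗ᵢ canon Y) ≪≫ (tpowAdd (gen k) X.length Y.length).symm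

/-- By the triangle identity, the unit that `canon` puts in front of the last letter is absorbed by
the right unitor inside `tpowAdd`. -/
theorem canon_tensor_gen {A : MonWord} {T : GenCat.{v, u} k}
    {c : tpow (gen.{v, u} k) A.length ⟶ T} {d : T ⟶ ⟨A⟩}
    (h : (canon k A).inv = c ≫ d) : (canon k (.tensor A .gen)).inv = c ▷ gen k ≫ d ▷ gen k := by
  have aux : ∀ {V : Type u} [Category.{v} V] [MonoidalCategory V] {A B T M : V} {a : A ⟶ B}
      {c : A ⟶ T} {d : T ⟶ B} (_ : a = c ≫ d), ((ρ_ A).inv ▷ M ≫ (α_ A (𝟙_ V) M).hom) ≫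
        (a ⊗ₘ (λ_ M).hom) = c ▷ M ≫ d ▷ M := by
    intro V _ _ A B T M a c d h
    subst h
    simp [MonoidalCategory.tensorHom_def']
  exact aux h

theorem length_pow (n : ℕ) : (MonWord.pow n).length = n := by
  induction n with
  | zero => rfl
  | succ n ih => exact congrArg (· + 1) ih

theorem canon_pow (n : ℕ) :
    (canon k (.pow n)).inv = tpowCast (gen.{v, u} k) (length_pow n) ≫ toPow k n := by
  induction n with
  | zero => exact (Category.comp_id _).symm
  | succ n ih =>
    exact (canon_tensor_gen k ih).trans
      (congrArg (· ≫ _) (tpowCast_succ (gen k) (length_pow n) _).symm)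

theorem length_tpow (n : ℕ) : (tpow (gen.{v, u} k) n).word.length = n := by
  induction n with
  | zero => rfl
  | succ n ih => exact congrArg (· + 1) ih

theorem canon_tpow (n : ℕ) :
    (canon k (tpow (gen.{v, u} k) n).word).inv = tpowCast (gen.{v, u} k) (length_tpow k n) := by
  induction n with
  | zero => rfl
  | succ n ih =>
    have aux : ∀ {A B : GenCat.{v, u} k} (f : A ⟶ B), f ▷ gen k ≫ 𝟙 B ▷ gen k = f ▷ gen k := by
      simp
    exact (canon_tensor_gen k (ih.trans (Category.comp_id _).symm)).trans
      ((aux _).trans (tpowCast_succ (gen k) (length_tpow k n) _).symm)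

variable {k}

/-- The class of a formal morphism. -/
noncomputable def homMk {X Y : MonWord} (t : GenTerm k X Y) : (⟨X⟩ : GenCat.{v, u} k) ⟶ ⟨Y⟩ :=
  GenHom.mk t

theorem eval_homMk (P : MonPair.{v, u}) (g : (i : I) → P.End (k i)) {X Y : MonWord}
    (t : GenTerm k X Y) : eval P g (homMk t) = t.eval P g := GenHom.eval_mk P g t

theorem homMk_comp {X Y Z : MonWord} (s : GenTerm k X Y) (t : GenTerm k Y Z) :
    homMk.{v, u} (.comp s t) = homMk s ≫ homMk t := hom_ext fun P g => by
  rw [eval_comp, eval_homMk, eval_homMk, eval_homMk]; rfl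

theorem homMk_whiskerLeft (X : MonWord) {Y Z : MonWord} (t : GenTerm k Y Z) :
    homMk.{v, u} (.whiskerLeft X t) = (⟨X⟩ : GenCat.{v, u} k) ◁ homMk t := hom_ext fun P g => by
  rw [eval_whiskerLeft, eval_homMk, eval_homMk]; rfl

theorem homMk_whiskerRight {X Y : MonWord} (t : GenTerm k X Y) (Z : MonWord) :
    homMk.{v, u} (.whiskerRight t Z) = homMk t ▷ (⟨Z⟩ : GenCat.{v, u} k) := hom_ext fun P g => by
  rw [eval_whiskerRight, eval_homMk, eval_homMk]; rfl

theorem homMk_add {X Y : MonWord} (s t : GenTerm k X Y) :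
    homMk.{v, u} (.add s t) = homMk s + homMk t := hom_ext fun P g => by
  rw [eval_add, eval_homMk, eval_homMk, eval_homMk]; rfl

theorem homMk_neg {X Y : MonWord} (t : GenTerm k X Y) :
    homMk.{v, u} (.neg t) = -homMk t := hom_ext fun P g => by
  rw [eval_neg, eval_homMk, eval_homMk]; rfl

/-- A morphism between words as a morphism between tensor powers of the generator. -/
noncomputable def conj {X Y : MonWord} (f : (⟨X⟩ : GenCat.{v, u} k) ⟶ ⟨Y⟩) :
    tpow (gen.{v, u} k) X.length ⟶ tpow (gen k) Y.length :=
  (canon k X).inv ≫ f ≫ (canon k Y).hom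

/-- Coherence: transported to tensor powers, associators and unitors are mere casts of exponents,
hence represented by forests. -/
theorem conj_assoc (X Y Z : MonWord) :
    conj (α_ (⟨X⟩ : GenCat.{v, u} k) ⟨Y⟩ ⟨Z⟩).hom =
      tpowCast (gen k) (add_assoc X.length Y.length Z.length) := by
  have h := tpowAdd_assoc (gen.{v, u} k) X.length Y.length Z.length
  have aux : ∀ {V : Type u} [Category.{v} V] [MonoidalCategory V] {A B C A' B' C' D E F G : V}
      (x : A ≅ A') (y : B ≅ B') (z : C ≅ C') (t : G ⟶ D ⊗ C') (t' : D ⟶ A' ⊗ B')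
      (c : G ⟶ E) (s : E ≅ A' ⊗ F) (s' : F ≅ B' ⊗ C')
      (_ : t ≫ t' ▷ C' ≫ (α_ A' B' C').hom = c ≫ s.hom ≫ A' ◁ s'.hom),
      (t ≫ ((t' ≫ (x.inv ⊗ₘ y.inv)) ⊗ₘ z.inv)) ≫ (α_ A B C).hom ≫
        (x.hom ⊗ₘ ((y.hom ⊗ₘ z.hom) ≫ s'.inv)) ≫ s.inv = c := by
    intro V _ _ A B C A' B' C' D E F G x y z t t' c s s' h
    rw [← whiskerRight_comp_tensorHom, ← tensorHom_comp_whiskerLeft]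
    simp only [Category.assoc, associator_naturality_assoc,
      MonoidalCategory.tensorHom_comp_tensorHom_assoc, Iso.inv_hom_id]
    rw [reassoc_of% h]
    simp
  exact aux (canon k X) (canon k Y) (canon k Z) _ _ _ (tpowAdd _ _ _) (tpowAdd _ _ _) h

theorem conj_left (X : MonWord) :
    conj (λ_ (⟨X⟩ : GenCat.{v, u} k)).hom = tpowCast (gen k) (zero_add X.length) := by
  have aux : ∀ {V : Type u} [Category.{v} V] [MonoidalCategory V] {A B C : V} (x : A ≅ B)
      (c : C ⟶ B) (t : C ⟶ 𝟙_ V ⊗ B) (_ : t = c ≫ (λ_ B).inv),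
      (t ≫ (𝟙 _ ⊗ₘ x.inv)) ≫ (λ_ A).hom ≫ x.hom = c := by
    rintro V _ _ A B C x c t rfl
    simp
  exact aux (canon k X) _ _ (tpowAdd_zero_left (gen.{v, u} k) X.length)

theorem conj_right (X : MonWord) : conj (ρ_ (⟨X⟩ : GenCat.{v, u} k)).hom = 𝟙 _ := by
  have aux : ∀ {V : Type u} [Category.{v} V] [MonoidalCategory V] {A B : V} (x : A ≅ B),
      ((ρ_ B).inv ≫ (x.inv ⊗ₘ 𝟙 _)) ≫ (ρ_ A).hom ≫ x.hom = 𝟙 B := by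
    intro V _ _ A B x
    simp
  exact aux (canon k X)

theorem conj_whiskerLeft (X : MonWord) {Y Z : MonWord} (f : (⟨Y⟩ : GenCat.{v, u} k) ⟶ ⟨Z⟩) :
    conj ((⟨X⟩ : GenCat.{v, u} k) ◁ f) = tpowTensor (𝟙 _) (conj f) := by
  have aux : ∀ {V : Type u} [Category.{v} V] [MonoidalCategory V] {A A' B B' C C' D E : V}
      (x : A ≅ A') (y : B ≅ B') (z : C ≅ C') (f : B ⟶ C) (t : D ⟶ A' ⊗ B') (s : A' ⊗ C' ⟶ E),
      (t ≫ (x.inv ⊗ₘ y.inv)) ≫ A ◁ f ≫ (x.hom ⊗ₘ z.hom) ≫ s =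
        t ≫ (𝟙 _ ⊗ₘ (y.inv ≫ f ≫ z.hom)) ≫ s := by
    intro V _ _ A A' B B' C C' D E x y z f t s
    rw [whiskerLeft_comp_tensorHom_assoc, Category.assoc,
      MonoidalCategory.tensorHom_comp_tensorHom_assoc, Iso.inv_hom_id]
  exact aux _ _ _ _ _ _

theorem conj_whiskerRight {X Y : MonWord} (f : (⟨X⟩ : GenCat.{v, u} k) ⟶ ⟨Y⟩) (Z : MonWord) :
    conj (f ▷ (⟨Z⟩ : GenCat.{v, u} k)) = tpowTensor (conj f) (𝟙 _) := by
  have aux : ∀ {V : Type u} [Category.{v} V] [MonoidalCategory V] {A A' B B' C C' D E : V}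
      (x : A ≅ A') (y : B ≅ B') (z : C ≅ C') (f : B ⟶ C) (t : D ⟶ B' ⊗ A') (s : C' ⊗ A' ⟶ E),
      (t ≫ (y.inv ⊗ₘ x.inv)) ≫ f ▷ A ≫ (z.hom ⊗ₘ x.hom) ≫ s =
        t ≫ ((y.inv ≫ f ≫ z.hom) ⊗ₘ 𝟙 _) ≫ s := by
    intro V _ _ A A' B B' C C' D E x y z f t s
    rw [whiskerRight_comp_tensorHom_assoc, Category.assoc,
      MonoidalCategory.tensorHom_comp_tensorHom_assoc, Iso.inv_hom_id]
  exact aux _ _ _ _ _ _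

theorem conj_comp {X Y Z : MonWord} (f : (⟨X⟩ : GenCat.{v, u} k) ⟶ ⟨Y⟩)
    (g : (⟨Y⟩ : GenCat.{v, u} k) ⟶ ⟨Z⟩) : conj (f ≫ g) = conj f ≫ conj g := by
  simp [conj]

theorem conj_add {X Y : MonWord} (f g : (⟨X⟩ : GenCat.{v, u} k) ⟶ ⟨Y⟩) :
    conj (f + g) = conj f + conj g := by
  simp [conj]

theorem conj_neg {X Y : MonWord} (f : (⟨X⟩ : GenCat.{v, u} k) ⟶ ⟨Y⟩) :
    conj (-f) = -conj f := by
  simp [conj]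

theorem conj_id (X : MonWord) : conj (𝟙 (⟨X⟩ : GenCat.{v, u} k)) = 𝟙 _ := by
  simp [conj]

theorem conj_inv {X Y : MonWord} (e : (⟨X⟩ : GenCat.{v, u} k) ≅ ⟨Y⟩) (h : X.length = Y.length)
    (he : conj e.hom = tpowCast (gen k) h) : conj e.inv = tpowCast (gen k) h.symm := by
  have h' : tpowCast (gen k) h ≫ conj e.inv = 𝟙 _ := by
    rw [← he, ← conj_comp, Iso.hom_inv_id, conj_id]
  have h'' := congrArg (tpowCast (gen k) h.symm ≫ ·) h'
  simpa [← Category.assoc, tpowCast_trans] using h''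

open Forest in
-- The normal form theorem. In the induction on terms, composition and whiskering are the closure of
-- forests under substitution and tensor products, structure isomorphisms become casts, and the
-- monoid structure and the operations are themselves forests.
theorem conj_mem_repSpan {X Y : MonWord} (t : GenTerm k X Y) :
    conj (homMk t) ∈
      repSpan (genOp.{v, u} k) X.length Y.length := by
  have id_mem : ∀ n, 𝟙 (tpow (gen.{v, u} k) n) ∈ repSpan (genOp.{v, u} k) n n :=
    fun n => AddSubgroup.subset_closure (IsRep.id n)
  have cast_mem : ∀ {m n} (h : m = n),
      tpowCast (gen.{v, u} k) h ∈ repSpan (genOp.{v, u} k) m n := by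
    rintro m _ rfl; exact id_mem m
  induction t with
  | id X => exact (conj_id X).symm ▸ id_mem _
  | comp s t ih ih' => rw [homMk_comp, conj_comp]; exact comp_mem_repSpan ih ih'
  | whiskerLeft X t ih =>
    rw [homMk_whiskerLeft, conj_whiskerLeft]; exact tpowTensor_mem_repSpan (id_mem _) ih
  | whiskerRight t Z ih =>
    rw [homMk_whiskerRight, conj_whiskerRight]; exact tpowTensor_mem_repSpan ih (id_mem _)
  | assocHom X Y Z => exact (conj_assoc X Y Z).symm ▸ cast_mem _
  | assocInv X Y Z =>
    exact (conj_inv (α_ (⟨X⟩ : GenCat.{v, u} k) ⟨Y⟩ ⟨Z⟩) _ (conj_assoc X Y Z)).symm ▸ cast_mem _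
  | leftHom X => exact (conj_left X).symm ▸ cast_mem _
  | leftInv X => exact (conj_inv (λ_ (⟨X⟩ : GenCat.{v, u} k)) _ (conj_left X)).symm ▸ cast_mem _
  | rightHom X => exact (conj_right X).symm ▸ id_mem _
  | rightInv X =>
    exact (conj_inv (ρ_ (⟨X⟩ : GenCat.{v, u} k)) rfl (conj_right X)).symm ▸ cast_mem _
  | mul =>
    have h : conj (genMul.{v, u} : gen k ⊗ gen k ⟶ _) =
        (λ_ (gen.{v, u} k)).hom ▷ gen k ≫ genMul ≫ tpowOneInv (gen k) := by
      have aux : ∀ {V : Type u} [Category.{v} V] [MonoidalCategory V] {M : V} (m : M ⊗ M ⟶ M),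
        (((ρ_ (𝟙_ V ⊗ M)).inv ▷ M ≫ (α_ _ _ _).hom) ≫ ((λ_ M).hom ⊗ₘ (λ_ M).hom)) ≫ m ≫
          (λ_ M).inv = (λ_ M).hom ▷ M ≫ m ≫ (λ_ M).inv := by
        intro V _ _ M m
        simp [MonoidalCategory.tensorHom_def']
      exact aux _
    exact h ▸ AddSubgroup.subset_closure IsRep.mul
  | one =>
    have h : conj (genOne.{v, u} : 𝟙_ _ ⟶ gen k) = genOne ≫ tpowOneInv (gen k) :=
      Category.id_comp _
    exact h ▸ AddSubgroup.subset_closure IsRep.one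
  | op i =>
    have h : conj (homMk.{v, u} (.op i : GenTerm k _ _)) =
        tpowCast (gen k) (length_pow (k i)) ≫ genOp k i ≫ tpowOneInv (gen k) := by
      refine (congrArg (· ≫ _) (canon_pow k (k i))).trans ?_
      have aux : ∀ {A B C D E : GenCat.{v, u} k} (a : A ⟶ B) (b : B ⟶ C) (c : C ⟶ D) (d : D ⟶ E),
        (a ≫ b) ≫ c ≫ d = a ≫ (b ≫ c) ≫ d := by simp
      exact aux _ _ _ _
    exact h ▸ comp_mem_repSpan (cast_mem _) (AddSubgroup.subset_closure (IsRep.op i))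
  | zero X Y =>
    have h : conj (0 : (⟨X⟩ : GenCat.{v, u} k) ⟶ ⟨Y⟩) = 0 := by simp [conj]
    exact h ▸ zero_mem (repSpan (genOp.{v, u} k) X.length Y.length)
  | add s t ih ih' =>
    rw [homMk_add, conj_add]
    exact add_mem ih ih'
  | neg t ih =>
    rw [homMk_neg, conj_neg]
    exact neg_mem ih

theorem mem_repSpan (l : ℕ) (x : (genPair.{v, u} k).End l) :
    x ≫ tpowOneInv _ ∈ Forest.repSpan (genOp.{v, u} k) l 1 := by
  have key : ∀ {m l : ℕ} (h : m = l) (y : tpow (gen.{v, u} k) l ⟶ tpow (gen k) 1),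
      tpowCast (gen k) h ≫ y ∈ Forest.repSpan (genOp.{v, u} k) m 1 →
      y ∈ Forest.repSpan (genOp.{v, u} k) l 1 := by
    rintro m _ rfl y hy
    simpa using hy
  refine key (length_tpow k l) _ ?_
  -- The morphism `x` is the class of a formal term, to which the induction on terms applies.
  have h : conj (X := (tpow (gen.{v, u} k) l).word) (Y := .gen) x ∈ _ :=
    (congrArg conj (GenHom.mk_out x)) ▸ conj_mem_repSpan.{v, u} (GenHom.out x)
  have e : conj (X := (tpow (gen.{v, u} k) l).word) (Y := .gen) x = _ :=
    congrArg (· ≫ x ≫ tpowOneInv (gen k)) (canon_tpow k l)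
  exact e ▸ h

end GenCat

end GenericPair

/-! ### Words in a monoid, as a pair in arbitrary universes. -/

section WordCategory

variable {C : Type*} [Category.{0} C] [MonoidalCategory C]

/-- Morphisms between the interpretations of words. -/
def WordHom (M : C) (X Y : MonWord) : Type v := ULift.{v} (X.obj M ⟶ Y.obj M)

/-- The category of words in `M` with all morphisms between their interpretations. -/
abbrev WordCat (M : C) : Type u := WordObj.{v, u} (WordHom.{v} M)

namespace WordCat

variable {M : C}

/-- The pair of abelian groups and a ring has to live in the universes of the family operad, whereas
`ModuleCat ℤ` has fixed ones. The full image of the words in `M`, with lifted morphisms, contains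
all tensor powers that matter. -/
instance : Category.{v} (WordCat.{v, u} M) where
  Hom X Y := WordHom.{v} M X.word Y.word
  id X := ⟨𝟙 (X.word.obj M)⟩
  comp f g := ⟨f.down ≫ g.down⟩
  id_comp _ := ULift.ext _ _ (Category.id_comp _)
  comp_id _ := ULift.ext _ _ (Category.comp_id _)
  assoc _ _ _ := ULift.ext _ _ (Category.assoc _ _ _)

/-- The underlying morphism in `C`. -/
def hom {X Y : WordCat.{v, u} M} (f : X ⟶ Y) : X.word.obj M ⟶ Y.word.obj M := f.down

/-- The morphism of words given by a morphism in `C`. -/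
def ofHom {X Y : WordCat.{v, u} M} (f : X.word.obj M ⟶ Y.word.obj M) : X ⟶ Y := ⟨f⟩

theorem hom_ext {X Y : WordCat.{v, u} M} {f g : X ⟶ Y} (h : hom f = hom g) : f = g :=
  ULift.ext _ _ h

instance : MonoidalCategoryStruct (WordCat.{v, u} M) where
  tensorObj X Y := ⟨.tensor X.word Y.word⟩
  tensorUnit := ⟨.unit⟩
  whiskerLeft X _ _ f := ⟨X.word.obj M ◁ hom f⟩
  whiskerRight f Z := ⟨hom f ▷ Z.word.obj M⟩
  tensorHom f g := ⟨hom f ⊗ₘ hom g⟩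
  associator X Y Z := ⟨⟨(α_ (X.word.obj M) (Y.word.obj M) (Z.word.obj M)).hom⟩,
    ⟨(α_ (X.word.obj M) (Y.word.obj M) (Z.word.obj M)).inv⟩,
    hom_ext (Iso.hom_inv_id _), hom_ext (Iso.inv_hom_id _)⟩
  leftUnitor X := ⟨⟨(λ_ (X.word.obj M)).hom⟩, ⟨(λ_ (X.word.obj M)).inv⟩,
    hom_ext (Iso.hom_inv_id _), hom_ext (Iso.inv_hom_id _)⟩
  rightUnitor X := ⟨⟨(ρ_ (X.word.obj M)).hom⟩, ⟨(ρ_ (X.word.obj M)).inv⟩,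
    hom_ext (Iso.hom_inv_id _), hom_ext (Iso.inv_hom_id _)⟩

instance : MonoidalCategory (WordCat.{v, u} M) where
  tensorHom_def _ _ := hom_ext (MonoidalCategory.tensorHom_def (C := C) _ _)
  id_tensorHom_id _ _ := hom_ext (MonoidalCategory.id_tensorHom_id (C := C) _ _)
  tensorHom_comp_tensorHom _ _ _ _ := hom_ext (MonoidalCategory.tensorHom_comp_tensorHom (C := C) _ _ _ _)
  whiskerLeft_id _ _ := hom_ext (MonoidalCategory.whiskerLeft_id (C := C) _ _)
  id_whiskerRight _ _ := hom_ext (MonoidalCategory.id_whiskerRight (C := C) _ _)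
  associator_naturality _ _ _ := hom_ext (MonoidalCategory.associator_naturality (C := C) _ _ _)
  leftUnitor_naturality _ := hom_ext (MonoidalCategory.leftUnitor_naturality (C := C) _)
  rightUnitor_naturality _ := hom_ext (MonoidalCategory.rightUnitor_naturality (C := C) _)
  pentagon _ _ _ _ := hom_ext (MonoidalCategory.pentagon (C := C) _ _ _ _)
  triangle _ _ := hom_ext (MonoidalCategory.triangle (C := C) _ _)

variable (M) in
/-- The word with one letter. -/
def gen : WordCat.{v, u} M := ⟨.gen⟩

instance [MonObj M] : MonObj (gen.{v, u} M) where
  one := ⟨(MonObj.one : 𝟙_ C ⟶ M)⟩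
  mul := ⟨(MonObj.mul : M ⊗ M ⟶ M)⟩
  one_mul := hom_ext (MonObj.one_mul M)
  mul_one := hom_ext (MonObj.mul_one M)
  mul_assoc := hom_ext (MonObj.mul_assoc M)

variable [Preadditive C]

instance (X Y : WordCat.{v, u} M) : AddCommGroup (X ⟶ Y) :=
  inferInstanceAs (AddCommGroup (ULift (X.word.obj M ⟶ Y.word.obj M)))

instance : Preadditive (WordCat.{v, u} M) where
  homGroup _ _ := inferInstance
  add_comp _ _ _ _ _ _ := hom_ext (Preadditive.add_comp (C := C) _ _ _ _ _ _)
  comp_add _ _ _ _ _ _ := hom_ext (Preadditive.comp_add (C := C) _ _ _ _ _ _)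

instance [MonoidalPreadditive C] : MonoidalPreadditive (WordCat.{v, u} M) where
  whiskerLeft_zero := hom_ext (MonoidalPreadditive.whiskerLeft_zero (C := C))
  zero_whiskerRight := hom_ext (MonoidalPreadditive.zero_whiskerRight (C := C))
  whiskerLeft_add _ _ := hom_ext (MonoidalPreadditive.whiskerLeft_add (C := C) _ _)
  add_whiskerRight _ _ := hom_ext (MonoidalPreadditive.add_whiskerRight (C := C) _ _)

variable (M) in
/-- The pair given by a monoid in a preadditive monoidal category, in the universes `v` and `u`. -/
def pair [MonoidalPreadditive C] [MonObj M] : MonPair.{v, u} where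
  V := WordCat.{v, u} M
  M := ⟨gen M⟩

end WordCat

end WordCategory

/-! ### The pair of a ring, and its endomorphisms as Hochschild cochains. -/

section RingPair

open TensorProduct

variable (A : Type) [Ring A]

noncomputable instance : MonObj (ModuleCat.of ℤ A) :=
  ModuleCat.MonModuleEquivalenceAlgebra.inverseObj (AlgCat.of ℤ A)

/-- The pair of abelian groups and the ring `A`. -/
noncomputable def ringPair : MonPair.{v, u} := WordCat.pair.{v, u} (ModuleCat.of ℤ A)

namespace RingPair

variable {A}

/-- The elements of a tensor product given by pairs of elements. -/
def tmulCarrier {M N : ModuleCat.{0} ℤ} (x : M) (y : N) : (M ⊗ N : ModuleCat.{0} ℤ) := x ⊗ₜ[ℤ] y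

/-- An object of `ModuleCat ℤ` carries its own action of the integers, equal but not definitionally
equal to that of its additive group. With this lemma only additive maps need to be handled. -/
theorem zsmul_eq_smul (M : ModuleCat.{0} ℤ) (n : ℤ) (x : M) :
    M.isModule.toSMul.smul n x = (AddCommGroup.toIntModule M).toSMul.smul n x :=
  int_smul_eq_zsmul M.isModule n x

/-- The homomorphism on a tensor product given by a biadditive map. -/
def liftCarrier {M N : ModuleCat.{0} ℤ} {P : Type} [AddCommGroup P] (B : M →+ N →+ P) :
    (M ⊗ N : ModuleCat.{0} ℤ) →+ P :=
  TensorProduct.liftAddHom B fun n x y => by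
    have h1 := zsmul_eq_smul M n x
    have h2 := zsmul_eq_smul N n y
    refine (congrArg (fun t => B t y) h1).trans (Eq.trans ?_ (congrArg (B x) h2).symm)
    exact (congrArg (fun t => t y) (map_zsmul B n x)).trans (map_zsmul (B x) n y).symm

/-- The abelian group of a word in `A`. -/
def El (X : (ringPair.{v, u} A).V) : Type :=
  ModuleCat.carrier (MonWord.obj (V := ModuleCat.{0} ℤ) (ModuleCat.of ℤ A)
    (WordObj.word (H := WordHom.{v} (ModuleCat.of ℤ A)) X))

noncomputable instance (X : (ringPair.{v, u} A).V) : AddCommGroup (El X) :=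
  ModuleCat.isAddCommGroup (MonWord.obj (V := ModuleCat.{0} ℤ) (ModuleCat.of ℤ A)
    (WordObj.word (H := WordHom.{v} (ModuleCat.of ℤ A)) X))

/-- The group homomorphism given by a morphism of words. -/
noncomputable def ap {X Y : (ringPair.{v, u} A).V} (f : X ⟶ Y) : El X →+ El Y :=
  (WordCat.hom (M := ModuleCat.of ℤ A) f).hom.toAddMonoidHom

/-- The tensor product of elements. -/
noncomputable def tm {X Y : (ringPair.{v, u} A).V} : El X →+ El Y →+ El (X ⊗ Y) :=
  AddMonoidHom.mk' (fun x => AddMonoidHom.mk' (fun y => tmulCarrier x y)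
    (TensorProduct.tmul_add (M := ModuleCat.carrier _) (N := ModuleCat.carrier _) _))
    (fun x x' => AddMonoidHom.ext fun y =>
      TensorProduct.add_tmul (M := ModuleCat.carrier _) (N := ModuleCat.carrier _) x x' y)

/-- The element of `El gen` given by an element of `A`. -/
def ofA : A ≃+ El.{v, u} (ringPair.{v, u} A).M.X := AddEquiv.refl A

/-- The element of the unit given by an integer. -/
def ofZ : ℤ ≃+ El.{v, u} (𝟙_ (ringPair.{v, u} A).V) := AddEquiv.refl ℤ

variable {X Y Z W : (ringPair.{v, u} A).V}

theorem ap_comp (f : X ⟶ Y) (g : Y ⟶ Z) (x : El X) : ap (f ≫ g) x = ap g (ap f x) := rfl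

theorem ap_id (x : El X) : ap (𝟙 X) x = x := rfl

theorem ap_injective : Function.Injective (ap : (X ⟶ Y) → (El X →+ El Y)) :=
  fun _ _ h => WordCat.hom_ext (M := ModuleCat.of ℤ A)
    (ModuleCat.hom_ext (LinearMap.ext fun x => DFunLike.congr_fun h x))

theorem ap_surjective : Function.Surjective (ap : (X ⟶ Y) → (El X →+ El Y)) :=
  fun φ => ⟨WordCat.ofHom (M := ModuleCat.of ℤ A) (ModuleCat.ofHom
    { φ with
      map_smul' := fun n x => (congrArg φ (zsmul_eq_smul _ n x)).trans
        ((map_zsmul φ n x).trans (zsmul_eq_smul _ n (φ x)).symm) }), rfl⟩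

theorem ap_leftUnitor_hom (n : ℤ) (x : El X) : ap (λ_ X).hom (tm (ofZ n) x) = n • x :=
  (TensorProduct.lid_tmul (R := ℤ) (M := MonWord.obj (V := ModuleCat.{0} ℤ) (ModuleCat.of ℤ A)
    (WordObj.word (H := WordHom.{v} (ModuleCat.of ℤ A)) X)) x n).trans (zsmul_eq_smul _ n x)

theorem ap_mul (x y : A) :
    ap (MonObj.mul : (ringPair.{v, u} A).M.X ⊗ (ringPair.{v, u} A).M.X ⟶ _) (tm (ofA x) (ofA y)) =
      ofA (x * y) :=
  LinearMap.mul'_apply (R := ℤ) (A := A)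

theorem ap_one : ap (MonObj.one : 𝟙_ (ringPair.{v, u} A).V ⟶ (ringPair.{v, u} A).M.X) (ofZ 1) =
    ofA 1 := (algebraMap ℤ A).map_one

/-- A bilinear map determines a linear map on the tensor product. -/
noncomputable def tmLift {N : Type} [AddCommGroup N] (B : El X →+ El Y →+ N) :
    El (X ⊗ Y) →+ N :=
  liftCarrier (M := MonWord.obj (V := ModuleCat.{0} ℤ) (ModuleCat.of ℤ A)
    (WordObj.word (H := WordHom.{v} (ModuleCat.of ℤ A)) X))
    (N := MonWord.obj (V := ModuleCat.{0} ℤ) (ModuleCat.of ℤ A)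
    (WordObj.word (H := WordHom.{v} (ModuleCat.of ℤ A)) Y)) B

theorem tmLift_tm {N : Type} [AddCommGroup N] (B : El X →+ El Y →+ N) (x : El X) (y : El Y) :
    tmLift B (tm x y) = B x y := rfl

theorem tm_ext {N : Type} [AddCommGroup N] {f g : El (X ⊗ Y) →+ N}
    (h : ∀ x y, f (tm x y) = g (tm x y)) : f = g := by
  ext z
  refine TensorProduct.induction_on (motive := fun z => f z = g z) z ?_ h ?_
  · exact (map_zero f).trans (map_zero g).symm
  · intro x y hx hy
    exact (map_add f _ _).trans ((congrArg₂ _ hx hy).trans (map_add g _ _).symm)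

/-- A biadditive map as a bilinear map. -/
def bilin {M N P : Type} [AddCommGroup M] [AddCommGroup N] [AddCommGroup P] (B : M →+ N →+ P) :=
  LinearMap.mk₂ ℤ (fun x y => B x y) (by simp) (by simp) (by simp) (by simp)

variable (A) in
/-- The tensor product of `n` elements of `A`. -/
noncomputable def tpM : (n : ℕ) →
    MultilinearMap ℤ (fun _ : Fin n => A) (El.{v, u} (tpow (ringPair.{v, u} A).M.X n))
  | 0 => MultilinearMap.constOfIsEmpty ℤ _ (ofZ 1)
  | n + 1 => MultilinearMap.uncurryRight (M := fun _ : Fin (n + 1) => A)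
      ((bilin (tm.{v, u} (X := tpow (ringPair.{v, u} A).M.X n) (Y := (ringPair.{v, u} A).M.X))).compMultilinearMap (tpM n))

theorem tpM_succ (n : ℕ) (x : Fin (n + 1) → A) :
    tpM.{v, u} A (n + 1) x = tm (tpM A n (fun i => x i.castSucc)) (ofA (x (Fin.last n))) := rfl

/-- With `exists_tpM_eq` this is the universal property of the tensor power. Currying the last
variable replaces `N` by a group of homomorphisms into `N`, so both inductions keep `N` general. -/
theorem tpM_ext {N : Type} [AddCommGroup N] {n : ℕ}
    {f g : El (tpow (ringPair.{v, u} A).M.X n) →+ N}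
    (h : ∀ x, f (tpM A n x) = g (tpM A n x)) : f = g := by
  induction n generalizing N with
  | zero =>
    have h2 : f.comp ofZ.{v, u}.toAddMonoidHom = g.comp ofZ.toAddMonoidHom :=
      AddMonoidHom.ext_int (h ![])
    exact AddMonoidHom.ext fun x => DFunLike.congr_fun h2 (ofZ.symm x)
  | succ n ih =>
    have h2 : (AddMonoidHom.compHom f).comp tm = (AddMonoidHom.compHom g).comp tm :=
      ih fun x => AddMonoidHom.ext fun y => by
        have h1 := h (Fin.snoc (α := fun _ => A) x (ofA.symm y))
        simp only [tpM_succ, Fin.snoc_castSucc, Fin.snoc_last, AddEquiv.apply_symm_apply] at h1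
        exact h1
    exact tm_ext fun x y => DFunLike.congr_fun (DFunLike.congr_fun h2 x) y

theorem exists_tpM_eq {N : Type} [AddCommGroup N] {n : ℕ}
    (m : MultilinearMap ℤ (fun _ : Fin n => A) N) :
    ∃ f : El (tpow (ringPair.{v, u} A).M.X n) →+ N, ∀ x, f (tpM A n x) = m x := by
  induction n generalizing N with
  | zero =>
    refine ⟨(zmultiplesHom N (m ![])).comp ofZ.symm.toAddMonoidHom, fun x => ?_⟩
    rw [Subsingleton.elim x ![]]
    exact one_zsmul _
  | succ n ih =>
    let m' : MultilinearMap ℤ (fun _ : Fin n => A) (A →+ N) :=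
      MultilinearMap.mk' (fun x => (m.curryRight x).toAddMonoidHom)
        (fun x i a b => AddMonoidHom.ext fun y =>
          DFunLike.congr_fun (m.curryRight.map_update_add x i a b) y)
        (fun x i a b => AddMonoidHom.ext fun y =>
          DFunLike.congr_fun (m.curryRight.map_update_smul x i a b) y)
    obtain ⟨f, hf⟩ := ih m'
    refine ⟨tmLift ((AddMonoidHom.compHom' ofA.symm.toAddMonoidHom).comp f), fun x => ?_⟩
    have h1 := DFunLike.congr_fun (hf fun i => x i.castSucc) (x (Fin.last n))
    exact (tmLift_tm _ _ _).trans (h1.trans (congrArg m (Fin.snoc_init_self x)))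

/-- Endomorphisms of the pair `ringPair A` are Hochschild cochains of `A`. -/
noncomputable def toHoch (k : ℕ) : (ringPair.{v, u} A).End k ≃+ Hoch A k :=
  AddEquiv.ofBijective (AddMonoidHom.mk' (fun f => 
      (ap f).toIntLinearMap.compMultilinearMap (tpM.{v, u} A k))
    (fun _ _ => rfl)) (by
      constructor
      · intro f g h
        exact ap_injective (tpM_ext (N := A) fun x => DFunLike.congr_fun h x)
      · intro m
        obtain ⟨L, hL⟩ := exists_tpM_eq.{v, u} m
        obtain ⟨f, hf⟩ := ap_surjective (ofA.toAddMonoidHom.comp L)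
        refine ⟨f, MultilinearMap.ext fun x => ?_⟩
        exact (DFunLike.congr_fun hf _).trans (hL x))

end RingPair

end RingPair

namespace RingPair

variable {A : Type} [Ring A]

theorem ap_tpowAdd_hom (a b : ℕ) (x : Fin (a + b) → A) :
    ap (tpowAdd (ringPair.{v, u} A).M.X a b).hom (tpM A (a + b) x) =
      tm (tpM A a fun i => x (Fin.castAdd b i)) (tpM A b fun j => x (Fin.natAdd a j)) := by
  induction b with
  | zero => rfl
  | succ b ih =>
    exact congrArg (fun t => ap (α_ (tpow (ringPair.{v, u} A).M.X a) _ _).hom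
      (tm t (ofA (x (Fin.last (a + b)))))) (ih fun i => x i.castSucc)

theorem ap_tpowAdd_inv (a b : ℕ) (x : Fin (a + b) → A) :
    ap (tpowAdd (ringPair.{v, u} A).M.X a b).inv
      (tm (tpM A a fun i => x (Fin.castAdd b i)) (tpM A b fun j => x (Fin.natAdd a j))) =
      tpM A (a + b) x := by
  rw [← ap_tpowAdd_hom, ← ap_comp, Iso.hom_inv_id, ap_id]

theorem ap_tpowAdd_inv_append (a b : ℕ) (x : Fin a → A) (y : Fin b → A) :
    ap (tpowAdd (ringPair.{v, u} A).M.X a b).inv (tm (tpM A a x) (tpM A b y)) =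
      tpM A (a + b) (Fin.append x y) := by
  rw [← ap_tpowAdd_inv]
  simp

theorem tpM_append_one {a : ℕ} (x : Fin a → A) (y : A) :
    tpM.{v, u} A (a + 1) (Fin.append x fun _ : Fin 1 => y) = tm (tpM A a x) (ofA y) := by
  have h : ∀ i : Fin a, (Fin.append x fun _ : Fin 1 => y) i.castSucc = x i := Fin.append_left x _
  have h' : (Fin.append x fun _ : Fin 1 => y) (Fin.last a) = y :=
    Fin.append_right x (fun _ : Fin 1 => y) 0
  rw [tpM_succ, h']
  exact congrArg (fun t => tm (tpM A a t) (ofA y)) (funext h)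

/-- The categorical insertion is followed on a pure tensor: cut into blocks, apply `g` to the middle
block, and reassemble. -/
theorem toHoch_insert (a l b : ℕ) (f : (ringPair.{v, u} A).End (a + 1 + b))
    (g : (ringPair.{v, u} A).End l) :
    toHoch (a + l + b) ((ringPair.{v, u} A).insert a l b f g) =
      Hoch.insert a l b (toHoch _ f) (toHoch _ g) := by
  ext x
  apply (ofA.{v, u} (A := A)).injective
  refine Eq.trans (congrArg (fun t => ap f (ap (tpowAdd _ (a + 1) b).inv
    (ap (((tpowAdd (ringPair.{v, u} A).M.X a l).hom ≫ tpow (ringPair.{v, u} A).M.X a ◁ g) ▷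
      tpow (ringPair.{v, u} A).M.X b) t))) (ap_tpowAdd_hom (a + l) b x)) ?_
  refine Eq.trans (congrArg (fun t => ap f (ap (tpowAdd _ (a + 1) b).inv
    (tm (ap (tpow (ringPair.{v, u} A).M.X a ◁ g) t) (tpM A b fun j => x (Fin.natAdd (a + l) j)))))
    (ap_tpowAdd_hom a l _)) ?_
  refine Eq.trans ?_ (congrArg (ap f) (ap_tpowAdd_inv_append (a + 1) b
    (Fin.append (fun i => x (Fin.castAdd b (Fin.castAdd l i)))
      (fun _ : Fin 1 => toHoch l g fun j => x (Fin.castAdd b (Fin.natAdd a j))))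
    (fun j => x (Fin.natAdd (a + l) j))))
  refine congrArg (fun t => ap f (ap (tpowAdd _ (a + 1) b).inv (tm t _))) ?_
  exact (tpM_append_one _ _).symm

theorem toHoch_mul : toHoch 2 (ringPair.{v, u} A).mul = Hoch.mul := by
  ext x
  rw [Hoch.mul_apply]
  apply (ofA.{v, u} (A := A)).injective
  refine Eq.trans (congrArg (fun t => ap MonObj.mul (tm t (ofA (x 1))))
    (ap_leftUnitor_hom 1 (ofA (x 0)))) ?_
  rw [one_zsmul]
  exact ap_mul _ _

theorem toHoch_id : toHoch 1 (ringPair.{v, u} A).id = Hoch.id := by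
  ext x
  rw [Hoch.id_apply]
  apply (ofA.{v, u} (A := A)).injective
  exact (ap_leftUnitor_hom 1 (ofA (x 0))).trans (one_zsmul _)

theorem toHoch_one : toHoch 0 (ringPair.{v, u} A).one = Hoch.one := by
  ext x
  rw [Hoch.one_apply]
  apply (ofA.{v, u} (A := A)).injective
  exact ap_one

end RingPair

/-! ### Values of cochains and forests on lists of arguments. -/

namespace Hoch

variable {A : Type} [Ring A]

/-- The value of a cochain on a list of arguments. -/
def app {n : ℕ} (f : Hoch A n) (L : List A) : A := f fun i => L.getD i 0

theorem app_ofFn {n : ℕ} (f : Hoch A n) (x : Fin n → A) : f.app (List.ofFn x) = f x := by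
  simp [app]

/-- Only lists of the right length matter; the default `0` in `app` fills positions past the end.
Lists spare the casts between `Fin` types of equal size. -/
theorem ext_app {n : ℕ} {f g : Hoch A n} (h : ∀ L : List A, L.length = n → f.app L = g.app L) :
    f = g := by
  ext x
  rw [← app_ofFn, ← app_ofFn]
  exact h _ (by simp)

end Hoch

section Val

variable {A : Type} [Ring A] {I : Type} {k : I → ℕ}

/-- The forest `w`, with the operations interpreted by the cochains `g i`, sends the tuple `L` to the
tuple `R`. -/
inductive Forest.Val (g : (i : I) → Hoch A (k i)) : {n : ℕ} → Forest k n → List A → List A → Prop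
  | nil : Val g .nil [] []
  | new {n : ℕ} {w : Forest k n} {L R : List A} (h : Val g w L R) : Val g w.new L (R ++ [1])
  | leaf {n : ℕ} {w : Forest k (n + 1)} {L R : List A} {y : A} (h : Val g w L (R ++ [y])) (x : A) :
      Val g w.leaf (L ++ [x]) (R ++ [y * x])
  | node {n : ℕ} {w : Forest k (n + 1)} {L R : List A} {y : A} (h : Val g w L (R ++ [y])) {i : I}
      {t : Forest k (k i)} {L' R' : List A} (h' : Val g t L' R') :
      Val g (w.node i t) (L ++ L') (R ++ [y * (g i).app R'])

theorem Forest.Val.length {g : (i : I) → Hoch A (k i)} {n : ℕ} {w : Forest k n} {L R : List A}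
    (h : Val g w L R) : R.length = n := by
  induction h with
  | nil => rfl
  | new _ ih => simp [ih]
  | leaf _ _ ih => simpa using ih
  | node _ _ ih _ => simpa using ih

end Val

namespace RingPair

variable {A : Type} [Ring A]

variable (A) in
/-- The tensor product of the first `n` elements of a list. -/
noncomputable def tpL (n : ℕ) (L : List A) : El.{v, u} (tpow (ringPair.{v, u} A).M.X n) :=
  tpM A n fun i => L.getD i 0

theorem ap_tpL {n : ℕ} (f : (ringPair.{v, u} A).End n) (L : List A) :
    ap f (tpL A n L) = ofA ((toHoch n f).app L) := rfl

theorem tpL_concat {n : ℕ} (L : List A) (x : A) (h : L.length = n) :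
    tpL.{v, u} A (n + 1) (L ++ [x]) = tm (tpL A n L) (ofA x) := by
  subst h
  rw [tpL, tpM_succ]
  congr 2
  · unfold tpL
    congr 1
    funext i
    simp
  · simp

theorem ap_tpowAdd_tpL {m m' : ℕ} (L L' : List A) (h : L.length = m) :
    ap (tpowAdd (ringPair.{v, u} A).M.X m m').hom (tpL A (m + m') (L ++ L')) =
      tm (tpL A m L) (tpL A m' L') := by
  subst h
  rw [tpL, ap_tpowAdd_hom]
  simp only [tpL]
  congr 2
  · congr 2
    funext i
    exact List.getD_append _ _ _ _ i.2
  · funext i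
    refine (List.getD_append_right _ _ _ _ (Nat.le_add_right _ _)).trans ?_
    simp

theorem ap_newHom {m n : ℕ} {φ : tpow (ringPair.{v, u} A).M.X m ⟶ tpow (ringPair.{v, u} A).M.X n}
    {L R : List A} (hR : R.length = n) (h : ap φ (tpL A m L) = tpL A n R) :
    ap (newHom φ) (tpL A m L) = tpL A (n + 1) (R ++ [1]) := by
  rw [tpL_concat _ _ hR, ← h]
  exact congrArg (tm (ap φ (tpL A m L))) ap_one

theorem ap_nodeHom {m m' n : ℕ}
    {φ : tpow (ringPair.{v, u} A).M.X m ⟶ tpow (ringPair.{v, u} A).M.X (n + 1)}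
    {ψ : (ringPair.{v, u} A).End m'} {L L' R : List A} {x y : A}
    (hL : L.length = m) (hR : R.length = n) (h : ap φ (tpL A m L) = tpL A (n + 1) (R ++ [y]))
    (h' : ap ψ (tpL A m' L') = ofA x) :
    ap (nodeHom φ ψ) (tpL A (m + m') (L ++ L')) = tpL A (n + 1) (R ++ [y * x]) := by
  rw [tpL_concat _ _ hR] at h ⊢
  refine Eq.trans (congrArg (fun t => ap (_ ◁ MonObj.mul) (ap (α_ _ _ _).hom (ap (φ ⊗ₘ ψ) t)))
    (ap_tpowAdd_tpL L L' hL)) ?_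
  refine Eq.trans (congrArg₂ (fun s t => ap (_ ◁ MonObj.mul) (ap (α_ _ _ _).hom (tm s t))) h h') ?_
  exact congrArg (tm (tpL A n R)) (ap_mul y x)

theorem ap_tpowOne (L : List A) (x : A) :
    ap (tpowOne (ringPair.{v, u} A).M.X) (tpL A 1 (x :: L)) = ofA x :=
  (ap_leftUnitor_hom 1 (ofA x)).trans (one_zsmul _)

/-- A morphism represented by a forest acts on tensor products of elements as prescribed by the
forest. -/
theorem exists_val {I : Type} {k : I → ℕ} {f : (i : I) → (ringPair.{v, u} A).End (k i)} {m n : ℕ}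
    {w : Forest k n} {φ : tpow (ringPair.{v, u} A).M.X m ⟶ tpow (ringPair.{v, u} A).M.X n}
    (h : Forest.Rep f m n w φ) (L : List A) (hL : L.length = m) :
    ∃ R, Forest.Val (fun i => toHoch (k i) (f i)) w L R ∧ ap φ (tpL A m L) = tpL A n R := by
  induction h generalizing L with
  | nil =>
    obtain rfl := List.length_eq_zero_iff.mp hL
    exact ⟨[], .nil, rfl⟩
  | new h ih =>
    obtain ⟨R, hR, e⟩ := ih L hL
    exact ⟨_, hR.new, ap_newHom hR.length e⟩
  | @leaf m n w φ h ih =>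
    obtain ⟨L, x, rfl⟩ : ∃ L' x, L = L' ++ [x] := by
      rcases List.eq_nil_or_concat' L with rfl | h
      · simp at hL
      · exact h
    have hL' : L.length = m := by simpa using hL
    obtain ⟨R, hR, e⟩ := ih L hL'
    obtain ⟨R, y, rfl⟩ : ∃ R' y, R = R' ++ [y] := by
      rcases List.eq_nil_or_concat' R with rfl | h
      · exact absurd hR.length (by simp)
      · exact h
    exact ⟨_, hR.leaf x, ap_nodeHom hL' (by simpa using hR.length) e (ap_tpowOne _ _)⟩
  | @node m m' n w i t φ ψ h h' ih ih' =>
    have e0 := List.take_append_drop m L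
    have hL1 : (L.take m).length = m := by simp [hL]
    have hL2 : (L.drop m).length = m' := by simp [hL]
    rw [← e0]
    obtain ⟨R, hR, e⟩ := ih _ hL1
    obtain ⟨R', hR', e'⟩ := ih' _ hL2
    obtain ⟨R, y, rfl⟩ : ∃ R' y, R = R' ++ [y] := by
      rcases List.eq_nil_or_concat' R with rfl | h
      · exact absurd hR.length (by simp)
      · exact h
    refine ⟨_, hR.node hR', ap_nodeHom hL1 (by simpa using hR.length) e ?_⟩
    rw [ap_comp, e', ap_tpL]

end RingPair

/-! ### Forests as operations generated by the elementary ones. -/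

namespace Hoch

variable {A : Type} [Ring A]

theorem app_insert {a l b : ℕ} (f : Hoch A (a + 1 + b)) (g : Hoch A l) {X Y Z : List A}
    (hX : X.length = a) (hY : Y.length = l) :
    (Hoch.insert a l b f g).app (X ++ Y ++ Z) = f.app (X ++ [g.app Y] ++ Z) := by
  subst hX hY
  refine congrArg f (funext fun q => ?_)
  induction q using Fin.addCases with
  | left q =>
    induction q using Fin.addCases with
    | left i =>
      simp only [insertArgs, Fin.append_left, Fin.val_castAdd]
      rw [List.getD_append _ _ _ _ (by simp; omega), List.getD_append _ _ _ _ i.2,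
        List.getD_append _ _ _ _ (by simp), List.getD_append _ _ _ _ i.2]
    | right j =>
      obtain rfl : j = 0 := Subsingleton.elim _ _
      simp only [insertArgs, Fin.append_left, Fin.append_right, Fin.val_castAdd, Fin.val_natAdd]
      rw [List.getD_append _ _ _ _ (by simp), List.getD_append_right _ _ _ _ (by simp)]
      simp only [Fin.val_zero, add_zero, Nat.sub_self, List.getD_cons_zero]
      refine congrArg g (funext fun j => ?_)
      rw [List.getD_append _ _ _ _ (by simp), List.getD_append_right _ _ _ _ (by simp)]
      simp
  | right j =>
    simp only [insertArgs, Fin.append_right, Fin.val_natAdd]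
    rw [List.getD_append_right _ _ _ _ (by simp), List.getD_append_right _ _ _ _ (by simp)]
    simp

theorem app_mul (x y : A) : (Hoch.mul : Hoch A 2).app [x, y] = x * y := mul_apply _

theorem app_id (x : A) : (Hoch.id : Hoch A 1).app [x] = x := id_apply _

theorem app_one : (Hoch.one : Hoch A 0).app [] = 1 := one_apply _

/-- The operations generated by the elementary ones. -/
abbrev IsGenerated {I : Type} [Finite I] {k : I → ℕ} {l : ℕ}
    (τ : MultilinearMap ℤ (fun i => Hoch A (k i)) (Hoch A l)) : Prop :=
  ColOperad.Generated (ColOperad.endOperad (Hoch A)) (IsElementary A) I k l τ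

/-- A family of two types. -/
def pairType (J J' : Type) (i : Fin 2) : Type :=
  match i with
  | 0 => J
  | 1 => J'

instance (J J' : Type) [Finite J] [Finite J'] (i : Fin 2) : Finite (pairType J J' i) :=
  match i with
  | 0 => inferInstanceAs (Finite J)
  | 1 => inferInstanceAs (Finite J')

/-- The total space of a family of two types is their sum. -/
def pairTypeEquiv (J J' : Type) : (Σ i, pairType J J' i) ≃ J ⊕ J' where
  toFun
    | ⟨0, j⟩ => Sum.inl j
    | ⟨1, j⟩ => Sum.inr j
  invFun
    | Sum.inl j => ⟨0, j⟩
    | Sum.inr j => ⟨1, j⟩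
  left_inv
    | ⟨0, _⟩ => rfl
    | ⟨1, _⟩ => rfl
  right_inv
    | Sum.inl _ => rfl
    | Sum.inr _ => rfl

/-- The operadic composite has its inputs indexed by a dependent sum over `Fin 2`; relabelling turns
this into `J ⊕ J'`. -/
theorem exists_isGenerated_insert {J J' : Type} [Finite J] [Finite J'] {k : J ⊕ J' → ℕ}
    {a l b : ℕ} {τ : MultilinearMap ℤ (fun j => Hoch A (k (Sum.inl j))) (Hoch A (a + 1 + b))}
    {τ' : MultilinearMap ℤ (fun j => Hoch A (k (Sum.inr j))) (Hoch A l)}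
    (h : IsGenerated τ) (h' : IsGenerated τ') :
    ∃ σ : MultilinearMap ℤ (fun j => Hoch A (k j)) (Hoch A (a + l + b)), IsGenerated σ ∧
      ∀ v, σ v = Hoch.insert a l b (τ fun j => v (Sum.inl j)) (τ' fun j => v (Sum.inr j)) := by
  let y : (i : Fin 2) → (ColOperad.endOperad (Hoch A)).Op (pairType J J' i)
      (fun j => k (pairTypeEquiv J J' ⟨i, j⟩)) (![a + 1 + b, l] i) := fun i => match i with
    | 0 => τ
    | 1 => τ'
  have hy : ∀ i, ColOperad.Generated (ColOperad.endOperad (Hoch A)) (IsElementary A) _ _ _ (y i) :=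
    fun i => match i with
    | 0 => h
    | 1 => h'
  refine ⟨_, ColOperad.Generated.act _ _ (pairTypeEquiv J J') k _ _
    (ColOperad.Generated.comp _ _ _ _ _ _ y (.basic _ _ _ _ (.insert a l b)) hy), fun v => rfl⟩

variable {I : Type} {k : I → ℕ}

/-- `Φ` is given by an operation, generated by the elementary ones, with `c i` inputs in which
the cochain `i` is substituted. -/
def IsNatOp (c : I → ℕ) (l : ℕ) (Φ : ((i : I) → Hoch A (k i)) → List A → A) : Prop :=
  ∃ (J : Type) (_ : Finite J) (p : J → I)
    (τ : MultilinearMap ℤ (fun j => Hoch A (k (p j))) (Hoch A l)), IsGenerated τ ∧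
    (∀ i, Nat.card {j // p j = i} = c i) ∧
    ∀ g L, L.length = l → Φ g L = (τ fun j => g (p j)).app L

namespace IsNatOp

theorem const {l : ℕ} {h : Hoch A l}
    (H : IsElementary A (Fin 0) ![] l (ColOperad.constOp h)) :
    IsNatOp (k := k) (fun _ => 0) l (fun _ L => h.app L) := by
  refine ⟨Fin 0, inferInstance, Fin.elim0, MultilinearMap.constOfIsEmpty ℤ _ h, ?_, ?_, ?_⟩
  · have e : (fun j : Fin 0 => k (j.elim0)) = ![] := Subsingleton.elim _ _
    have h1 := ColOperad.Generated.basic _ _ _ _ H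
    have : ∀ (q : Fin 0 → ℕ) (_ : q = ![]),
        IsGenerated (MultilinearMap.constOfIsEmpty ℤ (fun j => Hoch A (q j)) h) := by
      rintro _ rfl
      exact h1
    exact this _ e
  · intro i
    simp
  · intro g L hL
    rfl

theorem var [DecidableEq I] (i : I) :
    IsNatOp (k := k) (A := A) (Pi.single i 1) (k i) (fun g L => (g i).app L) := by
  refine ⟨Unit, inferInstance, fun _ => i, _, ColOperad.Generated.one (k i), ?_, ?_⟩
  · intro j
    by_cases h : i = j
    · subst h
      simp
    · simp [h, Ne.symm h]
  · intro g L hL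
    rfl

theorem insert {c c' : I → ℕ} {a l b : ℕ} {Φ Φ' : ((i : I) → Hoch A (k i)) → List A → A}
    (h : IsNatOp c (a + 1 + b) Φ) (h' : IsNatOp c' l Φ') :
    ∃ Ψ, IsNatOp (fun i => c i + c' i) (a + l + b) Ψ ∧ ∀ g X Y Z, X.length = a → Y.length = l →
      Z.length = b → Ψ g (X ++ Y ++ Z) = Φ g (X ++ [Φ' g Y] ++ Z) := by
  obtain ⟨J, _, p, τ, hτ, hc, e⟩ := h
  obtain ⟨J', _, p', τ', hτ', hc', e'⟩ := h'
  obtain ⟨σ, hσ, hv⟩ := exists_isGenerated_insert (k := fun s => k (Sum.elim p p' s)) hτ hτ'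
  refine ⟨fun g L => (σ fun j => g (Sum.elim p p' j)).app L,
    ⟨J ⊕ J', inferInstance, Sum.elim p p', σ, hσ, ?_, fun _ _ _ => rfl⟩, ?_⟩
  · intro i
    change _ = c i + c' i
    rw [← hc, ← hc', ← Nat.card_sum]
    exact Nat.card_congr
      { toFun := fun s => match s with
          | ⟨Sum.inl j, h⟩ => Sum.inl ⟨j, h⟩
          | ⟨Sum.inr j, h⟩ => Sum.inr ⟨j, h⟩
        invFun := fun s => match s with
          | Sum.inl j => ⟨Sum.inl j.1, j.2⟩
          | Sum.inr j => ⟨Sum.inr j.1, j.2⟩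
        left_inv := fun s => match s with
          | ⟨Sum.inl j, h⟩ => rfl
          | ⟨Sum.inr j, h⟩ => rfl
        right_inv := fun s => match s with
          | Sum.inl j => rfl
          | Sum.inr j => rfl }
  · intro g X Y Z hX hY hZ
    change Hoch.app (σ _) _ = _
    rw [hv, app_insert _ _ hX hY, e g _ (by simp [hX, hZ]; omega), e' g _ hY]
    rfl

theorem congr_count {c c' : I → ℕ} {l : ℕ} {Φ : ((i : I) → Hoch A (k i)) → List A → A}
    (h : IsNatOp c l Φ) (e : ∀ i, c i = c' i) : IsNatOp c' l Φ := (funext e : c = c') ▸ h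

theorem congr_arity {c : I → ℕ} {l l' : ℕ} {Φ : ((i : I) → Hoch A (k i)) → List A → A}
    (h : IsNatOp c l Φ) (e : l = l') : IsNatOp c l' Φ := e ▸ h

/-- Intermediate operations may use a cochain several times or not at all, whence the auxiliary
index type `J` over `I`. If every fibre has one element, `J` is relabelled to `I`. -/
theorem exists_isGenerated [Finite I] {l : ℕ} {Φ : ((i : I) → Hoch A (k i)) → List A → A}
    (h : IsNatOp (fun _ => 1) l Φ) :
    ∃ τ : MultilinearMap ℤ (fun i => Hoch A (k i)) (Hoch A l), IsGenerated τ ∧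
      ∀ g L, L.length = l → Φ g L = (τ g).app L := by
  obtain ⟨J, _, p, τ, hτ, hc, e⟩ := h
  have hp : Function.Bijective p := by
    constructor
    · intro j j' hj
      have := (Nat.card_eq_one_iff_unique.mp (hc (p j'))).1
      exact congrArg Subtype.val (Subsingleton.elim (⟨j, hj⟩ : {x // p x = p j'}) ⟨j', rfl⟩)
    · intro i
      obtain ⟨⟨j, hj⟩⟩ := (Nat.card_eq_one_iff_unique.mp (hc i)).2
      exact ⟨j, hj⟩
  exact ⟨_, ColOperad.Generated.act _ _ (Equiv.ofBijective p hp) k _ _ hτ, e⟩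

end IsNatOp

end Hoch

namespace Forest

variable {A : Type} [Ring A] {I : Type} {k : I → ℕ}

/-- The number of leaves. -/
def leaves : {n : ℕ} → Forest k n → ℕ
  | _, nil => 0
  | _, new w => leaves w
  | _, leaf w => leaves w + 1
  | _, node w _ t => leaves w + leaves t

open Classical in
/-- The number of occurrences of an operation. -/
noncomputable def count : {n : ℕ} → Forest k n → I → ℕ
  | _, nil, _ => 0
  | _, new w, i => count w i
  | _, leaf w, i => count w i
  | _, node w j t, i => count w i + (count t i + Pi.single (M := fun _ => ℕ) j 1 i)

/-- Scaling a single operation by `2` makes the weight record its number of occurrences. -/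
theorem weight_update [DecidableEq I] (i : I) {n : ℕ} (w : Forest k n) :
    weight (Function.update 1 i 2) w = 2 ^ count w i := by
  induction w with
  | nil => rfl
  | new w ih => exact ih
  | leaf w ih => exact ih
  | node w j t ih ih' =>
    simp only [weight, count, ih, ih', pow_add]
    by_cases h : j = i
    · subst h
      simp
    · simp [Function.update_of_ne h, Ne.symm h]

theorem Val.length_left {g : (i : I) → Hoch A (k i)} {n : ℕ} {w : Forest k n} {L R : List A}
    (h : Val g w L R) : L.length = leaves w := by
  induction h with
  | nil => rfl
  | new _ ih => exact ih
  | leaf _ _ ih => simp [leaves, ih]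
  | node _ _ ih ih' => simp [leaves, ih, ih']

/-- Substituting the operation of a forest in an operation generated by the elementary ones. -/
theorem exists_isNatOp {n : ℕ} (w : Forest k n) {a b : ℕ} {c : I → ℕ}
    {Φ : ((i : I) → Hoch A (k i)) → List A → A} (h : Hoch.IsNatOp c (a + n + b) Φ) :
    ∃ Φ', Hoch.IsNatOp (fun i => c i + count w i) (a + leaves w + b) Φ' ∧
      ∀ g X L R Z, X.length = a → Z.length = b → Val g w L R →
        Φ' g (X ++ L ++ Z) = Φ g (X ++ R ++ Z) := by
  classical
  induction w generalizing a b c Φ with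
  | nil =>
    refine ⟨Φ, h, ?_⟩
    rintro g X L R Z hX hZ ⟨⟩
    rfl
  | @new n w ih =>
    -- The last letter of the forest is substituted first: here `1` for the last word, after which
    -- `w` is substituted by `ih`.
    obtain ⟨Φ1, h1, e1⟩ := Hoch.IsNatOp.insert (a := a + n) (b := b)
      (h.congr_arity (by omega)) (Hoch.IsNatOp.const .one)
    obtain ⟨Φ2, h2, e2⟩ := ih (a := a) (b := b) (h1.congr_arity (by omega))
    refine ⟨Φ2, h2.congr_count (fun i => by simp [count]), ?_⟩
    rintro g X L R Z hX hZ hV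
    cases hV with
    | @new _ _ _ R hV =>
      rw [e2 g X L _ Z hX hZ hV]
      have := e1 g (X ++ R) [] Z (by simp [hX, hV.length]) rfl hZ
      simpa [Hoch.app_one] using this
  | @leaf n w ih =>
    obtain ⟨Φ1, h1, e1⟩ := Hoch.IsNatOp.insert (a := a + n) (b := b)
      (h.congr_arity (by omega)) (Hoch.IsNatOp.const .mul)
    -- The argument of the leaf now lies to the right of the words of `w`, hence `1 + b`.
    obtain ⟨Φ2, h2, e2⟩ := ih (a := a) (b := 1 + b) (h1.congr_arity (by omega))
    refine ⟨Φ2, (h2.congr_count (fun i => by simp [count])).congr_arity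
      (by simp only [leaves]; omega), ?_⟩
    rintro g X L R Z hX hZ hV
    cases hV with
    | @leaf _ _ L R y hV x =>
      have hR : R.length = n := by simpa using hV.length
      have h3 := e2 g X L _ ([x] ++ Z) hX (by simp [hZ]; omega) hV
      have := e1 g (X ++ R) [y, x] Z (by simp [hX, hR]) rfl hZ
      rw [Hoch.app_mul] at this
      simp only [List.append_assoc, List.cons_append, List.nil_append] at h3 this ⊢
      rw [h3, this]
  | @node n w i t ih ih' =>
    -- The last argument becomes a product, its second factor becomes the operation `i`, then `t` is
    -- substituted in that operation, and finally `w` to the left of the inputs of `t`.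
    obtain ⟨Φ1, h1, e1⟩ := Hoch.IsNatOp.insert (a := a + n) (b := b)
      (h.congr_arity (by omega)) (Hoch.IsNatOp.const .mul)
    obtain ⟨Φ2, h2, e2⟩ := Hoch.IsNatOp.insert (a := a + n + 1) (b := b)
      (h1.congr_arity (by omega)) (Hoch.IsNatOp.var i)
    obtain ⟨Φ3, h3, e3⟩ := ih' (a := a + n + 1) (b := b) h2
    obtain ⟨Φ4, h4, e4⟩ := ih (a := a) (b := leaves t + b) (h3.congr_arity (by omega))
    refine ⟨Φ4, (h4.congr_count (fun i => by simp [count, Pi.single_apply]; omega)).congr_arity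
      (by simp only [leaves]; omega), ?_⟩
    rintro g X L R Z hX hZ hV
    cases hV with
    | @node _ _ L R y hV _ _ L' R' hV' =>
      have hR : R.length = n := by simpa using hV.length
      have q4 := e4 g X L _ (L' ++ Z) hX (by simp [hZ, hV'.length_left]) hV
      have q3 := e3 g (X ++ (R ++ [y])) L' R' Z (by simp [hX, hR]; omega) hZ hV'
      have q2 := e2 g (X ++ (R ++ [y])) R' Z (by simp [hX, hR]; omega) hV'.length hZ
      have q1 := e1 g (X ++ R) [y, (g i).app R'] Z (by simp [hX, hR]) rfl hZ
      rw [Hoch.app_mul] at q1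
      simp only [List.append_assoc, List.cons_append, List.nil_append] at q1 q2 q3 q4 ⊢
      rw [q4, q3, q2, q1]

/-- A forest with one word in which each operation occurs once is an operation generated by
the elementary ones. -/
theorem exists_isGenerated [Finite I] (w : Forest k 1) (hw : ∀ i, count w i = 1) :
    ∃ τ : MultilinearMap ℤ (fun i => Hoch A (k i)) (Hoch A (leaves w)), Hoch.IsGenerated τ ∧
      ∀ g L y, Val g w L [y] → (τ g).app L = y := by
  obtain ⟨Φ, h, e⟩ := exists_isNatOp (A := A) w (a := 0) (b := 0)
    (Hoch.IsNatOp.const (A := A) (k := k) .id)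
  obtain ⟨τ, hτ, e'⟩ := ((h.congr_count (c' := fun _ => 1) (fun i => by simp [hw])).congr_arity
    (l' := leaves w) (by simp)).exists_isGenerated
  refine ⟨τ, hτ, fun g L y hV => ?_⟩
  have h1 := e g [] L [y] [] rfl rfl hV
  simp only [List.append_nil, List.nil_append] at h1
  rw [← e' g L hV.length_left, h1, Hoch.app_id]

end Forest

/-! ### Separating forests by cochains of the free ring. -/

/-- A multilinear map with prescribed values on the elements of a basis. -/
theorem Module.Basis.exists_multilinearMap {R M N ι : Type*} [CommRing R] [AddCommGroup M]
    [Module R M] [AddCommGroup N] [Module R N] (b : Module.Basis ι R M) (n : ℕ)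
    (F : List ι → N) : ∃ h : MultilinearMap R (fun _ : Fin n => M) N,
      ∀ v : Fin n → ι, h (fun i => b (v i)) = F (List.ofFn v) := by
  induction n generalizing F with
  | zero => exact ⟨MultilinearMap.constOfIsEmpty R _ (F []), fun v => by simp⟩
  | succ n ih =>
    choose h hh using fun j : ι => ih fun L => F (j :: L)
    refine ⟨LinearMap.uncurryLeft (M := fun _ => M) (b.constr R h), fun v => ?_⟩
    rw [LinearMap.uncurryLeft_apply, Module.Basis.constr_basis]
    refine (hh (v 0) (fun i => v i.succ)).trans ?_
    rw [List.ofFn_succ]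

/-- The monomial of a list of generators of the generic ring. -/
noncomputable def GenericRing.monomial (m : List ℕ) : GenericRing :=
  (m.map (FreeAlgebra.ι ℤ)).prod

namespace GenericRing

theorem monomial_append (m m' : List ℕ) : monomial (m ++ m') = monomial m * monomial m' := by
  simp [monomial]

theorem monomial_nil : monomial [] = 1 := rfl

/-- The basis of monomials. -/
noncomputable def basis : Module.Basis (FreeMonoid ℕ) ℤ GenericRing :=
  FreeAlgebra.basisFreeMonoid ℤ ℕ

theorem basis_apply (m : List ℕ) : basis (FreeMonoid.ofList m) = monomial m := by
  refine (MonoidAlgebra.lift_single (FreeMonoid.lift (FreeAlgebra.ι ℤ)) (FreeMonoid.ofList m)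
    (1 : ℤ)).trans ((one_smul _ _).trans ?_)
  exact FreeMonoid.lift_apply _ _

theorem exists_hoch (n : ℕ) (F : List (List ℕ) → GenericRing) :
    ∃ h : Hoch GenericRing n, ∀ L : List (List ℕ), L.length = n →
      h.app (L.map monomial) = F L := by
  obtain ⟨h, hh⟩ := basis.exists_multilinearMap n fun L => F (L.map FreeMonoid.toList)
  refine ⟨h, ?_⟩
  rintro L rfl
  have := hh fun i => FreeMonoid.ofList (L.get i)
  simp only [basis_apply] at this
  refine Eq.trans (congrArg h (funext fun i => ?_)) (this.trans (congrArg F ?_))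
  · simp
  · rw [List.map_ofFn]
    exact List.ofFn_get L

end GenericRing

namespace Forest

variable {I : Type} {k : I → ℕ}

/-- A code of forests by lists of natural numbers, depending on a code `e` of the labels of nodes. -/
def code (e : I × List ℕ → ℕ) : {n : ℕ} → Forest k n → List ℕ
  | _, nil => []
  | _, new w => code e w ++ [0]
  | _, leaf w => code e w ++ [1]
  | _, node w i t => code e w ++ [e (i, code e t) + 2]

/-- The last symbol tells the last constructor: `0` for a new word, `1` for a leaf, at least `2` for
a node. In the last case `e` gives back the label and the code of the subforest. -/
theorem code_injective {e : I × List ℕ → ℕ} (he : Function.Injective e) {n : ℕ} :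
    Function.Injective (code e : Forest k n → List ℕ) := by
  intro w w' h
  induction w with
  | nil => cases w'; rfl
  | new w ih =>
    cases w' with
    | new w' => exact congrArg new (ih (by simpa [code] using h))
    | leaf w' => simp [code] at h
    | node w' i t => simp [code] at h
  | leaf w ih =>
    cases w' with
    | new w' => simp [code] at h
    | leaf w' => exact congrArg leaf (ih (by simpa [code] using h))
    | node w' i t => simp [code] at h
  | node w i t ih ih' =>
    cases w' with
    | new w' => simp [code] at h
    | leaf w' => simp [code] at h
    | node w' i' t' =>
      simp only [code, List.append_singleton_inj, Nat.add_right_cancel_iff] at h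
      obtain ⟨h1, h2⟩ := h
      have h3 := he h2
      rw [Prod.mk.injEq] at h3
      obtain ⟨rfl, h3⟩ := h3
      rw [ih h1, ih' h3]

theorem exists_code_eq_cons (e : I × List ℕ → ℕ) {n : ℕ} (w : Forest k n) (hn : n ≠ 0) :
    ∃ r, code e w = 0 :: r := by
  induction w with
  | nil => exact absurd rfl hn
  | @new n w ih =>
    rcases Nat.eq_zero_or_pos n with rfl | h
    · cases w
      exact ⟨[], rfl⟩
    · obtain ⟨r, hr⟩ := ih h.ne'
      exact ⟨r ++ [0], by simp [code, hr]⟩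
  | leaf w ih =>
    obtain ⟨r, hr⟩ := ih hn
    exact ⟨r ++ [1], by simp [code, hr]⟩
  | node w i t ih _ =>
    obtain ⟨r, hr⟩ := ih hn
    exact ⟨r ++ [e (i, code e t) + 2], by simp [code, hr]⟩

open GenericRing in
-- A leaf contributes generator `1`, a node the generator numbered by its label and subforest, and
-- products concatenate. The value of each word therefore spells its code, apart from the opening
-- `0`, which `flatMap` restores.
theorem Val.eq_map_monomial {e : I × List ℕ → ℕ} {g : (i : I) → Hoch GenericRing (k i)}
    (hg : ∀ i, ∀ L : List (List ℕ), L.length = k i →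
      (g i).app (L.map monomial) = monomial [e (i, L.flatMap (0 :: ·)) + 2])
    {n : ℕ} {w : Forest k n} {L R : List GenericRing} (h : Val g w L R)
    (hL : ∀ x ∈ L, x = monomial [1]) :
    ∃ R' : List (List ℕ), R = R'.map monomial ∧ code e w = R'.flatMap (0 :: ·) := by
  induction h with
  | nil => exact ⟨[], rfl, rfl⟩
  | new h ih =>
    obtain ⟨R', rfl, h'⟩ := ih hL
    exact ⟨R' ++ [[]], by simp [monomial_nil], by simp [code, h']⟩
  | @leaf n w L R y h x ih =>
    obtain ⟨R', hR, h'⟩ := ih fun z hz => hL z (by simp [hz])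
    obtain rfl := hL x (by simp)
    rcases List.eq_nil_or_concat' R' with rfl | ⟨R', m, rfl⟩
    · simp at hR
    · simp only [List.map_append, List.map_cons, List.map_nil, List.append_singleton_inj] at hR
      obtain ⟨rfl, rfl⟩ := hR
      exact ⟨R' ++ [m ++ [1]], by simp [monomial_append], by simp [code, h']⟩
  | @node n w L R y h i t L' T h' ih ih' =>
    obtain ⟨R', hR, hc⟩ := ih fun z hz => hL z (by simp [hz])
    obtain ⟨T', rfl, hc'⟩ := ih' fun z hz => hL z (by simp [hz])
    rcases List.eq_nil_or_concat' R' with rfl | ⟨R', m, rfl⟩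
    · simp at hR
    · simp only [List.map_append, List.map_cons, List.map_nil, List.append_singleton_inj] at hR
      obtain ⟨rfl, rfl⟩ := hR
      refine ⟨R' ++ [m ++ [e (i, code e t) + 2]], ?_, by simp [code, hc]⟩
      rw [hg i T' (by simpa using h'.length), hc']
      simp [monomial_append]

/-- For suitable cochains of the generic ring, different forests take different monomials as
values. -/
theorem exists_separating [Countable I] (k : I → ℕ) : ∃ (g : (i : I) → Hoch GenericRing (k i))
    (m : Forest k 1 → FreeMonoid ℕ), Function.Injective m ∧ ∀ w L y, Val g w L [y] →
      (∀ x ∈ L, x = GenericRing.monomial [1]) → y = GenericRing.basis (m w) := by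
  obtain ⟨e, he⟩ := exists_injective_nat (I × List ℕ)
  -- A tuple of monomials goes to one generator that remembers `i` and the tuple; the shift by `2`
  -- keeps it apart from the symbols for new words and leaves.
  choose g hg using fun i : I => GenericRing.exists_hoch (k i)
    fun L => GenericRing.monomial [e (i, L.flatMap (0 :: ·)) + 2]
  refine ⟨g, fun w => FreeMonoid.ofList (code e w).tail, ?_, ?_⟩
  · intro w w' h
    -- Both codes begin with `0`, so nothing is lost by taking tails.
    obtain ⟨r, hr⟩ := exists_code_eq_cons e w one_ne_zero
    obtain ⟨r', hr'⟩ := exists_code_eq_cons e w' one_ne_zero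
    have h' : (code e w).tail = (code e w').tail := h
    refine code_injective he ?_
    rw [hr, hr'] at h' ⊢
    exact congrArg _ h'
  · intro w L y h hL
    obtain ⟨R', h1, h2⟩ := h.eq_map_monomial hg hL
    match R', h1, h2 with
    | [r], h1, h2 =>
      simp only [List.map_cons, List.map_nil, List.cons.injEq, and_true] at h1
      simp only [List.flatMap_cons, List.flatMap_nil, List.append_nil] at h2
      rw [GenericRing.basis_apply, h2, h1, List.tail_cons]

end Forest

/-! ### Expansion of natural operations in forests. -/

section Expansion

variable {V : Type u} [Category.{v} V] [MonoidalCategory V] [Preadditive V] {M : V}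
  [MonObj M] {I : Type} {k : I → ℕ} {f : (i : I) → (tpow M (k i) ⟶ M)}

theorem Forest.exists_sum_of_mem_repSpan {m n : ℕ} {y : tpow M m ⟶ tpow M n}
    (h : y ∈ Forest.repSpan f m n) : ∃ (c : Forest k n →₀ ℤ) (φ : Forest k n → (tpow M m ⟶ tpow M n)),
      (∀ w ∈ c.support, Forest.Rep f m n w (φ w)) ∧ y = c.sum fun w z => z • φ w := by
  classical
  -- One morphism for each forest, forced by `Rep.unique` when it exists; the value `0` is used only
  -- for forests that do not represent a morphism of this type.
  let φ : Forest k n → (tpow M m ⟶ tpow M n) := fun w =>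
    if h : ∃ φ, Forest.Rep f m n w φ then h.choose else 0
  have hφ : ∀ w ψ, Forest.Rep f m n w ψ → Forest.Rep f m n w (φ w) ∧ φ w = ψ := by
    intro w ψ h
    have h' : ∃ φ, Forest.Rep f m n w φ := ⟨ψ, h⟩
    have e : φ w = h'.choose := dif_pos h'
    rw [e]
    refine ⟨h'.choose_spec, ?_⟩
    obtain ⟨_, e'⟩ := h'.choose_spec.unique h
    rw [e', tpowCast_rfl, Category.id_comp]
  suffices ∃ c : Forest k n →₀ ℤ, (∀ w ∈ c.support, Forest.Rep f m n w (φ w)) ∧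
      y = c.sum fun w z => z • φ w by
    obtain ⟨c, hc⟩ := this
    exact ⟨c, φ, hc⟩
  induction h using AddSubgroup.closure_induction with
  | mem y hy =>
    obtain ⟨w, hw⟩ := hy
    obtain ⟨h1, h2⟩ := hφ w y hw
    refine ⟨Finsupp.single w 1, fun w' hw' => ?_, ?_⟩
    · obtain rfl := Finset.mem_singleton.mp (Finsupp.support_single_subset hw')
      exact h1
    · rw [Finsupp.sum_single_index (zero_zsmul _), one_zsmul, h2]
  | zero => exact ⟨0, by simp, by simp⟩
  | add y y' _ _ h h' =>
    obtain ⟨c, hc, rfl⟩ := h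
    obtain ⟨c', hc', rfl⟩ := h'
    refine ⟨c + c', fun w hw => ?_, ?_⟩
    · rcases Finset.mem_union.mp (Finsupp.support_add hw) with hw | hw
      · exact hc w hw
      · exact hc' w hw
    · rw [Finsupp.sum_add_index' (fun _ => zero_zsmul _) (fun _ _ _ => add_zsmul _ _ _)]
  | neg y _ h =>
    obtain ⟨c, hc, rfl⟩ := h
    refine ⟨-c, fun w hw => hc w (by simpa using hw), ?_⟩
    rw [Finsupp.sum_neg_index (fun _ => zero_zsmul _), Finsupp.sum, Finsupp.sum,
      ← Finset.sum_neg_distrib]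
    simp

end Expansion

namespace MonPair

variable {I : Type} {k : I → ℕ} {l : ℕ}

theorem component_map [Finite I] (α : operadTCheck.{v, u}.Op I k l) {P Q : MonPair.{v, u}} (F : Hom P Q)
    (f : (i : I) → P.End (k i)) :
    component α.1 Q (fun i => F.map (k i) (f i)) = F.map l (component α.1 P f) := α.2 P Q F f

/-- A natural operation is determined by its value at the generic operations. -/
theorem component_eq [Finite I] (α : operadTCheck.{v, u}.Op I k l) (P : MonPair.{v, u})
    (f : (i : I) → P.End (k i)) : component α.1 P f =
      (GenCat.evalHom P f).map l (component α.1 (genPair.{v, u} k) (GenCat.genOp k)) := by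
  rw [← component_map]
  simp only [GenCat.evalHom_genOp]

theorem exists_expansion (x : (genPair.{v, u} k).End l) :
    ∃ (c : Forest k 1 →₀ ℤ)
      (φ : Forest k 1 → (tpow (genPair.{v, u} k).M.X l ⟶ tpow (genPair.{v, u} k).M.X 1)),
      (∀ w ∈ c.support, Forest.Rep (GenCat.genOp.{v, u} k) l 1 w (φ w)) ∧
        x = c.sum fun w z => z • (φ w ≫ tpowOne _) := by
  obtain ⟨c, φ, hc, h⟩ := Forest.exists_sum_of_mem_repSpan (GenCat.mem_repSpan l x)
  refine ⟨c, φ, hc, ?_⟩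
  have aux : ∀ {C : Type u} [Category.{v} C] [Preadditive C] {X Y Z : C} {x : X ⟶ Y} {s : Y ⟶ Z} {t : Z ⟶ Y}
      {φ : Forest k 1 → (X ⟶ Z)}, s ≫ t = 𝟙 Y → x ≫ s = c.sum (fun w z => z • φ w) →
      x = c.sum fun w z => z • (φ w ≫ t) := by
    intro C _ _ X Y Z x s t φ h e
    rw [← Category.comp_id x, ← h, ← Category.assoc, e, Finsupp.sum, Preadditive.sum_comp]
    simp [Finsupp.sum]
  exact aux (tpowOneInv_one _) h

variable {A : Type} [Ring A]

theorem rep_value {g : (i : I) → Hoch A (k i)} {w : Forest k 1}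
    {ψ : tpow (ringPair.{v, u} A).M.X l ⟶ tpow (ringPair.{v, u} A).M.X 1}
    (h : Forest.Rep (fun i => (RingPair.toHoch (k i)).symm (g i)) l 1 w ψ) (L : List A)
    (hL : L.length = l) :
    Forest.Val g w L [(RingPair.toHoch l (ψ ≫ tpowOne _)).app L] := by
  obtain ⟨R, hR, e⟩ := RingPair.exists_val h L hL
  simp only [AddEquiv.apply_symm_apply] at hR
  obtain ⟨y, rfl⟩ := List.length_eq_one_iff.mp hR.length
  have e' : RingPair.ofA.{v, u} ((RingPair.toHoch l (ψ ≫ tpowOne _)).app L) = RingPair.ofA y := by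
    rw [← RingPair.ap_tpL]
    exact (congrArg (RingPair.ap (tpowOne _)) e).trans (RingPair.ap_tpowOne [] y)
  rw [RingPair.ofA.injective e']
  exact hR

/-- The operation on the Hochschild cochains of a ring given by a natural operation. -/
noncomputable def toEndHoch [Finite I] (A : Type) [Ring A] (α : operadTCheck.{v, u}.Op I k l) :
    MultilinearMap ℤ (fun i => Hoch A (k i)) (Hoch A l) :=
  ((RingPair.toHoch.{v, u} (A := A) l).toAddMonoidHom.toIntLinearMap.compMultilinearMap
    (component α.1 (ringPair.{v, u} A))).compLinearMap
      fun i => (RingPair.toHoch (A := A) (k i)).symm.toAddMonoidHom.toIntLinearMap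

theorem toEndHoch_apply [Finite I] (α : operadTCheck.{v, u}.Op I k l) (g : (i : I) → Hoch A (k i)) :
    toEndHoch A α g = RingPair.toHoch l (component α.1 (ringPair.{v, u} A) fun i =>
      (RingPair.toHoch (k i)).symm (g i)) := rfl

/-- The expansion of a natural operation in forests. -/
theorem exists_toEndHoch_eq_sum [Finite I] (α : operadTCheck.{v, u}.Op I k l) :
    ∃ c : Forest k 1 →₀ ℤ,
      (c = 0 → α = 0) ∧
      ∀ (A : Type) [Ring A], ∃ (Y : ((i : I) → Hoch A (k i)) → Forest k 1 → Hoch A l),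
      (∀ g, ∀ w ∈ c.support, ∀ L : List A, L.length = l → Forest.Val g w L [(Y g w).app L]) ∧
      (∀ g, toEndHoch A α g = c.sum fun w z => z • Y g w) ∧
      ∀ g (z : I → ℤ), ∀ w ∈ c.support,
        Y (fun i => z i • g i) w = Forest.weight z w • Y g w := by
  classical
  -- The coefficients come from the free pair and thus do not depend on `A`; the forests are carried
  -- to the pair of `A` by `evalHom`.
  obtain ⟨c, φ, hc, e⟩ := exists_expansion (component α.1 (genPair.{v, u} k) (GenCat.genOp k))
  refine ⟨c, ?_, ?_⟩
  · rintro rfl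
    refine Subtype.ext (funext fun P => MultilinearMap.ext fun f => ?_)
    refine (component_eq α P f).trans ?_
    rw [e]
    exact map_zero _
  · intro A _
    have h1 : ∀ (g : (i : I) → Hoch A (k i)) (w : Forest k 1), ∃ ψ, w ∈ c.support →
        Forest.Rep (fun i => (RingPair.toHoch.{v, u} (k i)).symm (g i)) l 1 w ψ ∧
        (GenCat.evalHom (ringPair.{v, u} A) fun i => (RingPair.toHoch (k i)).symm (g i)).map l
          (φ w ≫ tpowOne _) = ψ ≫ tpowOne _ := by
      intro g w
      by_cases hw : w ∈ c.support
      · obtain ⟨ψ, h, h'⟩ := (GenCat.evalHom (ringPair.{v, u} A)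
          fun i => (RingPair.toHoch (k i)).symm (g i)).map_rep_comp_tpowOne (hc w hw)
        simp only [GenCat.evalHom_genOp] at h
        exact ⟨ψ, fun _ => ⟨h, h'⟩⟩
      · exact ⟨0, fun h => absurd h hw⟩
    choose ψ hψ using h1
    refine ⟨fun g w => RingPair.toHoch l (ψ g w ≫ tpowOne _), ?_, ?_, ?_⟩
    · intro g w hw L hL
      exact rep_value (hψ g w hw).1 L hL
    · intro g
      rw [toEndHoch_apply, component_eq, e, Finsupp.sum, Finsupp.sum, map_sum, map_sum]
      refine Finset.sum_congr rfl fun w hw => ?_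
      rw [map_zsmul, map_zsmul, (hψ g w hw).2]
    · intro g z w hw
      have h2 := (hψ (fun i => z i • g i) w hw).1
      simp only [map_zsmul] at h2
      -- Two morphisms represented by the same forest with the scaled operations are equal.
      obtain ⟨_, h3⟩ := h2.unique ((hψ g w hw).1.zsmul z)
      rw [tpowCast_rfl, Category.id_comp] at h3
      have aux : ∀ (t : tpow (ringPair.{v, u} A).M.X l ⟶ tpow (ringPair.{v, u} A).M.X 1) (n : ℤ),
        (n • t) ≫ tpowOne _ = n • (t ≫ tpowOne _) := fun t n => Preadditive.zsmul_comp _ _ _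
      exact (congrArg (fun t => RingPair.toHoch l (t ≫ tpowOne _)) h3).trans
        ((congrArg _ (aux _ _)).trans (map_zsmul _ _ _))

end MonPair

namespace MonPair

variable {I : Type} [Finite I] {k : I → ℕ} {l : ℕ}

/-- In the expansion of a natural operation on the cochains of the generic ring, each forest
contains each operation exactly once. -/
theorem count_eq_one (α : operadTCheck.{v, u}.Op I k l) : ∃ c : Forest k 1 →₀ ℤ,
    (c = 0 → α = 0) ∧ (toEndHoch GenericRing α = 0 → c = 0) ∧
      ∃ (Y : ((i : I) → Hoch GenericRing (k i)) → Forest k 1 → Hoch GenericRing l),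
      (∀ g, ∀ w ∈ c.support, ∀ L : List GenericRing, L.length = l →
        Forest.Val g w L [(Y g w).app L]) ∧
      (∀ g, toEndHoch GenericRing α g = c.sum fun w z => z • Y g w) ∧
      ∀ w ∈ c.support, ∀ i, Forest.count w i = 1 := by
  classical
  obtain ⟨_⟩ := nonempty_fintype I
  obtain ⟨c, hc, h⟩ := exists_toEndHoch_eq_sum α
  obtain ⟨Y, hval, hsum, hscale⟩ := h GenericRing
  obtain ⟨g, m, hm, hg⟩ := Forest.exists_separating k
  set L := List.replicate l (GenericRing.monomial [1]) with hL
  -- Distinct forests evaluate to distinct basis elements, so coefficients can be compared.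
  have hli := linearIndependent_iff'.mp (GenericRing.basis.linearIndependent.comp m hm)
  have hY : ∀ w ∈ c.support, (Y g w).app L = GenericRing.basis (m w) := fun w hw =>
    hg w L _ (hval g w hw L (by simp [hL])) fun x hx => List.eq_of_mem_replicate hx
  have happ : ∀ (d : Forest k 1 → ℤ),
      Hoch.app (∑ w ∈ c.support, d w • Y g w) L = ∑ w ∈ c.support, d w • GenericRing.basis (m w) := by
    intro d
    have : ∀ s : Finset (Forest k 1), Hoch.app (∑ w ∈ s, d w • Y g w) L =
        ∑ w ∈ s, d w • (Y g w).app L := fun s => by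
      simp [Hoch.app]
    rw [this]
    exact Finset.sum_congr rfl fun w hw => by rw [hY w hw]
  refine ⟨c, hc, fun h0 => ?_, Y, hval, hsum, fun w hw i => ?_⟩
  · have h1 := hsum g
    rw [h0] at h1
    have h2 := happ c
    rw [← Finsupp.sum.eq_1 c fun w z => z • Y g w, ← h1] at h2
    ext w
    by_contra hw
    exact hw (hli c.support c h2.symm w (Finsupp.mem_support_iff.mpr hw))
  -- Both sides are the coefficient of the monomial of `w` after scaling `g`: forest by forest on
  -- the left, by multilinearity on the right.
  · have key : ∀ z : I → ℤ, c w * Forest.weight z w = (∏ i, z i) * c w := by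
      intro z
      have h1 := hsum fun i => z i • g i
      have h2 : toEndHoch GenericRing α (fun i => z i • g i) =
          (∏ i, z i) • toEndHoch GenericRing α g := MultilinearMap.map_smul_univ _ _ _
      rw [h2, hsum g] at h1
      have h3 : ∑ w ∈ c.support, ((∏ i, z i) * c w) • Y g w =
          ∑ w ∈ c.support, (c w * Forest.weight z w) • Y g w := by
        refine Eq.trans ?_ (h1.trans (Finset.sum_congr rfl fun w hw => ?_))
        · simp [Finsupp.sum, Finset.smul_sum, mul_smul]
        · change c w • Y _ w = _
          rw [hscale g z w hw, mul_smul]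
      have h4 := congrArg (Hoch.app · L) h3
      simp only [happ] at h4
      have h5 := hli c.support (fun w => (∏ i, z i) * c w - c w * Forest.weight z w) (by
        simp only [sub_smul, Finset.sum_sub_distrib]
        exact sub_eq_zero.mpr h4) w hw
      exact (sub_eq_zero.mp h5).symm
    -- The product is now `2` and the weight a power of `2`, so the exponent, the number of
    -- occurrences of `i`, is one.
    have h1 := key (Function.update 1 i 2)
    rw [Forest.weight_update, Finset.prod_update_of_mem (Finset.mem_univ i), mul_comm] at h1
    have h2 := mul_right_cancel₀ (Finsupp.mem_support_iff.mp hw) h1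
    simp only [Pi.one_apply, Finset.prod_const_one, mul_one] at h2
    exact Nat.pow_right_injective le_rfl (by exact_mod_cast h2)

/-- The expansion is an integral combination of forests that use each operation once, each of which
is a generated operation. -/
theorem isGenerated_toEndHoch (α : operadTCheck.{v, u}.Op I k l) :
    Hoch.IsGenerated (toEndHoch GenericRing α) := by
  obtain ⟨c, -, -, Y, hval, hsum, hcount⟩ := count_eq_one α
  have h1 : ∀ w, ∃ τ : MultilinearMap ℤ (fun i => Hoch GenericRing (k i)) (Hoch GenericRing l),
      w ∈ c.support → Hoch.IsGenerated τ ∧ ∀ g, τ g = Y g w := by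
    intro w
    by_cases hw : w ∈ c.support
    · have hl : Forest.leaves w = l := by
        -- Any list of length `l` would do; it only serves to count the leaves.
        have := (hval 0 w hw (List.replicate l 0) (by simp)).length_left
        simpa using this.symm
      subst hl
      obtain ⟨τ, hτ, h⟩ := Forest.exists_isGenerated (A := GenericRing) w (hcount w hw)
      exact ⟨τ, fun _ => ⟨hτ, fun g => Hoch.ext_app fun L hL => h g L _ (hval g w hw L hL)⟩⟩
    · exact ⟨0, fun h => absurd h hw⟩
  choose τ hτ using h1
  have h2 : toEndHoch GenericRing α = ∑ w ∈ c.support, c w • τ w := by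
    ext g : 1
    rw [hsum, Finsupp.sum, sum_apply]
    exact Finset.sum_congr rfl fun w hw =>
      congrArg (c w • ·) ((hτ w hw).2 g).symm
  rw [h2]
  exact AddSubgroup.sum_mem (((ColOperad.endOperad (Hoch GenericRing)).closure
    (Hoch.IsElementary GenericRing)).carrier I k l) fun w hw =>
      AddSubgroup.zsmul_mem _ (hτ w hw).1 _

theorem toEndHoch_injective {α : operadTCheck.{v, u}.Op I k l}
    (h : toEndHoch GenericRing α = 0) : α = 0 := by
  obtain ⟨c, h1, h2, -⟩ := count_eq_one α
  exact h1 (h2 h)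

/-! ### Evaluation at the generic ring as an isomorphism of operads. -/

section

variable (A : Type) [Ring A]

theorem toEndHoch_add (α β : operadTCheck.{v, u}.Op I k l) :
    toEndHoch A (α + β) = toEndHoch A α + toEndHoch A β := by
  ext g : 1
  exact map_add (RingPair.toHoch.{v, u} l) _ _

theorem toEndHoch_one (c : ℕ) :
    toEndHoch A (operadTCheck.{v, u}.one c) = (ColOperad.endOperad (Hoch A)).one c := by
  refine MultilinearMap.ext fun g => ?_
  exact (RingPair.toHoch.{v, u} c).apply_symm_apply (g ())

theorem toEndHoch_comp {J : I → Type} [∀ i, Finite (J i)] {m : (i : I) → J i → ℕ}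
    (x : operadTCheck.{v, u}.Op I k l) (y : (i : I) → operadTCheck.{v, u}.Op (J i) (m i) (k i)) :
    toEndHoch A (operadTCheck.{v, u}.comp x y) =
      (ColOperad.endOperad (Hoch A)).comp (toEndHoch A x) (fun i => toEndHoch A (y i)) := by
  refine MultilinearMap.ext fun g => ?_
  refine congrArg (fun t => RingPair.toHoch.{v, u} l (component x.1 (ringPair A) t))
    (funext fun i => ?_)
  exact ((RingPair.toHoch.{v, u} (k i)).symm_apply_apply _).symm

theorem toEndHoch_act {J : Type} [Finite J] (e : I ≃ J) {k : J → ℕ}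
    (x : operadTCheck.{v, u}.Op I (fun i => k (e i)) l) :
    toEndHoch A (operadTCheck.{v, u}.act (k := k) e x) =
      (ColOperad.endOperad (Hoch A)).act e (toEndHoch A x) := rfl

end

/-- The insertion as a natural operation. -/
def insertOp (a l b : ℕ) : operadTCheck.{v, u}.Op (Fin 2) ![a + 1 + b, l] (a + l + b) :=
  ⟨fun P => ColOperad.bilinOp (P.insert a l b), fun _ _ F f => (F.map_insert a l b (f 0) (f 1)).symm⟩

/-- A natural constant. -/
def constOp {l : ℕ} (c : (P : MonPair.{v, u}) → P.End l)
    (h : ∀ {P Q : MonPair.{v, u}} (F : Hom P Q), F.map l (c P) = c Q) :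
    operadTCheck.{v, u}.Op (Fin 0) ![] l :=
  ⟨fun P => ColOperad.constOp (c P), fun _ _ F _ => (h F).symm⟩

variable (A : Type) [Ring A]

theorem toEndHoch_insertOp (a l b : ℕ) :
    toEndHoch A (insertOp.{v, u} a l b) = ColOperad.bilinOp (Hoch.insert (A := A) a l b) := by
  refine MultilinearMap.ext fun g => ?_
  refine (RingPair.toHoch_insert.{v, u} a l b _ _).trans ?_
  exact congrArg₂ (fun s t => Hoch.insert (A := A) a l b s t)
    ((RingPair.toHoch _).apply_symm_apply (g 0)) ((RingPair.toHoch _).apply_symm_apply (g 1))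

theorem toEndHoch_constOp {l : ℕ} (c : (P : MonPair.{v, u}) → P.End l)
    (h : ∀ {P Q : MonPair.{v, u}} (F : Hom P Q), F.map l (c P) = c Q) :
    toEndHoch A (constOp c h) = ColOperad.constOp (X := Hoch A) (RingPair.toHoch l (c (ringPair A))) :=
  rfl

variable {A}

/-- Surjectivity, for any ring: the elementary operations come from natural ones, and evaluation
respects every construction allowed in the generated suboperad. -/
theorem exists_toEndHoch_eq {τ : (ColOperad.endOperad (Hoch A)).Op I k l}
    (h : ColOperad.Generated (ColOperad.endOperad (Hoch A)) (Hoch.IsElementary A) I k l τ) :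
    ∃ α : operadTCheck.{v, u}.Op I k l, toEndHoch A α = τ := by
  induction h with
  | basic I k l τ h =>
    cases h with
    | insert a l b => exact ⟨_, toEndHoch_insertOp A a l b⟩
    | mul => exact ⟨constOp mul fun F => F.map_mul, (toEndHoch_constOp A _ _).trans
      (congrArg (ColOperad.constOp (X := Hoch A)) RingPair.toHoch_mul)⟩
    | id => exact ⟨constOp id fun F => F.map_id, (toEndHoch_constOp A _ _).trans
      (congrArg (ColOperad.constOp (X := Hoch A)) RingPair.toHoch_id)⟩
    | one => exact ⟨constOp one fun F => F.map_one, (toEndHoch_constOp A _ _).trans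
      (congrArg (ColOperad.constOp (X := Hoch A)) RingPair.toHoch_one)⟩
  | one c => exact ⟨_, toEndHoch_one A c⟩
  | comp I J k m l x y _ _ ih ih' =>
    obtain ⟨α, rfl⟩ := ih
    choose β hβ using ih'
    exact ⟨_, (toEndHoch_comp A α β).trans (congrArg _ (funext hβ))⟩
  | act I J e k l x _ ih =>
    obtain ⟨α, rfl⟩ := ih
    exact ⟨_, toEndHoch_act A e α⟩
  | zero I k l => exact ⟨0, MultilinearMap.ext fun g => map_zero (RingPair.toHoch.{v, u} l)⟩
  | add I k l x y _ _ ih ih' =>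
    obtain ⟨α, rfl⟩ := ih
    obtain ⟨β, rfl⟩ := ih'
    exact ⟨α + β, toEndHoch_add A α β⟩
  | neg I k l x _ ih =>
    obtain ⟨α, rfl⟩ := ih
    exact ⟨-α, MultilinearMap.ext fun g => map_neg (RingPair.toHoch.{v, u} l) _⟩

/-- Natural operations are operations on the Hochschild cochains of the generic ring. -/
noncomputable def toOperadT (I : Type) [Finite I] (k : I → ℕ) (l : ℕ) :
    operadTCheck.{v, u}.Op I k l ≃+ operadT.Op I k l :=
  AddEquiv.ofBijective (AddMonoidHom.mk' (M := operadTCheck.{v, u}.Op I k l)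
      (G := operadT.Op I k l) (fun α => ⟨toEndHoch GenericRing α, isGenerated_toEndHoch α⟩)
      (fun α β => Subtype.ext (toEndHoch_add GenericRing α β))) (by
    constructor
    · rw [injective_iff_map_eq_zero]
      exact fun α h => toEndHoch_injective (congrArg Subtype.val h)
    · intro τ
      obtain ⟨α, h⟩ := exists_toEndHoch_eq τ.2
      exact ⟨α, Subtype.ext h⟩)

/-- The isomorphism of the operad `T` with the operad of natural operations. -/
noncomputable def operadTIso : ColOperad.Iso operadT operadTCheck.{v, u} where
  toEquiv I _ k l := (toOperadT I k l).symm
  map_one c := (AddEquiv.symm_apply_eq _).mpr (Subtype.ext (toEndHoch_one GenericRing c).symm)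
  map_comp {I _ J _ k m l} x y := by
    refine (AddEquiv.symm_apply_eq _).mpr (Subtype.ext ?_)
    refine Eq.trans ?_ (toEndHoch_comp GenericRing _ _).symm
    refine congrArg₂ (fun s t => (ColOperad.endOperad (Hoch GenericRing)).comp s t)
      (congrArg Subtype.val ((toOperadT.{v, u} I k l).apply_symm_apply x)).symm (funext fun i => ?_)
    exact (congrArg Subtype.val ((toOperadT.{v, u} _ _ _).apply_symm_apply (y i))).symm
  map_act {I J _ _} e k l x := by
    refine (AddEquiv.symm_apply_eq _).mpr (Subtype.ext ?_)
    refine Eq.trans ?_ (toEndHoch_act GenericRing e _).symm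
    exact congrArg (fun s => (ColOperad.endOperad (Hoch GenericRing)).act e s)
      (congrArg Subtype.val ((toOperadT.{v, u} I _ l).apply_symm_apply x)).symm

end MonPair

/-! ### Uniqueness and the values on the elementary operations. -/

theorem ColOperad.Iso.ext_toEquiv {C : Type*} {P Q : ColOperad C} {Φ Ψ : ColOperad.Iso P Q}
    (h : ∀ (I : Type) [Finite I] (k : I → C) (l : C) (x : P.Op I k l),
      Φ.toEquiv I k l x = Ψ.toEquiv I k l x) : Φ = Ψ := by
  cases Φ
  cases Ψ
  congr
  funext I _ k l
  exact AddEquiv.ext (h I k l)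

/-- Isomorphisms from a generated suboperad are determined by the images of the generators. -/
theorem ColOperad.Iso.ext_closure {C : Type*} {P : ColOperad C} {Q : ColOperad C}
    {S : (I : Type) → [Finite I] → (k : I → C) → (l : C) → P.Op I k l → Prop}
    {Φ Ψ : ColOperad.Iso (P.closure S).toOperad Q}
    (h : ∀ (I : Type) [Finite I] (k : I → C) (l : C) (x : P.Op I k l) (hx : S I k l x),
      Φ.toEquiv I k l ⟨x, .basic _ _ _ _ hx⟩ = Ψ.toEquiv I k l ⟨x, .basic _ _ _ _ hx⟩) : Φ = Ψ := by
  refine ColOperad.Iso.ext_toEquiv ?_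
  rintro I _ k l ⟨x, hx⟩
  induction hx with
  | basic I k l x hx => exact h I k l x hx
  | one c => exact (Φ.map_one c).trans (Ψ.map_one c).symm
  | comp I J k m l x y hx hy ih ih' =>
    refine (Φ.map_comp (⟨x, hx⟩ : (P.closure S).toOperad.Op I k l) (fun i => ⟨y i, hy i⟩)).trans
      (Eq.trans ?_ (Ψ.map_comp (⟨x, hx⟩ : (P.closure S).toOperad.Op I k l)
        (fun i => ⟨y i, hy i⟩)).symm)
    rw [ih]
    simp only [ih']
  | act I J e k l x hx ih =>
    refine (Φ.map_act e (⟨x, hx⟩ : (P.closure S).toOperad.Op I _ l)).trans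
      (Eq.trans ?_ (Ψ.map_act e (⟨x, hx⟩ : (P.closure S).toOperad.Op I _ l)).symm)
    rw [ih]
  | zero I k l => exact (map_zero (Φ.toEquiv I k l)).trans (map_zero (Ψ.toEquiv I k l)).symm
  | add I k l x y hx hy ih ih' =>
    refine (map_add (Φ.toEquiv I k l) ⟨x, hx⟩ ⟨y, hy⟩).trans
      (Eq.trans ?_ (map_add (Ψ.toEquiv I k l) ⟨x, hx⟩ ⟨y, hy⟩).symm)
    rw [ih, ih']
  | neg I k l x hx ih =>
    refine (map_neg (Φ.toEquiv I k l) ⟨x, hx⟩).trans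
      (Eq.trans ?_ (map_neg (Ψ.toEquiv I k l) ⟨x, hx⟩).symm)
    rw [ih]

theorem MonPair.operadTIso_elementary :
    (∀ (a l b : ℕ) (P : MonPair.{v, u}),
      MonPair.evalAt (MonPair.operadTIso.{v, u}.toEquiv (Fin 2) ![a + 1 + b, l] (a + l + b) (Hoch.insertT a l b)) P =
        ColOperad.bilinOp (P.insert a l b)) ∧
    (∀ P : MonPair.{v, u},
      MonPair.evalAt (MonPair.operadTIso.{v, u}.toEquiv (Fin 0) ![] 2 Hoch.mulT) P = ColOperad.constOp P.mul) ∧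
    (∀ P : MonPair.{v, u},
      MonPair.evalAt (MonPair.operadTIso.{v, u}.toEquiv (Fin 0) ![] 1 Hoch.idT) P = ColOperad.constOp P.id) ∧
    (∀ P : MonPair.{v, u},
      MonPair.evalAt (MonPair.operadTIso.{v, u}.toEquiv (Fin 0) ![] 0 Hoch.oneT) P = ColOperad.constOp P.one) := by
  refine ⟨fun a l b P => ?_, fun P => ?_, fun P => ?_, fun P => ?_⟩
  · have h : MonPair.operadTIso.{v, u}.toEquiv _ _ _ (Hoch.insertT a l b) =
        MonPair.insertOp a l b := (AddEquiv.symm_apply_eq _).mpr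
      (Subtype.ext (MonPair.toEndHoch_insertOp GenericRing a l b).symm)
    rw [h]
    rfl
  · have h : MonPair.operadTIso.{v, u}.toEquiv _ _ _ Hoch.mulT =
        MonPair.constOp MonPair.mul fun F => F.map_mul := (AddEquiv.symm_apply_eq _).mpr
      (Subtype.ext (congrArg ColOperad.constOp RingPair.toHoch_mul.symm))
    rw [h]
    rfl
  · have h : MonPair.operadTIso.{v, u}.toEquiv _ _ _ Hoch.idT =
        MonPair.constOp MonPair.id fun F => F.map_id := (AddEquiv.symm_apply_eq _).mpr
      (Subtype.ext (congrArg ColOperad.constOp RingPair.toHoch_id.symm))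
    rw [h]
    rfl
  · have h : MonPair.operadTIso.{v, u}.toEquiv _ _ _ Hoch.oneT =
        MonPair.constOp MonPair.one fun F => F.map_one := (AddEquiv.symm_apply_eq _).mpr
      (Subtype.ext (congrArg ColOperad.constOp RingPair.toHoch_one.symm))
    rw [h]
    rfl

/-- The `ℕ`-coloured operads `T` and `Ť` are naturally isomorphic: there is a unique isomorphism
that takes the elementary operations on Hochschild cochains (the insertions, the product, the
identity and the unit) to the corresponding operations on monoids in monoidal categories. -/
theorem mainTheorem6 :
    ∃! Φ : ColOperad.Iso operadT MonPair.operadTCheck.{v, u},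
      (∀ (a l b : ℕ) (P : MonPair.{v, u}),
        MonPair.evalAt (Φ.toEquiv (Fin 2) ![a + 1 + b, l] (a + l + b) (Hoch.insertT a l b)) P =
          ColOperad.bilinOp (P.insert a l b)) ∧
      (∀ P : MonPair.{v, u},
        MonPair.evalAt (Φ.toEquiv (Fin 0) ![] 2 Hoch.mulT) P = ColOperad.constOp P.mul) ∧
      (∀ P : MonPair.{v, u},
        MonPair.evalAt (Φ.toEquiv (Fin 0) ![] 1 Hoch.idT) P = ColOperad.constOp P.id) ∧
      (∀ P : MonPair.{v, u},
        MonPair.evalAt (Φ.toEquiv (Fin 0) ![] 0 Hoch.oneT) P = ColOperad.constOp P.one) := by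
  refine ⟨MonPair.operadTIso, MonPair.operadTIso_elementary, fun Φ hΦ => ?_⟩
  obtain ⟨h1, h2, h3, h4⟩ := MonPair.operadTIso_elementary.{v, u}
  obtain ⟨h1', h2', h3', h4'⟩ := hΦ
  refine ColOperad.Iso.ext_closure ?_
  intro I _ k l x hx
  refine Subtype.ext (funext fun P => ?_)
  cases hx with
  | insert a l b => exact (h1' a l b P).trans (h1 a l b P).symm
  | mul => exact (h2' P).trans (h2 P).symm
  | id => exact (h3' P).trans (h3 P).symm
  | one => exact (h4' P).trans (h4 P).symm
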